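/- **Setting.** Let $M\ge 1$, let $\vec N=(N_1,\dots,N_M)$ be positive integers, $|\vec N|=\sum_k N_k$, $X=\{0,\dots,N_1\}\times\cdots\times\{0,\dots,N_M\}$, $|\eta|=\sum_k\eta_k$ for $\eta\in X$, and let $\lambda,\rho,v\in\mathbb R$. Put $$h^+_k(\xi)=\rho+\sum_{j=k}^M(2\xi_j-N_j),\qquad h^-_k(\zeta)=\lambda+\sum_{j=1}^k(2\zeta_j-N_j).$$ Let $\eta^{k,l}$ be $\eta$ after a particle has moved from site $k$ to site $l$. $\mathrm{SSEP}_{\mathsf R}(\vec N,\rho)$ is the particle system on $X$ in which, for $1\le k\le M-1$, a particle jumps from $k$ to $k+1$ and from $k+1$ to $k$ with the respective rates $$\frac{\xi_k(N_{k+1}-\xi_{k+1})(h^+_k-\xi_k)(h^+_{k+1}-\xi_{k+1})}{h^+_{k+1}(h^+_{k+1}+1)},\qquad \frac{\xi_{k+1}(N_k-\xi_k)(h^+_{k+1}+\xi_k)(h^+_{k+2}+\xi_{k+1})}{h^+_{k+1}(h^+_{k+1}-1)}.$$ $\mathrm{SSEP}_{\mathsf L}(\vec N,\lambda)$ is the one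 with respective rates $$\frac{\zeta_k(N_{k+1}-\zeta_{k+1})(h^-_{k-1}+\zeta_k)(h^-_k+\zeta_{k+1})}{h^-_k(h^-_k-1)},\qquad \frac{\zeta_{k+1}(N_k-\zeta_k)(h^-_k-\zeta_k)(h^-_{k+1}-\zeta_{k+1})}{h^-_k(h^-_k+1)}.$$ The generators $L^{\mathsf R}$, $L^{\mathsf L}$ are $Lf(\eta)=\sum_{k=1}^{M-1}\big(c_k^+(\eta)[f(\eta^{k,k+1})-f(\eta)]+c^-_{k+1}(\eta)[f(\eta^{k+1,k})-f(\eta)]\big)$ with these rates. (They are Markov generators when the rates are nonnegative, for example when $|\rho|,|\lambda|>|\vec N|$; nonnegativity is not needed below.) **Duality function.** With $(a)_n=a(a+1)\cdots(a+n-1)$ and the Racah polynomials $$\hat R_n(x;\alpha,\beta,\gamma,\delta)={}_4F_3\!\left({-n,\;n+\alpha+\beta+1,\;-x,\;x+\gamma+\delta+1\atop \alpha+1,\;\beta+\delta+1,\;\gamma+1};1\right),$$ let $$\hat r(y,x;\lambda,\rho,v,N)=\frac{(\frac12(\rho+\lambda-N+v+1))_x(\frac12(\rho+\lambda-N-v+1))_y(y+\frac12(\lambda-\rho-N+v+1))_N}{(-x+\frac12(\lambda-\rho+N+v+1))_{x+y}}\hat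 R_x\big(y;\tfrac12(\rho+\lambda-N-v-1),\tfrac12(\rho-\lambda-N+v-1),-N-1,\lambda\big)$$ and $$\hat R^v(\zeta,\xi)=\prod_{k=1}^M\hat r(\zeta_k,\xi_k;h^-_{k-1}(\zeta),h^+_{k+1}(\xi),v,N_k).$$ **Weights.** Let $$\hat W(x;N,\rho)=(-1)^x\,\frac{2x+\rho-N}{\rho-N}\,\frac{(\rho-N)_x}{(\rho+1)_x(-\rho)_N}\binom Nx,$$ $$\hat W_{\mathsf R}(\xi)=\prod_{k=1}^M\hat W(\xi_k;N_k,h^+_{k+1}(\xi)),\qquad \hat W_{\mathsf L}(\zeta)=\prod_{k=1}^M(-1)^{N_k}\hat W(\zeta_k;N_k,h^-_{k-1}(\zeta)).$$ **The $q$-objects.** For $q>0$, $q\ne1$, put $(a;p)_n=\prod_{i=0}^{n-1}(1-ap^i)$, $\binom nk_p=\frac{(p;p)_n}{(p;p)_k(p;p)_{n-k}}$, $$R_n(x;\alpha,\beta,\gamma,\delta;p)={}_4\varphi_3\!\left({p^{-n},\alpha\beta p^{n+1},p^{-x},\gamma\delta p^{x+1}\atop\alpha p,\beta\delta p,\gamma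 p};p,p\right),$$ where ${}_4\varphi_3\!\left({a_1,\dots,a_4\atop b_1,b_2,b_3};p,z\right)=\sum_{n\ge0}\frac{(a_1;p)_n\cdots(a_4;p)_n}{(b_1;p)_n(b_2;p)_n(b_3;p)_n}\frac{z^n}{(p;p)_n}$, and, for complex $\lambda,\rho,v$ with $v\neq0$, $$r(y,x;\lambda,\rho,v,N;q)=v^y\frac{(-vq^{\rho+\lambda-N+1};q^2)_x(-v^{-1}q^{\rho+\lambda-N+1};q^2)_y(vq^{2y-\rho+\lambda-N+1};q^2)_N}{q^{y(y+\rho+\lambda-N)}(vq^{-2x-\rho+\lambda+N+1};q^2)_{x+y}}\,R_x\big(y;-v^{-1}q^{\rho+\lambda-N-1},vq^{\rho-\lambda-N-1},q^{-2N-2},-q^{2\lambda};q^2\big),$$ $$W(x;N,\rho;q)=\frac{1+q^{4x+2\rho-2N}}{1+q^{2\rho-2N}}\frac{(-q^{2\rho-2N};q^2)_x}{(-q^{2\rho+2};q^2)_x}\frac{q^{-x(2\rho+1+x-2N)}}{(-q^{-2\rho};q^2)_N}\binom Nx_{q^2},$$ $$R^v(\zeta,\xi;\lambda,\rho;q)=\prod_k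 r(\zeta_k,\xi_k;h^-_{k-1}(\zeta),h^+_{k+1}(\xi),v,N_k;q),$$ $$W_{\mathsf R}(\xi;\rho;q)=\prod_kW(\xi_k;N_k,h^+_{k+1}(\xi);q),\qquad W_{\mathsf L}(\zeta;\lambda;q)=\prod_kW(\zeta_k;N_k,h^-_{k-1}(\zeta);q^{-1}).$$ Write $\tilde s=s+\frac{\pi i}{2\ln q}$ for $s\in\{\lambda,\rho\}$. **Proposition.** Assume that no denominator in the formula for $\hat R^v$ vanishes, for any $\zeta,\xi\in X$; that is, for all $\zeta,\xi,k$, with $a=h^-_{k-1}(\zeta)$ and $b=h^+_{k+1}(\xi)$, the numbers $(\frac12(a+b-N_k\pm v+1))_{\min(\zeta_k,\xi_k)}$ and $(-\xi_k+\frac12(a-b+N_k+v+1))_{\xi_k+\zeta_k}$ are nonzero. 1. For all $\zeta,\xi\in X$, $\displaystyle\lim_{q\to1}(1-q^2)^{-|\vec N|}R^{q^v}(\zeta,\xi;\tilde\lambda,\tilde\rho;q)=(-1)^{|\zeta|}\hat R^v(\zeta,\xi)$. 2. If no denominator in the rate of a possible jump of either process vanishes, then $\hat R^v$ is a duality function between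 $\mathrm{SSEP}_{\mathsf L}(\vec N,\lambda)$ and $\mathrm{SSEP}_{\mathsf R}(\vec N,\rho)$: for all $\zeta,\xi\in X$, $$[L^{\mathsf L}\hat R^v(\,\cdot\,,\xi)](\zeta)=[L^{\mathsf R}\hat R^v(\zeta,\,\cdot\,)](\xi).$$ 3. If $\lambda\notin\{-|\vec N|,\dots,|\vec N|\}$, then $\hat W_{\mathsf L}(\zeta)=\lim_{q\to1}(1-q^2)^{|\vec N|}W_{\mathsf L}(\zeta;\tilde\lambda;q)\ne0$ for all $\zeta\in X$, and $\hat W_{\mathsf L}$ is a (signed) reversible measure of $\mathrm{SSEP}_{\mathsf L}(\vec N,\lambda)$, i.e. satisfies detailed balance. If $\rho\notin\{-|\vec N|,\dots,|\vec N|\}$, the same holds for $\hat W_{\mathsf R}$, $W_{\mathsf R}(\,\cdot\,;\tilde\rho;q)$ and $\mathrm{SSEP}_{\mathsf R}(\vec N,\rho)$. 4. If $\lambda,\rho\notin\{-|\vec N|,\dots,|\vec N|\}$ and no denominator in $\hat R^{-v}$ vanishes either, then $$\sum_{\zeta\in X}\hat R^v(\zeta,\xi)\hat R^{-v}(\zeta,\xi')\hat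 W_{\mathsf L}(\zeta)=\frac{\delta_{\xi,\xi'}}{\hat W_{\mathsf R}(\xi)},\qquad \sum_{\xi\in X}\hat R^v(\zeta,\xi)\hat R^{-v}(\zeta',\xi)\hat W_{\mathsf R}(\xi)=\frac{\delta_{\zeta,\zeta'}}{\hat W_{\mathsf L}(\zeta)}.$$ -/

import Mathlib

open scoped Topology BigOperators

namespace DynSSEP

noncomputable section

/-! ### Configurations, height functions and particle jumps

Sites are indexed by `Fin M`; the index `i` stands for the site `k = i + 1` of `{1, …, M}`. -/

/-- The state space `X = {0,…,N₁} × ⋯ × {0,…,N_M}`. -/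
abbrev Config {M : ℕ} (N : Fin M → ℕ) : Type := (k : Fin M) → Fin (N k + 1)

/-- `|N| = N₁ + ⋯ + N_M`. -/
def capacity {M : ℕ} (N : Fin M → ℕ) : ℕ := ∑ k, N k

/-- `|η| = η₁ + ⋯ + η_M`. -/
def particles {M : ℕ} {N : Fin M → ℕ} (η : Config N) : ℕ := ∑ k, (η k : ℕ)

/-- `heightR rho ξ i` is `rho + ∑ (2 ξ_j - N_j)` over all sites with index `≥ i`. With `k = i + 1`
this is `h⁺_k(ξ)`, so that `h⁺_{k+1}(ξ)` is `heightR rho ξ (i + 1)` and `h⁺_{M+1} = rho`. -/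
def heightR {K : Type*} [CommRing K] {M : ℕ} {N : Fin M → ℕ} (rho : K) (ξ : Config N) (i : ℕ) : K :=
  rho + ∑ j : Fin M, if i ≤ (j : ℕ) then 2 * ((ξ j : ℕ) : K) - (N j : K) else 0

/-- `heightL lam ζ i` is `lam + ∑ (2 ζ_j - N_j)` over the first `i` sites, that is `h⁻_i(ζ)`.
For the site `k = i + 1` of index `i`, `h⁻_{k-1}(ζ)` is `heightL lam ζ i` and `h⁻_k(ζ)` is
`heightL lam ζ (i + 1)`. -/
def heightL {K : Type*} [CommRing K] {M : ℕ} {N : Fin M → ℕ} (lam : K) (ζ : Config N) (i : ℕ) : K :=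
  lam + ∑ j : Fin M, if (j : ℕ) < i then 2 * ((ζ j : ℕ) : K) - (N j : K) else 0

/-- The configuration after a particle has jumped from site `i` to site `j` (unchanged if site `i`
is empty or site `j` is full; such jumps have rate zero). -/
def jump {M : ℕ} {N : Fin M → ℕ} (η : Config N) (i j : Fin M) : Config N :=
  if h : 0 < (η i : ℕ) ∧ (η j : ℕ) < N j then
    Function.update
      (Function.update η i ⟨(η i : ℕ) - 1, lt_of_le_of_lt (Nat.sub_le _ _) (η i).isLt⟩)
      j ⟨(η j : ℕ) + 1, Nat.succ_lt_succ h.2⟩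
  else η

/-! ### The processes -/

/-- Right process, `j` the right neighbour of `i`: rate of a jump from `i` to `j`. -/
def rateRRight {M : ℕ} {N : Fin M → ℕ} (rho : ℝ) (ξ : Config N) (i j : Fin M) : ℝ :=
  ((ξ i : ℕ) : ℝ) * ((N j : ℝ) - ((ξ j : ℕ) : ℝ))
      * (heightR rho ξ i - ((ξ i : ℕ) : ℝ)) * (heightR rho ξ j - ((ξ j : ℕ) : ℝ))
    / (heightR rho ξ j * (heightR rho ξ j + 1))

/-- Right process, `j` the right neighbour of `i`: rate of a jump from `j` to `i`. -/
def rateRLeft {M : ℕ} {N : Fin M → ℕ} (rho : ℝ) (ξ : Config N) (i j : Fin M) : ℝ :=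
  ((ξ j : ℕ) : ℝ) * ((N i : ℝ) - ((ξ i : ℕ) : ℝ))
      * (heightR rho ξ j + ((ξ i : ℕ) : ℝ)) * (heightR rho ξ (j + 1) + ((ξ j : ℕ) : ℝ))
    / (heightR rho ξ j * (heightR rho ξ j - 1))

/-- Left process, `j` the right neighbour of `i`: rate of a jump from `i` to `j`. -/
def rateLRight {M : ℕ} {N : Fin M → ℕ} (lam : ℝ) (ζ : Config N) (i j : Fin M) : ℝ :=
  ((ζ i : ℕ) : ℝ) * ((N j : ℝ) - ((ζ j : ℕ) : ℝ))
      * (heightL lam ζ i + ((ζ i : ℕ) : ℝ)) * (heightL lam ζ (i + 1) + ((ζ j : ℕ) : ℝ))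
    / (heightL lam ζ (i + 1) * (heightL lam ζ (i + 1) - 1))

/-- Left process, `j` the right neighbour of `i`: rate of a jump from `j` to `i`. -/
def rateLLeft {M : ℕ} {N : Fin M → ℕ} (lam : ℝ) (ζ : Config N) (i j : Fin M) : ℝ :=
  ((ζ j : ℕ) : ℝ) * ((N i : ℝ) - ((ζ i : ℕ) : ℝ))
      * (heightL lam ζ j - ((ζ i : ℕ) : ℝ)) * (heightL lam ζ (j + 1) - ((ζ j : ℕ) : ℝ))
    / (heightL lam ζ j * (heightL lam ζ j + 1))

/-- The Markov generator of a nearest neighbour particle system: the sum over all pairs of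
neighbouring sites `(i, j)`, `j = i + 1`, with `cR η i j` the rate of a jump from `i` to `j` and
`cL η i j` the rate of a jump from `j` to `i`. -/
def generator {M : ℕ} {N : Fin M → ℕ} (cR cL : Config N → Fin M → Fin M → ℝ)
    (f : Config N → ℝ) (η : Config N) : ℝ :=
  ∑ i : Fin M, ∑ j : Fin M,
    if (i : ℕ) + 1 = (j : ℕ) then
      cR η i j * (f (jump η i j) - f η) + cL η i j * (f (jump η j i) - f η)
    else 0

/-- Generator of the dynamic symmetric exclusion process with right boundary value `rho`. -/
def generatorR {M : ℕ} (N : Fin M → ℕ) (rho : ℝ) : (Config N → ℝ) → Config N → ℝ :=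
  generator (rateRRight rho) (rateRLeft rho)

/-- Generator of the dynamic symmetric exclusion process with left boundary value `lam`. -/
def generatorL {M : ℕ} (N : Fin M → ℕ) (lam : ℝ) : (Config N → ℝ) → Config N → ℝ :=
  generator (rateLRight lam) (rateLLeft lam)

/-- The rates of the right process are well defined: no denominator of a possible jump vanishes. -/
def RatesDefinedR {M : ℕ} (N : Fin M → ℕ) (rho : ℝ) : Prop :=
  ∀ (ξ : Config N) (i j : Fin M), (i : ℕ) + 1 = (j : ℕ) →
    (0 < (ξ i : ℕ) → (ξ j : ℕ) < N j → heightR rho ξ j * (heightR rho ξ j + 1) ≠ 0) ∧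
    (0 < (ξ j : ℕ) → (ξ i : ℕ) < N i → heightR rho ξ j * (heightR rho ξ j - 1) ≠ 0)

/-- The rates of the left process are well defined: no denominator of a possible jump vanishes. -/
def RatesDefinedL {M : ℕ} (N : Fin M → ℕ) (lam : ℝ) : Prop :=
  ∀ (ζ : Config N) (i j : Fin M), (i : ℕ) + 1 = (j : ℕ) →
    (0 < (ζ i : ℕ) → (ζ j : ℕ) < N j →
      heightL lam ζ (i + 1) * (heightL lam ζ (i + 1) - 1) ≠ 0) ∧
    (0 < (ζ j : ℕ) → (ζ i : ℕ) < N i → heightL lam ζ j * (heightL lam ζ j + 1) ≠ 0)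

/-- Markov duality of (the processes with generators) `L` and `L'` with duality function `D`. -/
def IsDuality {A B : Type*} (L : (A → ℝ) → A → ℝ) (L' : (B → ℝ) → B → ℝ) (D : A → B → ℝ) : Prop :=
  ∀ (a : A) (b : B), L (fun a' => D a' b) a = L' (fun b' => D a b') b

/-- Detailed balance `μ(a) L(a,b) = μ(b) L(b,a)`, where `L(a,b) = (L δ_b)(a)` is, for `a ≠ b`, the
jump rate from `a` to `b`. -/
def IsReversible {A : Type*} [DecidableEq A] (L : (A → ℝ) → A → ℝ) (μ : A → ℝ) : Prop :=
  ∀ a b : A, μ a * L (Pi.single b 1) a = μ b * L (Pi.single a 1) b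

/-! ### Hypergeometric series and Racah polynomials -/

/-- The shifted factorial `(a)_n = a (a+1) ⋯ (a+n-1)`. -/
def poch (a : ℝ) (n : ℕ) : ℝ := ∏ i ∈ Finset.range n, (a + i)

/-- The hypergeometric series with upper parameters `as` and lower parameters `bs`. In a terminating
series a term in which an upper and a lower factor vanish together counts as zero. -/
def hyper (as bs : List ℝ) (z : ℝ) : ℝ :=
  ∑' n : ℕ, (as.map fun a => poch a n).prod / (bs.map fun b => poch b n).prod
    * (z ^ n / (n.factorial : ℝ))

/-- The Racah polynomial `R_n(x; α, β, γ, δ)`. -/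
def racah (n x : ℕ) (α β γ δ : ℝ) : ℝ :=
  hyper [-(n : ℝ), n + α + β + 1, -(x : ℝ), x + γ + δ + 1] [α + 1, β + δ + 1, γ + 1] 1

/-- The one-site duality function `r̂(y, x; lam, rho, v, N)`. -/
def siteDuality (y x : ℕ) (lam rho v : ℝ) (N : ℕ) : ℝ :=
  poch ((rho + lam - N + v + 1) / 2) x * poch ((rho + lam - N - v + 1) / 2) y
      * poch (y + (lam - rho - N + v + 1) / 2) N
    / poch (-(x : ℝ) + (lam - rho + N + v + 1) / 2) (x + y)
    * racah x y ((rho + lam - N - v - 1) / 2) ((rho - lam - N + v - 1) / 2) (-(N : ℝ) - 1) lam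

/-- The duality function `R̂^v(ζ, ξ)`, a doubly nested product. -/
def duality {M : ℕ} {N : Fin M → ℕ} (lam rho v : ℝ) (ζ ξ : Config N) : ℝ :=
  ∏ k : Fin M, siteDuality (ζ k) (ξ k) (heightL lam ζ k) (heightR rho ξ (k + 1)) v (N k)

/-- No denominator in the formula for `R̂^v` vanishes. (The lower parameter `-N_k` of the Racah
polynomial causes no zero, since the series stops after the index `min ζ_k ξ_k ≤ N_k`.) -/
def DualityDefined {M : ℕ} (N : Fin M → ℕ) (lam rho v : ℝ) : Prop :=
  ∀ (ζ ξ : Config N) (k : Fin M),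
    poch ((heightR rho ξ (k + 1) + heightL lam ζ k - N k - v + 1) / 2) (min (ζ k : ℕ) (ξ k)) ≠ 0 ∧
    poch ((heightR rho ξ (k + 1) + heightL lam ζ k - N k + v + 1) / 2) (min (ζ k : ℕ) (ξ k)) ≠ 0 ∧
    poch (-((ξ k : ℕ) : ℝ) + (heightL lam ζ k - heightR rho ξ (k + 1) + N k + v + 1) / 2)
      ((ξ k : ℕ) + ζ k) ≠ 0

/-! ### Reversible weights -/

/-- The one-site weight `Ŵ(x; N, rho)`. -/
def siteWeight (x N : ℕ) (rho : ℝ) : ℝ :=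
  (-1) ^ x * ((2 * x + rho - N) / (rho - N))
    * (poch (rho - N) x / (poch (rho + 1) x * poch (-rho) N)) * (N.choose x : ℝ)

/-- The weight `Ŵ_R(ξ; N, rho)`. -/
def weightR {M : ℕ} {N : Fin M → ℕ} (rho : ℝ) (ξ : Config N) : ℝ :=
  ∏ k : Fin M, siteWeight (ξ k) (N k) (heightR rho ξ (k + 1))

/-- The weight `Ŵ_L(ζ; N, lam)`. -/
def weightL {M : ℕ} {N : Fin M → ℕ} (lam : ℝ) (ζ : Config N) : ℝ :=
  ∏ k : Fin M, (-1) ^ (N k) * siteWeight (ζ k) (N k) (heightL lam ζ k)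

/-- `s` is none of the integers `-|N|, …, |N|`. When all `N_k` are positive, this says exactly that
no denominator occurs as zero in the weights with boundary value `s`. -/
def WeightDefined {M : ℕ} (N : Fin M → ℕ) (s : ℝ) : Prop :=
  ∀ m : ℤ, |m| ≤ (capacity N : ℤ) → s ≠ (m : ℝ)

/-! ### The objects with parameter `q` (dynamic asymmetric exclusion) -/

/-- `q^z` for real `q > 0` and complex `z`. -/
def qpow (q : ℝ) (z : ℂ) : ℂ := (q : ℂ) ^ z

/-- The `p`-shifted factorial `(a; p)_n`. -/
def qpoch (a p : ℂ) (n : ℕ) : ℂ := ∏ i ∈ Finset.range n, (1 - a * p ^ i)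

/-- The `p`-binomial coefficient. -/
def qbinom (p : ℂ) (n k : ℕ) : ℂ := qpoch p p n / (qpoch p p k * qpoch p p (n - k))

/-- The basic hypergeometric series (one more upper than lower parameter) to base `p`. -/
def qhyper (as bs : List ℂ) (p z : ℂ) : ℂ :=
  ∑' n : ℕ, (as.map fun a => qpoch a p n).prod / (bs.map fun b => qpoch b p n).prod
    * (z ^ n / qpoch p p n)

/-- The `p`-Racah polynomial `R_n(x; α, β, γ, δ; p)`. -/
def qRacah (n x : ℕ) (α β γ δ p : ℂ) : ℂ :=
  qhyper [(p ^ n)⁻¹, α * β * p ^ (n + 1), (p ^ x)⁻¹, γ * δ * p ^ (x + 1)]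
    [α * p, β * δ * p, γ * p] p p

/-- The one-site duality function `r(y, x; lam, rho, v, N; q)`. -/
def qSiteDuality (y x : ℕ) (lam rho v : ℂ) (N : ℕ) (q : ℝ) : ℂ :=
  v ^ y * (qpoch (-v * qpow q (rho + lam - N + 1)) ((q : ℂ) ^ 2) x
      * qpoch (-v⁻¹ * qpow q (rho + lam - N + 1)) ((q : ℂ) ^ 2) y
      * qpoch (v * qpow q (2 * y - rho + lam - N + 1)) ((q : ℂ) ^ 2) N)
    / (qpow q (y * (y + rho + lam - N))
      * qpoch (v * qpow q (-2 * x - rho + lam + N + 1)) ((q : ℂ) ^ 2) (x + y))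
    * qRacah x y (-v⁻¹ * qpow q (rho + lam - N - 1)) (v * qpow q (rho - lam - N - 1))
        (qpow q (-2 * N - 2)) (-qpow q (2 * lam)) ((q : ℂ) ^ 2)

/-- The duality function `R^v(ζ, ξ; lam, rho, N; q)`. -/
def qDuality {M : ℕ} {N : Fin M → ℕ} (lam rho v : ℂ) (q : ℝ) (ζ ξ : Config N) : ℂ :=
  ∏ k : Fin M, qSiteDuality (ζ k) (ξ k) (heightL lam ζ k) (heightR rho ξ (k + 1)) v (N k) q

/-- The one-site weight `W(x; N, rho; q)`. -/
def qSiteWeight (x N : ℕ) (rho : ℂ) (q : ℝ) : ℂ :=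
  (1 + qpow q (4 * x + 2 * rho - 2 * N)) / (1 + qpow q (2 * rho - 2 * N))
    * (qpoch (-qpow q (2 * rho - 2 * N)) ((q : ℂ) ^ 2) x
      / qpoch (-qpow q (2 * rho + 2)) ((q : ℂ) ^ 2) x)
    * (qpow q (-x * (2 * rho + 1 + x - 2 * N)) / qpoch (-qpow q (-2 * rho)) ((q : ℂ) ^ 2) N)
    * qbinom ((q : ℂ) ^ 2) N x

/-- The weight `W_R(ξ; N, rho; q)`. -/
def qWeightR {M : ℕ} {N : Fin M → ℕ} (rho : ℂ) (q : ℝ) (ξ : Config N) : ℂ :=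
  ∏ k : Fin M, qSiteWeight (ξ k) (N k) (heightR rho ξ (k + 1)) q

/-- The weight `W_L(ζ; N, lam; q)`; its one-site weights have the parameter `q⁻¹`. -/
def qWeightL {M : ℕ} {N : Fin M → ℕ} (lam : ℂ) (q : ℝ) (ζ : Config N) : ℂ :=
  ∏ k : Fin M, qSiteWeight (ζ k) (N k) (heightL lam ζ k) q⁻¹

/-- The shifted boundary value `s + π i / (2 log q)`, for which `q^(2 s)` becomes `-q^(2 s)`. -/
def shift (q s : ℝ) : ℂ := (s : ℂ) + Complex.I * (Real.pi : ℂ) / (2 * (Real.log q : ℂ))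

end

end DynSSEP

open DynSSEP

/-!
A site of capacity `N + 1` behaves like a site of capacity `N` next to a unit site: two contiguous
relations of the terminating `₄F₃` write the one-site function of capacity `N + 1` as a combination
of one-site functions of capacities `N` and `1`, and this fusion carries both the duality relation
of a pair of sites and the biorthogonality relation of one site from `N` to `N + 1`. Unit sites are
checked by hand, and exchanging `(ζ, λ, v)` with `(ξ, ρ, -v)` halves the number of cases. The
fusion divides by linear forms in `λ`, `ρ`, `v`; parameters for which none of these vanishes are
dense, and continuity extends the relations to all parameters for which they are defined. The
`q`-limits hold factor by factor, because `(1 - q ^ (2 a)) / (1 - q ^ 2) → a`.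
-/

namespace DynSSEP

/-! ### Shifted factorials -/

@[simp] lemma poch_zero (a : ℝ) : poch a 0 = 1 := by simp [poch]

@[simp] lemma poch_one (a : ℝ) : poch a 1 = a := by simp [poch]

lemma poch_succ (a : ℝ) (n : ℕ) : poch a (n + 1) = poch a n * (a + n) := by
  simp [poch, Finset.prod_range_succ]

lemma poch_add (a : ℝ) (m n : ℕ) : poch a (m + n) = poch a m * poch (a + m) n := by
  simp only [poch, Finset.prod_range_add, Nat.cast_add, add_assoc]

lemma poch_succ_left (a : ℝ) (n : ℕ) : poch a (n + 1) = a * poch (a + 1) n := by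
  rw [add_comm, poch_add, poch_one, Nat.cast_one]

lemma mul_poch_add_one (a : ℝ) (n : ℕ) : a * poch (a + 1) n = poch a n * (a + n) := by
  rw [← poch_succ_left, poch_succ]

lemma poch_add_one_eq_div {a : ℝ} (ha : a ≠ 0) (n : ℕ) :
    poch (a + 1) n = poch a n * (a + n) / a := by
  rw [eq_div_iff ha, mul_comm, mul_poch_add_one]

lemma poch_neg_reflect (a : ℝ) (n : ℕ) : poch (-a) n = (-1) ^ n * poch (a - n + 1) n := by
  induction n generalizing a with
  | zero => simp
  | succ n ih =>
    rw [poch_succ_left, show -a + 1 = -(a - 1) by ring, ih, poch_succ, Nat.cast_succ,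
      show a - (n + 1) + 1 = a - 1 - n + 1 by ring]
    ring

lemma poch_ne_zero_iff {a : ℝ} {n : ℕ} : poch a n ≠ 0 ↔ ∀ i < n, a + i ≠ 0 := by
  simp [poch, Finset.prod_ne_zero_iff]

lemma poch_neg_eq_zero {x n : ℕ} (h : x < n) : poch (-(x : ℝ)) n = 0 :=
  Finset.prod_eq_zero (Finset.mem_range.2 h) (by simp)

lemma poch_neg_ne_zero {x n : ℕ} (h : n ≤ x) : poch (-(x : ℝ)) n ≠ 0 := by
  refine poch_ne_zero_iff.2 fun i hi => ?_
  have : (i : ℝ) < x := by exact_mod_cast hi.trans_le h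
  linarith

/-! ### Generic parameters -/

/-- Genericity of the boundary values `lam`, `rho` and the spectral parameter `v`: no integer occurs
among the six linear forms that control all denominators. -/
structure Generic (lam rho v : ℝ) : Prop where
  lam_ne : ∀ m : ℤ, lam ≠ m
  rho_ne : ∀ m : ℤ, rho ≠ m
  sum_add_ne : ∀ m : ℤ, rho + lam + v ≠ m
  sum_sub_ne : ∀ m : ℤ, rho + lam - v ≠ m
  diff_add_ne : ∀ m : ℤ, lam - rho + v ≠ m
  diff_sub_ne : ∀ m : ℤ, lam - rho - v ≠ m

lemma Generic.shift {lam rho v lam' rho' : ℝ} (h : Generic lam rho v) (m n : ℤ)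
    (hm : lam' = lam + m) (hn : rho' = rho + n) : Generic lam' rho' v := by
  subst hm hn
  constructor
  · exact fun k hk => h.lam_ne (k - m) (by push_cast; linarith)
  · exact fun k hk => h.rho_ne (k - n) (by push_cast; linarith)
  · exact fun k hk => h.sum_add_ne (k - m - n) (by push_cast; linarith)
  · exact fun k hk => h.sum_sub_ne (k - m - n) (by push_cast; linarith)
  · exact fun k hk => h.diff_add_ne (k - m + n) (by push_cast; linarith)
  · exact fun k hk => h.diff_sub_ne (k - m + n) (by push_cast; linarith)

lemma Generic.neg {lam rho v : ℝ} (h : Generic lam rho v) : Generic lam rho (-v) where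
  lam_ne := h.lam_ne
  rho_ne := h.rho_ne
  sum_add_ne m hm := h.sum_sub_ne m (by linarith)
  sum_sub_ne m hm := h.sum_add_ne m (by linarith)
  diff_add_ne m hm := h.diff_sub_ne m (by linarith)
  diff_sub_ne m hm := h.diff_add_ne m (by linarith)

lemma Generic.swap {lam rho v : ℝ} (h : Generic lam rho v) : Generic rho lam (-v) where
  lam_ne := h.rho_ne
  rho_ne := h.lam_ne
  sum_add_ne m hm := h.sum_sub_ne m (by linarith)
  sum_sub_ne m hm := h.sum_add_ne m (by linarith)
  diff_add_ne m hm := h.diff_add_ne (-m) (by push_cast; linarith)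
  diff_sub_ne m hm := h.diff_sub_ne (-m) (by push_cast; linarith)

lemma poch_half_ne_zero {a b : ℝ} (h : ∀ m : ℤ, a ≠ m) (k : ℤ) (hb : b = (a + k) / 2) (n : ℕ) :
    poch b n ≠ 0 :=
  poch_ne_zero_iff.2 fun i _ hi => h (-k - 2 * i) (by push_cast; linarith)

lemma poch_int_ne_zero {a b : ℝ} (h : ∀ m : ℤ, a ≠ m) (k : ℤ) (hb : b = a + k) (n : ℕ) :
    poch b n ≠ 0 :=
  poch_ne_zero_iff.2 fun i _ hi => h (-k - i) (by push_cast; linarith)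

/-! ### Contiguous relations of terminating series -/

/-- The `n`-th term of a `₄F₃` at `1`, the summand of the Racah polynomials. -/
noncomputable def hyperTerm (X σ s t A B D : ℝ) (n : ℕ) : ℝ :=
  poch X n * poch σ n * poch s n * poch t n / (poch A n * poch B n * poch D n) / (n.factorial : ℝ)

/-- A `₄F₃` at `1` truncated after `m` terms. -/
noncomputable def hyperSum (m : ℕ) (X σ s t A B D : ℝ) : ℝ :=
  ∑ n ∈ Finset.range m, hyperTerm X σ s t A B D n

lemma hyperTerm_swap_upper (X σ s t A B D : ℝ) (n : ℕ) :
    hyperTerm X σ s t A B D n = hyperTerm X σ t s A B D n := by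
  simp only [hyperTerm]; ring

lemma hyperSum_swap_upper (m : ℕ) (X σ s t A B D : ℝ) :
    hyperSum m X σ s t A B D = hyperSum m X σ t s A B D :=
  Finset.sum_congr rfl fun n _ => hyperTerm_swap_upper X σ s t A B D n

lemma hyperSum_swap_pairs (m : ℕ) (X σ s t A B D : ℝ) :
    hyperSum m X σ s t A B D = hyperSum m s t X σ B A D :=
  Finset.sum_congr rfl fun n _ => by simp only [hyperTerm]; ring

/-- The telescoping certificate of the contiguous relation `hyperTerm_contiguous`, found as in
Zeilberger's algorithm. -/
noncomputable def certificate (X σ s t A B D ρ : ℝ) (n : ℕ) : ℝ :=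
  D * n * (ρ + t + n) / t * hyperTerm X σ s t A B D n

lemma mul_hyperTerm_shift (X σ s t A B D : ℝ) (n : ℕ) :
    X * σ * hyperTerm (X + 1) (σ + 1) s t A B D n
      = (X + n) * (σ + n) * hyperTerm X σ s t A B D n := by
  have h : ∀ p q : ℝ, X * σ * (p * q) = X * p * (σ * q) := fun p q => by ring
  simp only [hyperTerm, ← mul_div_assoc, ← mul_assoc]
  rw [mul_assoc _ (poch (X + 1) n), h, mul_poch_add_one, mul_poch_add_one]
  ring

lemma hyperTerm_contiguous {X σ s t A B D ρ : ℝ} {n : ℕ} (hA : poch A (n + 1) ≠ 0)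
    (hB : poch B (n + 1) ≠ 0) (hD : poch D (n + 1) ≠ 0) (ht : t ≠ 0)
    (hAB : A + B = ρ + s + t + 1) (hσ : σ = ρ + D - X) :
    -ρ * D * hyperTerm X σ s t A B D n
      = (ρ - X) * (X - D) * hyperTerm X σ s (t + 1) A B (D + 1) n
        - (A - s) * (B - s) / (A * B)
          * (X * σ * hyperTerm (X + 1) (σ + 1) s (t + 1) (A + 1) (B + 1) (D + 1) n)
        + (certificate X σ s t A B D ρ n - certificate X σ s t A B D ρ (n + 1)) := by
  obtain ⟨hA₀, -⟩ := mul_ne_zero_iff.1 (poch_succ_left A n ▸ hA)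
  obtain ⟨hB₀, -⟩ := mul_ne_zero_iff.1 (poch_succ_left B n ▸ hB)
  obtain ⟨hD₀, -⟩ := mul_ne_zero_iff.1 (poch_succ_left D n ▸ hD)
  obtain ⟨hAn, hA'⟩ := mul_ne_zero_iff.1 (poch_succ A n ▸ hA)
  obtain ⟨hBn, hB'⟩ := mul_ne_zero_iff.1 (poch_succ B n ▸ hB)
  obtain ⟨hDn, hD'⟩ := mul_ne_zero_iff.1 (poch_succ D n ▸ hD)
  obtain rfl : ρ = A + B - s - t - 1 := by linarith
  subst hσ
  rw [mul_hyperTerm_shift]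
  simp only [hyperTerm, certificate, poch_succ, poch_add_one_eq_div ht, poch_add_one_eq_div hA₀,
    poch_add_one_eq_div hB₀, poch_add_one_eq_div hD₀, Nat.factorial_succ, Nat.cast_mul,
    Nat.cast_succ]
  have hn : (n : ℝ) + 1 ≠ 0 := by positivity
  have hf : (n.factorial : ℝ) ≠ 0 := by positivity
  field_simp
  ring

lemma hyperSum_contiguous {X σ s t A B D ρ : ℝ} {m : ℕ} (hA : poch A m ≠ 0) (hB : poch B m ≠ 0)
    (hD : poch D m ≠ 0) (ht : t ≠ 0) (hAB : A + B = ρ + s + t + 1) (hσ : σ = ρ + D - X) :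
    -ρ * D * hyperSum m X σ s t A B D
      = (ρ - X) * (X - D) * hyperSum m X σ s (t + 1) A B (D + 1)
        - (A - s) * (B - s) / (A * B)
          * (X * σ * hyperSum m (X + 1) (σ + 1) s (t + 1) (A + 1) (B + 1) (D + 1))
        - certificate X σ s t A B D ρ m := by
  have poch_prefix : ∀ {a : ℝ}, poch a m ≠ 0 → ∀ n ∈ Finset.range m, poch a (n + 1) ≠ 0 :=
    fun ha n hn => poch_ne_zero_iff.2 fun i hi => poch_ne_zero_iff.1 ha i
      (by rw [Finset.mem_range] at hn; omega)
  have h := Finset.sum_congr rfl fun n hn => hyperTerm_contiguous (poch_prefix hA n hn)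
    (poch_prefix hB n hn) (poch_prefix hD n hn) ht hAB hσ
  rw [← Finset.mul_sum, Finset.sum_add_distrib, Finset.sum_sub_distrib, ← Finset.mul_sum,
    ← Finset.mul_sum, ← Finset.mul_sum, Finset.sum_range_sub'] at h
  have certificate_zero : certificate X σ s t A B D ρ 0 = 0 := by simp [certificate]
  rw [certificate_zero, zero_sub, ← sub_eq_add_neg] at h
  exact h

lemma mul_hyperTerm_add_one (X σ s t A B D : ℝ) (n : ℕ) :
    t * hyperTerm X σ s (t + 1) A B D n = (t + n) * hyperTerm X σ s t A B D n := by
  simp only [hyperTerm, ← mul_div_assoc]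
  rw [mul_left_comm, mul_poch_add_one]
  ring

lemma mul_hyperTerm_lower_add_one (X σ s t A B : ℝ) {D : ℝ} {n : ℕ} (hD : D ≠ 0)
    (hDn : D + n ≠ 0) :
    (D + n) * hyperTerm X σ s t A B (D + 1) n = D * hyperTerm X σ s t A B D n := by
  simp only [hyperTerm, poch_add_one_eq_div hD, div_eq_mul_inv, mul_inv, inv_inv]
  field_simp

lemma hyperSum_lower_contiguous {X σ s t A B D : ℝ} {m : ℕ} (hD : poch D m ≠ 0) :
    -D * (t - s) * hyperSum m X σ s t A B D
      = (s - D) * t * hyperSum m X σ s (t + 1) A B (D + 1)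
        - s * (t - D) * hyperSum m X σ t (s + 1) A B (D + 1) := by
  simp only [hyperSum, Finset.mul_sum, ← Finset.sum_sub_distrib]
  refine Finset.sum_congr rfl fun n hn => ?_
  rw [Finset.mem_range] at hn
  have hDn : D + n ≠ 0 := poch_ne_zero_iff.1 hD n hn
  have hD₀ : D ≠ 0 := by simpa using poch_ne_zero_iff.1 hD 0 (by omega)
  have raise_D := mul_hyperTerm_lower_add_one X σ s t A B hD₀ hDn
  have raise_t := mul_hyperTerm_add_one X σ s t A B (D + 1) n
  have raise_s := mul_hyperTerm_add_one X σ t s A B (D + 1) n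
  rw [hyperTerm_swap_upper X σ t s] at raise_s
  linear_combination (t - s) * raise_D - (s - D) * raise_t + (t - D) * raise_s

/-! ### The one-site duality function -/

/-- The first `m` terms of the series of the Racah polynomial in `siteDuality y x lam rho v N`, for
real `y`, `x` and `N`. -/
noncomputable def racahSeries (m : ℕ) (y x lam rho v N : ℝ) : ℝ :=
  hyperSum m (-x) (x + rho - N) (-y) (y + lam - N)
    ((rho + lam - N - v + 1) / 2) ((rho + lam - N + v + 1) / 2) (-N)

/-- The factor of `siteDuality` in front of the Racah polynomial. -/
noncomputable def prefactor (y x : ℕ) (lam rho v : ℝ) (N : ℕ) : ℝ :=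
  poch ((rho + lam - N + v + 1) / 2) x * poch ((rho + lam - N - v + 1) / 2) y
      * poch (y + (lam - rho - N + v + 1) / 2) N
    / poch (-(x : ℝ) + (lam - rho + N + v + 1) / 2) (x + y)

lemma racah_eq_hyperSum {n x m : ℕ} (h : min n x < m) (α β γ δ : ℝ) :
    racah n x α β γ δ = hyperSum m (-(n : ℝ)) (n + α + β + 1) (-(x : ℝ)) (x + γ + δ + 1)
      (α + 1) (β + δ + 1) (γ + 1) := by
  rw [racah, hyper, tsum_eq_sum (s := Finset.range m)]
  · refine Finset.sum_congr rfl fun k _ => ?_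
    simp only [List.map_cons, List.map_nil, List.prod_cons, List.prod_nil, hyperTerm, one_pow]
    ring
  · intro k hk
    rw [Finset.mem_range, not_lt] at hk
    have upper_vanishes : poch (-(n : ℝ)) k = 0 ∨ poch (-(x : ℝ)) k = 0 :=
      (lt_or_ge n k).imp poch_neg_eq_zero fun hnk => poch_neg_eq_zero (by omega)
    rcases upper_vanishes with h | h <;> simp [h]

lemma siteDuality_eq_prefactor_mul {y x m : ℕ} (h : min x y < m) (lam rho v : ℝ) (N : ℕ) :
    siteDuality y x lam rho v N = prefactor y x lam rho v N * racahSeries m y x lam rho v N := by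
  rw [siteDuality, racah_eq_hyperSum h, prefactor, racahSeries]
  ring_nf

/-! ### The symmetry exchanging the two processes -/

lemma racahSeries_swap (m : ℕ) (y x lam rho v N : ℝ) :
    racahSeries m y x lam rho v N = racahSeries m x y rho lam (-v) N := by
  rw [racahSeries, racahSeries, hyperSum_swap_pairs]
  ring_nf

lemma prefactor_swap {lam rho v : ℝ} (hg : Generic lam rho v) (y x N : ℕ) :
    prefactor y x lam rho v N = (-1) ^ (N + x + y) * prefactor x y rho lam (-v) N := by
  set u := -(x : ℝ) + (lam - rho - N + v + 1) / 2 with hu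
  have numerator_reflect : poch (x + (rho - lam - N + -v + 1) / 2) N = (-1) ^ N * poch u N := by
    rw [show x + (rho - lam - N + -v + 1) / 2 = -(u + N - 1) by rw [hu]; ring, poch_neg_reflect]
    ring_nf
  have denominator_reflect : poch (-(y : ℝ) + (rho - lam + N + -v + 1) / 2) (y + x)
      = (-1) ^ (x + y) * poch u (x + y) := by
    rw [show -(y : ℝ) + (rho - lam + N + -v + 1) / 2 = -(u + x + y - 1) by rw [hu]; ring,
      poch_neg_reflect, add_comm y x]
    push_cast
    ring_nf
  have cross : poch u (x + y) * poch (y + (lam - rho - N + v + 1) / 2) N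
      = poch u N * poch (-(x : ℝ) + (lam - rho + N + v + 1) / 2) (x + y) := by
    rw [show y + (lam - rho - N + v + 1) / 2 = u + (x + y : ℕ) by rw [hu]; push_cast; ring,
      show -(x : ℝ) + (lam - rho + N + v + 1) / 2 = u + N by rw [hu]; ring,
      ← poch_add, ← poch_add, add_comm]
  have hu_ne : poch u (x + y) ≠ 0 :=
    poch_half_ne_zero hg.diff_add_ne (-2 * x - N + 1) (by rw [hu]; push_cast; ring) _
  have hd : poch (-(x : ℝ) + (lam - rho + N + v + 1) / 2) (x + y) ≠ 0 :=
    poch_half_ne_zero hg.diff_add_ne (-2 * x + N + 1) (by push_cast; ring) _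
  have sign_sq : (-1 : ℝ) ^ (N + x + y) * (-1) ^ N = (-1) ^ (x + y) := by
    rw [← pow_add, show N + x + y + N = x + y + 2 * N by ring, pow_add _ _ (2 * N)]
    simp
  have sign_ne : (-1 : ℝ) ^ (x + y) ≠ 0 := by simp
  rw [prefactor, prefactor, numerator_reflect, denominator_reflect, ← mul_div_assoc,
    div_eq_div_iff hd (mul_ne_zero sign_ne hu_ne),
    show (lam + rho - N + -v + 1) / 2 = (rho + lam - N - v + 1) / 2 by ring,
    show (lam + rho - N - -v + 1) / 2 = (rho + lam - N + v + 1) / 2 by ring, ← sign_sq]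
  linear_combination (-1) ^ (N + x + y) * (-1) ^ N * poch ((rho + lam - N + v + 1) / 2) x
    * poch ((rho + lam - N - v + 1) / 2) y * cross

lemma siteDuality_swap {lam rho v : ℝ} (hg : Generic lam rho v) (y x N : ℕ) :
    siteDuality y x lam rho v N = (-1) ^ (N + x + y) * siteDuality x y rho lam (-v) N := by
  rw [siteDuality_eq_prefactor_mul (m := min x y + 1) (by omega),
    siteDuality_eq_prefactor_mul (m := min x y + 1) (by omega), racahSeries_swap,
    prefactor_swap hg, mul_assoc]

section UnitSite
variable {lam rho v : ℝ}

lemma siteDuality_unit_zero_zero (lam rho v : ℝ) :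
    siteDuality 0 0 lam rho v 1 = (v + lam - rho) / 2 := by
  rw [siteDuality_eq_prefactor_mul (m := 1) (by simp)]
  simp only [prefactor, racahSeries, hyperSum, hyperTerm, Finset.sum_range_one, poch_zero, poch_one,
    Nat.cast_zero, Nat.cast_one, Nat.factorial_zero, add_zero]
  ring

lemma siteDuality_unit_zero_one (hg : Generic lam rho v) :
    siteDuality 0 1 lam rho v 1 = (v + lam + rho) / 2 := by
  have h : (lam - rho + v) / 2 ≠ 0 := by simpa using hg.diff_add_ne 0
  rw [siteDuality_eq_prefactor_mul (m := 1) (by simp)]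
  simp only [prefactor, racahSeries, hyperSum, hyperTerm, Finset.sum_range_one, poch_zero, poch_one,
    Nat.cast_zero, Nat.cast_one, Nat.factorial_zero, add_zero, mul_one, div_one, zero_add]
  rw [show -1 + (lam - rho + 1 + v + 1) / 2 = (lam - rho + v) / 2 by ring,
    show (lam - rho - 1 + v + 1) / 2 = (lam - rho + v) / 2 by ring, mul_div_cancel_right₀ _ h]
  ring

lemma siteDuality_unit_one_zero (hg : Generic lam rho v) :
    siteDuality 1 0 lam rho v 1 = (lam + rho - v) / 2 := by
  rw [siteDuality_swap hg, siteDuality_unit_zero_one hg.swap]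
  ring

lemma siteDuality_unit_one_one (hg : Generic lam rho v) :
    siteDuality 1 1 lam rho v 1 = (lam - rho - v) / 2 := by
  have h₀ : lam - rho + v ≠ 0 := by simpa using hg.diff_add_ne 0
  have h₂ : lam - rho + v + 2 ≠ 0 := fun h => hg.diff_add_ne (-2) (by push_cast; linarith)
  have hA : rho + lam + v ≠ 0 := by simpa using hg.sum_add_ne 0
  have hB : rho + lam - v ≠ 0 := by simpa using hg.sum_sub_ne 0
  rw [siteDuality_eq_prefactor_mul (m := 2) (by simp), prefactor, racahSeries]
  simp only [hyperSum, hyperTerm, Finset.sum_range_succ, Finset.sum_range_zero, poch_succ,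
    poch_zero, Nat.cast_zero, Nat.cast_one, Nat.factorial_zero, Nat.factorial_one, zero_add,
    add_zero, one_mul]
  rw [show rho + lam - 1 + v + 1 = rho + lam + v by ring,
    show rho + lam - 1 - v + 1 = rho + lam - v by ring,
    show -1 + (lam - rho + 1 + v + 1) / 2 = (lam - rho + v) / 2 by ring,
    show 1 + (lam - rho - 1 + v + 1) / 2 = (lam - rho + v + 2) / 2 by ring,
    show (lam - rho + v) / 2 + 1 = (lam - rho + v + 2) / 2 by ring]
  field_simp
  ring

end UnitSite

/-! ### Splitting off a unit site -/

section SeriesContiguous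

lemma racahSeries_capacity_add_one (m : ℕ) (y x lam rho v N : ℝ) :
    racahSeries m y x lam rho v (N + 1) = hyperSum m (-x) (x + rho - N - 1) (-y) (y + lam - N - 1)
      ((rho + lam - N - v) / 2) ((rho + lam - N + v) / 2) (-N - 1) := by
  rw [racahSeries]; congr 1 <;> ring

lemma racahSeries_rho_sub_one (m : ℕ) (y x lam rho v N : ℝ) :
    racahSeries m y x lam (rho - 1) v N = hyperSum m (-x) (x + rho - N - 1) (-y) (y + lam - N)
      ((rho + lam - N - v) / 2) ((rho + lam - N + v) / 2) (-N) := by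
  rw [racahSeries]; congr 1 <;> ring

lemma racahSeries_rho_add_one (m : ℕ) (y x lam rho v N : ℝ) :
    racahSeries m y (x - 1) lam (rho + 1) v N = hyperSum m (-x + 1) (x + rho - N - 1 + 1) (-y)
      (y + lam - N) ((rho + lam - N - v) / 2 + 1) ((rho + lam - N + v) / 2 + 1) (-N) := by
  rw [racahSeries]; congr 1 <;> ring

lemma poch_neg_natCast_sub_one_ne_zero {m N : ℕ} (h : m ≤ N + 1) :
    poch (-(N : ℝ) - 1) m ≠ 0 := by
  have := poch_neg_ne_zero h
  rwa [Nat.cast_succ, neg_add, ← sub_eq_add_neg] at this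

variable {lam rho v : ℝ}

lemma racahSeries_contiguous_zero (hg : Generic lam rho v) {y N : ℕ} (hy : y ≤ N) (x : ℝ) :
    rho * (N + 1) * racahSeries (y + 1) y x lam rho v (N + 1)
      = (rho + x) * (N + 1 - x) * racahSeries (y + 1) y x lam (rho - 1) v N
        + ((rho + lam - N + v) / 2 + y) * ((rho + lam - N - v) / 2 + y)
            / ((rho + lam - N + v) / 2 * ((rho + lam - N - v) / 2))
          * (x * (x + rho - N - 1) * racahSeries (y + 1) y (x - 1) lam (rho + 1) v N) := by
  have ht : (y : ℝ) + lam - N - 1 ≠ 0 := fun h =>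
    hg.lam_ne (N + 1 - y) (by push_cast; linarith)
  have h := hyperSum_contiguous (X := -x) (σ := x + rho - N - 1) (s := -(y : ℝ))
    (t := y + lam - N - 1) (D := -(N : ℝ) - 1) (ρ := rho)
    (poch_half_ne_zero hg.sum_sub_ne (-N) (b := (rho + lam - N - v) / 2) (by push_cast; ring) _)
    (poch_half_ne_zero hg.sum_add_ne (-N) (b := (rho + lam - N + v) / 2) (by push_cast; ring) _)
    (poch_neg_natCast_sub_one_ne_zero (Nat.succ_le_succ hy)) ht (by ring) (by ring)
  have boundary : certificate (-x) (x + rho - N - 1) (-(y : ℝ)) (y + lam - N - 1)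
      ((rho + lam - N - v) / 2) ((rho + lam - N + v) / 2) (-(N : ℝ) - 1) rho (y + 1) = 0 := by
    simp [certificate, hyperTerm, poch_neg_eq_zero (Nat.lt_succ_self y)]
  rw [boundary, sub_add_cancel, sub_add_cancel] at h
  rw [racahSeries_capacity_add_one, racahSeries_rho_sub_one, racahSeries_rho_add_one]
  linear_combination h

lemma racahSeries_contiguous_one (hg : Generic lam rho v) {y N : ℕ} (hy : y ≤ N) (x : ℝ) :
    rho * (N + 1) * racahSeries (y + 2) (y + 1) x lam rho v (N + 1)
      = (rho + x) * (N + 1 - x) * racahSeries (y + 1) y x lam (rho - 1) v N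
        + ((rho - lam + N + v) / 2 - y) * ((rho - lam + N - v) / 2 - y)
            / ((rho + lam - N + v) / 2 * ((rho + lam - N - v) / 2))
          * (x * (x + rho - N - 1) * racahSeries (y + 1) y (x - 1) lam (rho + 1) v N) := by
  have ht : -((y : ℝ) + 1) ≠ 0 := neg_ne_zero.2 (by positivity)
  have h := hyperSum_contiguous (X := -x) (σ := x + rho - N - 1) (s := y + lam - N)
    (t := -((y : ℝ) + 1)) (D := -(N : ℝ) - 1) (ρ := rho)
    (poch_half_ne_zero hg.sum_sub_ne (-N) (b := (rho + lam - N - v) / 2) (by push_cast; ring) _)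
    (poch_half_ne_zero hg.sum_add_ne (-N) (b := (rho + lam - N + v) / 2) (by push_cast; ring) _)
    (poch_neg_natCast_sub_one_ne_zero (Nat.succ_le_succ hy)) ht (by ring) (by ring)
  have boundary : certificate (-x) (x + rho - N - 1) (y + lam - N) (-((y : ℝ) + 1))
      ((rho + lam - N - v) / 2) ((rho + lam - N + v) / 2) (-(N : ℝ) - 1) rho (y + 1)
      = rho * (N + 1) * hyperTerm (-x) (x + rho - N - 1) (-((y : ℝ) + 1)) (y + lam - N)
        ((rho + lam - N - v) / 2) ((rho + lam - N + v) / 2) (-(N : ℝ) - 1) (y + 1) := by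
    rw [certificate, hyperTerm_swap_upper]
    push_cast
    field_simp
    ring
  rw [boundary, sub_add_cancel, show -((y : ℝ) + 1) + 1 = -y by ring,
    hyperSum_swap_upper _ _ _ _ (-((y : ℝ) + 1)), hyperSum_swap_upper _ _ _ _ (-(y : ℝ)),
    hyperSum_swap_upper _ (-x + 1)] at h
  rw [racahSeries_capacity_add_one, racahSeries_rho_sub_one, racahSeries_rho_add_one,
    show (y : ℝ) + 1 + lam - N - 1 = y + lam - N by ring, hyperSum, Finset.sum_range_succ,
    ← hyperSum]
  linear_combination h

lemma racahSeries_lower_contiguous (lam rho v : ℝ) {m N : ℕ} (hm : m ≤ N + 1) (y x : ℝ) :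
    (N + 1) * (lam - N - 1 + 2 * y) * racahSeries m y x lam rho v (N + 1)
      = (N + 1 - y) * (y + lam - N - 1) * racahSeries m y x lam (rho - 1) v N
        + y * (lam + y) * racahSeries m (y - 1) x lam (rho - 1) v N := by
  have h := hyperSum_lower_contiguous (X := -x) (σ := x + rho - N - 1) (s := -y)
    (t := y + lam - N - 1) (A := (rho + lam - N - v) / 2) (B := (rho + lam - N + v) / 2)
    (poch_neg_natCast_sub_one_ne_zero hm)
  rw [sub_add_cancel, sub_add_cancel, hyperSum_swap_upper _ _ _ (y + lam - N - 1),
    show -y + 1 = -(y - 1) by ring, show y + lam - N - 1 = y - 1 + lam - N by ring] at h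
  rw [racahSeries_capacity_add_one, racahSeries_rho_sub_one, racahSeries_rho_sub_one,
    show y + lam - N - 1 = y - 1 + lam - N by ring]
  linear_combination h

end SeriesContiguous

section PrefactorSplit
variable {lam rho v : ℝ}

lemma prefactor_split_zero_zero (y x N : ℕ) (lam rho v : ℝ) :
    prefactor y x lam rho v (N + 1)
      = prefactor y x lam (rho - 1) v N * ((v + (lam + 2 * y - N) - rho) / 2) := by
  simp only [prefactor]
  push_cast
  rw [poch_succ_left (y + (lam - rho - (N + 1) + v + 1) / 2) N,
    show rho + lam - (N + 1 : ℝ) + v + 1 = rho - 1 + lam - N + v + 1 by ring,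
    show rho + lam - (N + 1 : ℝ) - v + 1 = rho - 1 + lam - N - v + 1 by ring,
    show y + (lam - rho - (N + 1) + v + 1) / 2 + 1 = y + (lam - (rho - 1) - N + v + 1) / 2 by ring,
    show lam - rho + (N + 1 : ℝ) + v + 1 = lam - (rho - 1) + N + v + 1 by ring]
  ring

lemma prefactor_split_one_zero (hg : Generic lam rho v) (y x N : ℕ) :
    prefactor (y + 1) x lam rho v (N + 1)
      = prefactor y x lam (rho - 1) v N * ((lam + 2 * y - N + rho - v) / 2) := by
  have hden := poch_half_ne_zero hg.diff_add_ne (N + 2 - 2 * x)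
    (b := -(x : ℝ) + (lam - (rho - 1) + N + v + 1) / 2) (by push_cast; ring) (x + y + 1)
  obtain ⟨hden₀, hden₁⟩ := mul_ne_zero_iff.1 (poch_succ _ (x + y) ▸ hden)
  simp only [prefactor, ← add_assoc x y 1]
  push_cast at hden₁ ⊢
  rw [show (y : ℝ) + 1 + (lam - rho - (N + 1) + v + 1) / 2
      = y + (lam - (rho - 1) - N + v + 1) / 2 by ring,
    show rho + lam - (N + 1 : ℝ) + v + 1 = rho - 1 + lam - N + v + 1 by ring,
    show rho + lam - (N + 1 : ℝ) - v + 1 = rho - 1 + lam - N - v + 1 by ring,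
    show lam - rho + (N + 1 : ℝ) + v + 1 = lam - (rho - 1) + N + v + 1 by ring,
    poch_succ, poch_succ, poch_succ, div_mul_eq_mul_div, div_eq_div_iff _ hden₀]
  · push_cast; ring
  · push_cast; exact mul_ne_zero hden₀ hden₁

lemma prefactor_split_zero_one (hg : Generic lam rho v) (y x N : ℕ) :
    (rho + lam - N + v) / 2 * ((rho + lam - N - v) / 2) * prefactor y x lam (rho + 1) v N
      = prefactor y (x + 1) lam rho v (N + 1) * ((rho + lam - N - v) / 2 + y) := by
  have hden := poch_half_ne_zero hg.diff_add_ne (N - 2 * x)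
    (b := -(x : ℝ) + (lam - (rho + 1) + N + v + 1) / 2) (by push_cast; ring) (x + y + 1)
  obtain ⟨hden₀, hden₁⟩ := mul_ne_zero_iff.1 (poch_succ _ (x + y) ▸ hden)
  simp only [prefactor, add_right_comm x 1 y]
  push_cast at hden₁ ⊢
  rw [show rho + lam - (N + 1 : ℝ) + v + 1 = rho + lam - N + v by ring,
    show rho + lam - (N + 1 : ℝ) - v + 1 = rho + lam - N - v by ring,
    show (rho + 1 + lam - N + v + 1) / 2 = (rho + lam - N + v) / 2 + 1 by ring,
    show (rho + 1 + lam - N - v + 1) / 2 = (rho + lam - N - v) / 2 + 1 by ring,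
    show y + (lam - rho - (N + 1) + v + 1) / 2 = y + (lam - (rho + 1) - N + v + 1) / 2 by ring,
    show -((x : ℝ) + 1) + (lam - rho + (N + 1) + v + 1) / 2
      = -(x : ℝ) + (lam - (rho + 1) + N + v + 1) / 2 by ring,
    poch_succ _ N, poch_succ _ (x + y), poch_succ_left _ x]
  have h := mul_poch_add_one ((rho + lam - N - v) / 2) y
  generalize (rho + lam - N + v) / 2 = A at h ⊢
  generalize (rho + lam - N - v) / 2 = B at h ⊢
  rw [← mul_div_assoc, div_mul_eq_mul_div,
    div_eq_div_iff hden₀ (by push_cast; exact mul_ne_zero hden₀ hden₁)]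
  push_cast
  linear_combination A * poch (A + 1) x * poch (y + (lam - (rho + 1) - N + v + 1) / 2) N
    * (poch (-(x : ℝ) + (lam - (rho + 1) + N + v + 1) / 2) (x + y)
      * (-(x : ℝ) + (lam - (rho + 1) + N + v + 1) / 2 + (x + y))) * h

lemma prefactor_split_one_one (hg : Generic lam rho v) (y x N : ℕ) :
    (rho + lam - N + v) / 2 * ((rho + lam - N - v) / 2) * prefactor y x lam (rho + 1) v N
      = prefactor (y + 1) (x + 1) lam rho v (N + 1) * ((lam - rho - N + v) / 2 + y) := by
  set d := -(x : ℝ) + (lam - (rho + 1) + N + v + 1) / 2 with hd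
  set n := y + (lam - (rho + 1) - N + v + 1) / 2 with hn
  have hden := poch_half_ne_zero hg.diff_add_ne (N - 2 * x) (b := d) (by rw [hd]; push_cast; ring)
    (x + y + 2)
  obtain ⟨hden₀₁, hden₂⟩ := mul_ne_zero_iff.1 (poch_succ _ (x + y + 1) ▸ hden)
  obtain ⟨hden₀, hden₁⟩ := mul_ne_zero_iff.1 (poch_succ _ (x + y) ▸ hden₀₁)
  have h := mul_poch_add_one n (N + 1)
  simp only [prefactor, show x + 1 + (y + 1) = x + y + 1 + 1 by ring]
  push_cast at hden₁ hden₂ h ⊢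
  rw [show rho + lam - (N + 1 : ℝ) + v + 1 = rho + lam - N + v by ring,
    show rho + lam - (N + 1 : ℝ) - v + 1 = rho + lam - N - v by ring,
    show (rho + 1 + lam - N + v + 1) / 2 = (rho + lam - N + v) / 2 + 1 by ring,
    show (rho + 1 + lam - N - v + 1) / 2 = (rho + lam - N - v) / 2 + 1 by ring,
    show (y : ℝ) + 1 + (lam - rho - (N + 1) + v + 1) / 2 = n + 1 by rw [hn]; ring,
    show -((x : ℝ) + 1) + (lam - rho + (N + 1) + v + 1) / 2 = d by rw [hd]; ring,
    show (lam - rho - N + v) / 2 + y = n by rw [hn]; ring,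
    poch_succ_left _ x, poch_succ_left _ y, poch_succ _ (x + y + 1), poch_succ _ (x + y)]
  generalize (rho + lam - N + v) / 2 = A
  generalize (rho + lam - N - v) / 2 = B
  rw [← mul_div_assoc, div_mul_eq_mul_div, mul_assoc _ (poch (n + 1) (N + 1)), mul_comm _ n, h,
    poch_succ n N, div_eq_div_iff hden₀
      (by push_cast; exact mul_ne_zero (mul_ne_zero hden₀ hden₁) hden₂)]
  push_cast
  rw [hd, hn]
  ring

end PrefactorSplit

section SiteSplit
variable {lam rho v : ℝ}

lemma half_sum_mul_half_sum_ne_zero (hg : Generic lam rho v) (N : ℕ) :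
    (rho + lam - N + v) / 2 * ((rho + lam - N - v) / 2) ≠ 0 :=
  mul_ne_zero (fun h => hg.sum_add_ne N (by push_cast; linarith))
    (fun h => hg.sum_sub_ne N (by push_cast; linarith))

lemma siteDuality_splitR_zero (hg : Generic lam rho v) {y N : ℕ} (hy : y ≤ N) (x : ℕ) :
    rho * (N + 1) * siteDuality y x lam rho v (N + 1)
      = (rho + x) * (N + 1 - x) * (siteDuality y x lam (rho - 1) v N
          * siteDuality 0 0 (lam + 2 * y - N) rho v 1)
        + x * (rho - N - 1 + x) * (siteDuality y (x - 1) lam (rho + 1) v N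
          * siteDuality 0 1 (lam + 2 * y - N) rho v 1) := by
  have hg' : Generic (lam + 2 * y - N) rho v :=
    hg.shift (2 * y - N) 0 (by push_cast; ring) (by simp)
  have hAB := half_sum_mul_half_sum_ne_zero hg N
  have series := racahSeries_contiguous_zero hg hy x
  have drop := prefactor_split_zero_zero y x N lam rho v
  rw [siteDuality_unit_zero_zero, siteDuality_unit_zero_one hg',
    siteDuality_eq_prefactor_mul (m := y + 1) (by omega),
    siteDuality_eq_prefactor_mul (m := y + 1) (by omega),
    siteDuality_eq_prefactor_mul (m := y + 1) (by omega)]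
  rcases x with _ | x
  · push_cast at series ⊢
    linear_combination prefactor y 0 lam rho v (N + 1) * series
      + rho * (N + 1) * racahSeries (y + 1) y 0 lam (rho - 1) v N * drop
  · have move := prefactor_split_zero_one hg y x N
    rw [mul_comm, ← eq_div_iff hAB] at move
    rw [Nat.add_sub_cancel, move]
    push_cast at series ⊢
    rw [add_sub_cancel_right] at series
    linear_combination prefactor y (x + 1) lam rho v (N + 1) * series + (rho + (x + 1))
      * (N + 1 - (x + 1)) * racahSeries (y + 1) y (x + 1) lam (rho - 1) v N * drop

lemma siteDuality_splitR_one (hg : Generic lam rho v) {y N : ℕ} (hy : y ≤ N) (x : ℕ) :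
    rho * (N + 1) * siteDuality (y + 1) x lam rho v (N + 1)
      = (rho + x) * (N + 1 - x) * (siteDuality y x lam (rho - 1) v N
          * siteDuality 1 0 (lam + 2 * y - N) rho v 1)
        + x * (rho - N - 1 + x) * (siteDuality y (x - 1) lam (rho + 1) v N
          * siteDuality 1 1 (lam + 2 * y - N) rho v 1) := by
  have hg' : Generic (lam + 2 * y - N) rho v :=
    hg.shift (2 * y - N) 0 (by push_cast; ring) (by simp)
  have hAB := half_sum_mul_half_sum_ne_zero hg N
  have series := racahSeries_contiguous_one hg hy x
  have drop := prefactor_split_one_zero hg y x N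
  rw [siteDuality_unit_one_zero hg', siteDuality_unit_one_one hg',
    siteDuality_eq_prefactor_mul (y := y + 1) (m := y + 2) (by omega),
    siteDuality_eq_prefactor_mul (m := y + 1) (by omega),
    siteDuality_eq_prefactor_mul (m := y + 1) (by omega)]
  rcases x with _ | x
  · push_cast at series ⊢
    linear_combination prefactor (y + 1) 0 lam rho v (N + 1) * series
      + rho * (N + 1) * racahSeries (y + 1) y 0 lam (rho - 1) v N * drop
  · have move := prefactor_split_one_one hg y x N
    rw [mul_comm, ← eq_div_iff hAB] at move
    rw [Nat.add_sub_cancel, move]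
    push_cast at series ⊢
    rw [add_sub_cancel_right] at series
    linear_combination prefactor (y + 1) (x + 1) lam rho v (N + 1) * series + (rho + (x + 1))
      * (N + 1 - (x + 1)) * racahSeries (y + 1) y (x + 1) lam (rho - 1) v N * drop

lemma siteDuality_splitL_zero (hg : Generic lam rho v) {x N : ℕ} (hx : x ≤ N) (y : ℕ) :
    (N + 1) * (lam - N - 1 + 2 * y) * siteDuality y x lam rho v (N + 1)
      = (N + 1 - y) * (lam - N - 1 + y) * (siteDuality y x lam (rho - 1) v N
          * siteDuality 0 0 (lam + 2 * y - N) rho v 1)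
        + y * (lam + y) * (siteDuality (y - 1) x lam (rho - 1) v N
          * siteDuality 1 0 (lam + 2 * y - 2 - N) rho v 1) := by
  have hg' : Generic (lam + 2 * y - 2 - N) rho v :=
    hg.shift (2 * y - 2 - N) 0 (by push_cast; ring) (by simp)
  have series := racahSeries_lower_contiguous lam rho v (Nat.succ_le_succ hx) y x
  have drop := prefactor_split_zero_zero y x N lam rho v
  rw [siteDuality_unit_zero_zero, siteDuality_unit_one_zero hg',
    siteDuality_eq_prefactor_mul (m := x + 1) (by omega),
    siteDuality_eq_prefactor_mul (m := x + 1) (by omega),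
    siteDuality_eq_prefactor_mul (m := x + 1) (by omega)]
  rcases y with _ | y
  · push_cast at series ⊢
    linear_combination prefactor 0 x lam rho v (N + 1) * series
      + (N + 1) * (lam - N - 1) * racahSeries (x + 1) 0 x lam (rho - 1) v N * drop
  · have move := prefactor_split_one_zero hg y x N
    rw [Nat.add_sub_cancel]
    push_cast at series drop ⊢
    rw [add_sub_cancel_right] at series
    linear_combination prefactor (y + 1) x lam rho v (N + 1) * series
      + (N + 1 - (y + 1)) * (lam - N - 1 + (y + 1))
        * racahSeries (x + 1) (y + 1) x lam (rho - 1) v N * drop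
      + (y + 1) * (lam + (y + 1)) * racahSeries (x + 1) y x lam (rho - 1) v N * move

lemma siteDuality_splitL_one (hg : Generic lam rho v) {x y N : ℕ} (hx : x ≤ N) (hy : y ≤ N + 1) :
    (N + 1) * (lam - N - 1 + 2 * y) * siteDuality y (x + 1) lam rho v (N + 1)
      = (N + 1 - y) * (lam - N - 1 + y) * (siteDuality y x lam (rho + 1) v N
          * siteDuality 0 1 (lam + 2 * y - N) rho v 1)
        + y * (lam + y) * (siteDuality (y - 1) x lam (rho + 1) v N
          * siteDuality 1 1 (lam + 2 * y - 2 - N) rho v 1) := by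
  have right_zero : ((N : ℝ) + 1 - y) * (rho * (N + 1) * siteDuality y (x + 1) lam rho v (N + 1))
      = (N + 1 - y) * ((rho + (x + 1)) * (N + 1 - (x + 1))
          * (siteDuality y (x + 1) lam (rho - 1) v N * siteDuality 0 0 (lam + 2 * y - N) rho v 1)
        + (x + 1) * (rho - N - 1 + (x + 1))
          * (siteDuality y x lam (rho + 1) v N * siteDuality 0 1 (lam + 2 * y - N) rho v 1)) := by
    rcases hy.eq_or_lt with rfl | hy
    · simp
    · rw [siteDuality_splitR_zero hg (by omega), Nat.add_sub_cancel]; push_cast; rfl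
  have right_one : (y : ℝ) * (rho * (N + 1) * siteDuality y (x + 1) lam rho v (N + 1))
      = y * ((rho + (x + 1)) * (N + 1 - (x + 1)) * (siteDuality (y - 1) (x + 1) lam (rho - 1) v N
          * siteDuality 1 0 (lam + 2 * y - 2 - N) rho v 1)
        + (x + 1) * (rho - N - 1 + (x + 1)) * (siteDuality (y - 1) x lam (rho + 1) v N
          * siteDuality 1 1 (lam + 2 * y - 2 - N) rho v 1)) := by
    rcases y with _ | y
    · simp
    · rw [siteDuality_splitR_one hg (by omega),
        show lam + 2 * ((y + 1 : ℕ) : ℝ) - 2 - N = lam + 2 * y - N by push_cast; ring]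
      push_cast; rfl
  have left : ((N : ℝ) + 1 - (x + 1)) * ((N + 1) * (lam - N - 1 + 2 * y)
        * siteDuality y (x + 1) lam rho v (N + 1))
      = (N + 1 - (x + 1)) * ((N + 1 - y) * (lam - N - 1 + y) * (siteDuality y (x + 1) lam (rho - 1)
          v N * siteDuality 0 0 (lam + 2 * y - N) rho v 1)
        + y * (lam + y) * (siteDuality (y - 1) (x + 1) lam (rho - 1) v N
          * siteDuality 1 0 (lam + 2 * y - 2 - N) rho v 1)) := by
    rcases hx.eq_or_lt with rfl | hx
    · simp
    · rw [siteDuality_splitL_zero hg hx]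
  have hne : ((x : ℝ) + 1) * (rho - N - 1 + (x + 1)) ≠ 0 :=
    mul_ne_zero (by positivity) fun h => hg.rho_ne (N - x) (by push_cast; linarith)
  -- The terms with `rho - 1` cancel between the splittings of the right and of the left site.
  apply mul_left_cancel₀ hne
  linear_combination (lam - N - 1 + y) * right_zero + (lam + y) * right_one
    - (rho + (x + 1)) * left

end SiteSplit

/-! ### One-site weights -/

lemma natCast_add_one_choose_mul_sub {N x : ℕ} (hx : x ≤ N + 1) :
    ((N + 1).choose x : ℝ) * (N + 1 - x) = (N + 1) * (N.choose x : ℝ) := by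
  have h : ((N + 1 - x : ℕ) : ℝ) = N + 1 - x := by push_cast [Nat.cast_sub hx]; rfl
  rw [← h, mul_comm (_ : ℝ) (N.choose x : ℝ)]
  exact_mod_cast (Nat.choose_mul_succ_eq N x).symm

lemma natCast_add_one_choose_add_one_mul (N x : ℕ) :
    ((N + 1).choose (x + 1) : ℝ) * (x + 1) = (N + 1) * (N.choose x : ℝ) :=
  mod_cast (Nat.add_one_mul_choose_eq N x).symm

section SiteWeight
variable {rho : ℝ} (h : ∀ m : ℤ, rho ≠ m)
include h

lemma siteWeight_eq (x N : ℕ) :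
    siteWeight x N rho
      = (-1) ^ (x + N) * (N.choose x : ℝ) * (rho - N + 2 * x) / poch (rho - N + x) (N + 1) := by
  have regroup : poch (rho - N) x * poch (rho - N + x) (N + 1)
      = (rho - N) * poch (rho - N + 1) N * poch (rho + 1) x := by
    rw [← poch_add, ← poch_succ_left, show x + (N + 1) = (N + 1) + x by ring, poch_add]
    congr 2
    push_cast; ring
  have h₀ : rho - N ≠ 0 := fun h0 => h N (by push_cast; linarith)
  have h₁ : poch (rho - N + x) (N + 1) ≠ 0 := poch_int_ne_zero h (-N + x) (by push_cast; ring) _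
  have h₂ : poch (rho - N + 1) N ≠ 0 := poch_int_ne_zero h (-N + 1) (by push_cast; ring) _
  have h₃ : poch (rho + 1) x ≠ 0 := poch_int_ne_zero h 1 (by push_cast; ring) _
  have sign : ((-1 : ℝ) ^ N)⁻¹ = (-1) ^ N := by rw [← inv_pow]; norm_num
  rw [siteWeight, poch_neg_reflect, mul_comm ((-1 : ℝ) ^ N), ← mul_assoc, ← div_div,
    div_eq_mul_inv _ ((-1 : ℝ) ^ N), sign, pow_add, eq_div_iff h₁]
  field_simp
  linear_combination (2 * x + rho - N) * (N.choose x : ℝ) * regroup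

lemma siteWeight_ne_zero {x N : ℕ} (hx : x ≤ N) : siteWeight x N rho ≠ 0 := by
  rw [siteWeight_eq h]
  refine div_ne_zero (mul_ne_zero (mul_ne_zero (by simp) ?_) ?_) ?_
  · exact_mod_cast (Nat.choose_pos hx).ne'
  · exact fun h0 => h (N - 2 * x) (by push_cast; linarith)
  · exact poch_int_ne_zero h (-N + x) (by push_cast; ring) _

lemma siteWeight_capacity_add_one {x N : ℕ} (hx : x ≤ N + 1) :
    (rho + x) * (N + 1 - x) * siteWeight x (N + 1) rho
      = -((N : ℝ) + 1) * siteWeight x N (rho - 1) := by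
  have h' : ∀ m : ℤ, rho - 1 ≠ m := fun m hm => h (m + 1) (by push_cast; linarith)
  have hden := poch_int_ne_zero h (-N - 1 + x) (b := rho - 1 - N + x) (by push_cast; ring)
    (N + 1 + 1)
  rw [siteWeight_eq h, siteWeight_eq h']
  push_cast
  rw [show rho - (N + 1 : ℝ) + x = rho - 1 - N + x by ring, ← add_assoc x N 1, pow_succ]
  rw [poch_succ] at hden ⊢
  obtain ⟨hden₀, hden₁⟩ := mul_ne_zero_iff.1 hden
  push_cast at hden₁ ⊢
  rw [show rho - 1 - (N : ℝ) + x + (N + 1) = rho + x by ring] at hden₁ ⊢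
  field_simp
  linear_combination -(rho - N - 1 + 2 * x) * natCast_add_one_choose_mul_sub hx

lemma siteWeight_add_one_capacity_add_one (x N : ℕ) :
    (x + 1) * (rho - N + x) * siteWeight (x + 1) (N + 1) rho
      = (N + 1) * siteWeight x N (rho + 1) := by
  have h' : ∀ m : ℤ, rho + 1 ≠ m := fun m hm => h (m - 1) (by push_cast; linarith)
  have hden := poch_int_ne_zero h (-N + x) (b := rho - N + x) (by push_cast; ring) (N + 1 + 1)
  rw [siteWeight_eq h, siteWeight_eq h']
  push_cast
  rw [show rho - (N + 1 : ℝ) + (x + 1) = rho - N + x by ring,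
    show rho + 1 - (N : ℝ) + x = rho - N + x + 1 by ring,
    show x + 1 + (N + 1) = x + N + 1 + 1 by ring, pow_succ, pow_succ]
  rw [poch_succ_left] at hden ⊢
  obtain ⟨hden₀, hden₁⟩ := mul_ne_zero_iff.1 hden
  field_simp
  linear_combination (rho - N + 1 + 2 * x) * natCast_add_one_choose_add_one_mul N x

lemma sq_div_siteWeight_capacity_add_one {x N : ℕ} (hx : x ≤ N + 1) :
    ((rho + x) * (N + 1 - x)) ^ 2 / siteWeight x N (rho - 1)
      = -((N : ℝ) + 1) * ((rho + x) * (N + 1 - x)) / siteWeight x (N + 1) rho := by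
  have split := siteWeight_capacity_add_one h hx
  have hw := siteWeight_ne_zero h hx
  generalize (rho + x) * (N + 1 - x) = α at split ⊢
  rcases eq_or_ne α 0 with rfl | hα
  · simp
  have hw' : siteWeight x N (rho - 1) ≠ 0 := fun h0 =>
    mul_ne_zero hα hw (by rw [split, h0, mul_zero])
  rw [div_eq_div_iff hw' hw]
  linear_combination α * split

lemma sq_div_siteWeight_add_one_capacity_add_one {x N : ℕ} (hx : x ≤ N) :
    ((x + 1) * (rho - N + x)) ^ 2 / siteWeight x N (rho + 1)
      = (N + 1) * ((x + 1) * (rho - N + x)) / siteWeight (x + 1) (N + 1) rho := by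
  have h' : ∀ m : ℤ, rho + 1 ≠ m := fun m hm => h (m - 1) (by push_cast; linarith)
  rw [div_eq_div_iff (siteWeight_ne_zero h' hx) (siteWeight_ne_zero h (Nat.succ_le_succ hx))]
  linear_combination
    (x + 1) * (rho - N + x) * siteWeight_add_one_capacity_add_one h x N

lemma siteWeight_zero_capacity_add_one (N : ℕ) :
    (-1) ^ (N + 1) * siteWeight 0 (N + 1) rho = (-1) ^ N * siteWeight 0 N rho / (rho - N) := by
  have hden := poch_int_ne_zero h (-N - 1) (b := rho - (N + 1)) (by push_cast; ring) (N + 1 + 1)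
  rw [siteWeight_eq h, siteWeight_eq h]
  simp only [Nat.choose_zero_right, Nat.cast_zero, Nat.cast_one, Nat.cast_add, mul_zero, add_zero,
    zero_add]
  rw [poch_succ_left, sub_add_eq_sub_sub, sub_add_cancel] at hden ⊢
  obtain ⟨hden₀, hden₁⟩ := mul_ne_zero_iff.1 hden
  have hN : rho - N ≠ 0 := fun h0 => h N (by push_cast; linarith)
  simp only [pow_add, pow_one]
  field_simp

lemma siteWeight_add_one_capacity_add_one_eq_sub (y N : ℕ) :
    (-1) ^ (N + 1) * siteWeight (y + 1) (N + 1) rho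
      = (-1) ^ N * siteWeight (y + 1) N rho / (rho + 2 * (y + 1) - N)
        - (-1) ^ N * siteWeight y N rho / (rho + 2 * y - N) := by
  have absorb := natCast_add_one_choose_add_one_mul N y
  have pascal : ((N + 1).choose (y + 1) : ℝ) = N.choose y + N.choose (y + 1) :=
    mod_cast Nat.choose_succ_succ N y
  have h₁ : rho + 2 * (y + 1) - N ≠ 0 := fun h0 => h (N - 2 * (y + 1)) (by push_cast; linarith)
  have h₂ : rho + 2 * y - N ≠ 0 := fun h0 => h (N - 2 * y) (by push_cast; linarith)
  have h₃ : rho + 1 + y ≠ 0 := fun h0 => h (-1 - y) (by push_cast; linarith)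
  have hden := poch_int_ne_zero h (-N + y) (b := rho - N + y) (by push_cast; ring) (N + 1 + 1)
  have shift := mul_poch_add_one (rho - N + y) (N + 1)
  rw [siteWeight_eq h, siteWeight_eq h, siteWeight_eq h]
  push_cast at shift ⊢
  rw [show rho - N + y + (N + 1 : ℝ) = rho + 1 + y by ring, eq_comm, ← eq_div_iff h₃] at shift
  rw [show rho - (N + 1 : ℝ) + (y + 1) = rho - N + y by ring,
    show rho - (N : ℝ) + (y + 1) = rho - N + y + 1 by ring,
    show rho - (N + 1 : ℝ) + 2 * (y + 1) = rho - N + 2 * y + 1 by ring,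
    show rho - (N : ℝ) + 2 * (y + 1) = rho + 2 * (y + 1) - N by ring,
    show rho - (N : ℝ) + 2 * y = rho + 2 * y - N by ring, shift]
  rw [poch_succ_left] at hden ⊢
  obtain ⟨hden₀, hden₁⟩ := mul_ne_zero_iff.1 hden
  generalize poch (rho - N + y + 1) (N + 1) = p at *
  simp only [pow_add, pow_one]
  field_simp
  linear_combination -absorb - (rho - N + y) * pascal

/-- Summation by parts: the weight of a site with `N + 1` places is a discrete derivative of the
weight of a site with `N` places. -/
lemma sum_mul_siteWeight_capacity_add_one (N : ℕ) (G : ℕ → ℝ) :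
    ∑ y ∈ Finset.range (N + 1 + 1), G y * ((-1) ^ (N + 1) * siteWeight y (N + 1) rho)
      = ∑ y ∈ Finset.range (N + 1), (G y - G (y + 1)) / (rho + 2 * y - N)
          * ((-1) ^ N * siteWeight y N rho) := by
  set w : ℕ → ℝ := fun y => (-1) ^ N * siteWeight y N rho / (rho + 2 * y - N) with hw
  have last : w (N + 1) = 0 := by simp [hw, siteWeight]
  have first : (-1) ^ (N + 1) * siteWeight 0 (N + 1) rho = w 0 := by
    simp only [hw, siteWeight_zero_capacity_add_one h N, Nat.cast_zero, mul_zero, add_zero]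
  have step (y : ℕ) : (-1) ^ (N + 1) * siteWeight (y + 1) (N + 1) rho = w (y + 1) - w y := by
    simp only [hw, siteWeight_add_one_capacity_add_one_eq_sub h y N, Nat.cast_add, Nat.cast_one]
  have shift := (Finset.sum_range_succ' (fun y => G y * w y) (N + 1)).symm.trans
    (Finset.sum_range_succ (fun y => G y * w y) (N + 1))
  rw [Finset.sum_range_succ', first]
  simp only [step, mul_sub, Finset.sum_sub_distrib]
  rw [sub_add_eq_add_sub, shift, last, mul_zero, add_zero, ← Finset.sum_sub_distrib]
  refine Finset.sum_congr rfl fun y _ => ?_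
  simp only [hw]
  ring

end SiteWeight

/-! ### Orthogonality for one site -/

/-- The inner product, with respect to the left weight of a site with `N` places, of the one-site
duality functions with `x` and `x'` particles on the right and parameters `v` and `-v`. -/
noncomputable def siteInner (x x' : ℕ) (lam rho v : ℝ) (N : ℕ) : ℝ :=
  ∑ y ∈ Finset.range (N + 1), siteDuality y x lam rho v N * siteDuality y x' lam rho (-v) N
    * ((-1) ^ N * siteWeight y N lam)

section SiteInner
variable {lam rho v : ℝ}

lemma siteDuality_mul_sub_mul_add_one (hg : Generic lam rho v) {y N : ℕ} (hy : y ≤ N)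
    (x x' : ℕ) :
    (siteDuality y x lam rho v (N + 1) * siteDuality y x' lam rho (-v) (N + 1)
        - siteDuality (y + 1) x lam rho v (N + 1) * siteDuality (y + 1) x' lam rho (-v) (N + 1))
        / (lam + 2 * y - N)
      = (x * (rho - N - 1 + x) * (x' * (rho - N - 1 + x'))
          * (siteDuality y (x - 1) lam (rho + 1) v N * siteDuality y (x' - 1) lam (rho + 1) (-v) N)
        - (rho + x) * (N + 1 - x) * ((rho + x') * (N + 1 - x'))
          * (siteDuality y x lam (rho - 1) v N * siteDuality y x' lam (rho - 1) (-v) N))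
        / (rho * (N + 1) ^ 2) := by
  have hμ : lam + 2 * y - N ≠ 0 := fun h0 => hg.lam_ne (N - 2 * y) (by push_cast; linarith)
  have hg' : Generic (lam + 2 * y - N) rho v :=
    hg.shift (2 * y - N) 0 (by push_cast; ring) (by simp)
  have hrho : rho ≠ 0 := by simpa using hg.rho_ne 0
  have hN : (N : ℝ) + 1 ≠ 0 := by positivity
  have zero := siteDuality_splitR_zero hg hy x
  have zero' := siteDuality_splitR_zero hg.neg hy x'
  have one := siteDuality_splitR_one hg hy x
  have one' := siteDuality_splitR_one hg.neg hy x'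
  rw [siteDuality_unit_zero_zero, siteDuality_unit_zero_one hg'] at zero
  rw [siteDuality_unit_zero_zero, siteDuality_unit_zero_one hg'.neg] at zero'
  rw [siteDuality_unit_one_zero hg', siteDuality_unit_one_one hg'] at one
  rw [siteDuality_unit_one_zero hg'.neg, siteDuality_unit_one_one hg'.neg] at one'
  rw [mul_comm, ← eq_div_iff (mul_ne_zero hrho hN)] at zero zero' one one'
  rw [zero, zero', one, one']
  generalize siteDuality y x lam (rho - 1) v N = p
  generalize siteDuality y (x - 1) lam (rho + 1) v N = q
  generalize siteDuality y x' lam (rho - 1) (-v) N = p'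
  generalize siteDuality y (x' - 1) lam (rho + 1) (-v) N = q'
  generalize (rho + x) * (N + 1 - x) = α
  generalize (rho + x') * (N + 1 - x') = α'
  generalize x * (rho - N - 1 + x) = β
  generalize x' * (rho - N - 1 + x') = β'
  generalize lam + 2 * y - N = μ at hμ ⊢
  field_simp
  ring

lemma siteInner_capacity_add_one (hg : Generic lam rho v) (x x' N : ℕ) :
    siteInner x x' lam rho v (N + 1)
      = (x * (rho - N - 1 + x) * (x' * (rho - N - 1 + x'))
          * siteInner (x - 1) (x' - 1) lam (rho + 1) v N
        - (rho + x) * (N + 1 - x) * ((rho + x') * (N + 1 - x'))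
          * siteInner x x' lam (rho - 1) v N) / (rho * (N + 1) ^ 2) := by
  rw [siteInner, sum_mul_siteWeight_capacity_add_one hg.lam_ne, siteInner, siteInner,
    Finset.mul_sum, Finset.mul_sum, ← Finset.sum_sub_distrib, Finset.sum_div]
  refine Finset.sum_congr rfl fun y hy => ?_
  rw [siteDuality_mul_sub_mul_add_one hg (Finset.mem_range_succ_iff.1 hy)]
  ring

lemma mul_siteInner_of_last_empty (hrho : ∀ m : ℤ, rho ≠ m) {N x x' : ℕ} (hx : x ≤ N + 1)
    (hx' : x' ≤ N + 1) (ih : x ≤ N → x' ≤ N →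
      siteInner x x' lam (rho - 1) v N = (if x = x' then 1 else 0) / siteWeight x N (rho - 1)) :
    (rho + x) * (N + 1 - x) * ((rho + x') * (N + 1 - x')) * siteInner x x' lam (rho - 1) v N
      = (if x = x' then 1 else 0)
        * (-(N + 1) * ((rho + x) * (N + 1 - x)) / siteWeight x (N + 1) rho) := by
  rw [← sq_div_siteWeight_capacity_add_one hrho hx]
  rcases hx.eq_or_lt with rfl | hx
  · simp
  rcases hx'.eq_or_lt with rfl | hx'
  · simp [hx.ne]
  rw [ih (by omega) (by omega)]
  split_ifs with hxx
  · rw [hxx]; ring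
  · simp

lemma mul_siteInner_of_last_full (hrho : ∀ m : ℤ, rho ≠ m) {N x x' : ℕ} (hx : x ≤ N + 1)
    (ih : siteInner (x - 1) (x' - 1) lam (rho + 1) v N
      = (if x - 1 = x' - 1 then 1 else 0) / siteWeight (x - 1) N (rho + 1)) :
    x * (rho - N - 1 + x) * (x' * (rho - N - 1 + x'))
        * siteInner (x - 1) (x' - 1) lam (rho + 1) v N
      = (if x = x' then 1 else 0)
        * ((N + 1) * (x * (rho - N - 1 + x)) / siteWeight x (N + 1) rho) := by
  rw [ih]
  rcases x with _ | x
  · simp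
  rcases x' with _ | x'
  · simp
  have factor (z : ℕ) : ((z + 1 : ℕ) : ℝ) * (rho - N - 1 + (z + 1 : ℕ))
    = (z + 1) * (rho - N + z) := by push_cast; ring
  simp only [factor, Nat.add_sub_cancel, Nat.add_right_cancel_iff]
  rw [← sq_div_siteWeight_add_one_capacity_add_one hrho (by omega)]
  split_ifs with hxx
  · rw [hxx]; ring
  · simp

theorem siteInner_eq (hg : Generic lam rho v) {N x x' : ℕ} (hx : x ≤ N) (hx' : x' ≤ N) :
    siteInner x x' lam rho v N = (if x = x' then 1 else 0) / siteWeight x N rho := by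
  induction N generalizing lam rho x x' with
  | zero =>
    obtain rfl : x = 0 := by omega
    obtain rfl : x' = 0 := by omega
    have hlam : lam ≠ 0 := by simpa using hg.lam_ne 0
    have hrho : rho ≠ 0 := by simpa using hg.rho_ne 0
    simp [siteInner, siteDuality_eq_prefactor_mul (m := 1) (y := 0) (x := 0) (by simp), prefactor,
      racahSeries, hyperSum, hyperTerm, siteWeight, hlam, hrho]
  | succ N ih =>
    have hgm : Generic lam (rho - 1) v := hg.shift 0 (-1) (by simp) (by push_cast; ring)
    have hgp : Generic lam (rho + 1) v := hg.shift 0 1 (by simp) (by push_cast; ring)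
    have hrho : rho ≠ 0 := by simpa using hg.rho_ne 0
    have hN : (N : ℝ) + 1 ≠ 0 := by positivity
    have hw := siteWeight_ne_zero hg.rho_ne hx
    rw [siteInner_capacity_add_one hg, mul_siteInner_of_last_empty hg.rho_ne hx hx' (ih hgm),
      mul_siteInner_of_last_full hg.rho_ne hx (ih hgp (by omega) (by omega))]
    field_simp
    ring

end SiteInner

/-! ### The generator of one bond -/

/-- Jump rate from the left to the right of two neighbouring sites of the left process, which have
capacities `N₁`, `N₂` and contents `a`, `b`, and whose left boundary value is `lam`. Reading the
sites from right to left yields the rate of the right process for a jump to the left. -/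
noncomputable def bondRateRight (N₁ N₂ : ℕ) (lam : ℝ) (a b : ℕ) : ℝ :=
  a * (N₂ - b) * (lam + a) * (lam + 2 * a - N₁ + b)
    / ((lam + 2 * a - N₁) * (lam + 2 * a - N₁ - 1))

/-- Jump rate from the right to the left site, in the setting of `bondRateRight`. -/
noncomputable def bondRateLeft (N₁ N₂ : ℕ) (lam : ℝ) (a b : ℕ) : ℝ :=
  b * (N₁ - a) * (lam + a - N₁) * (lam + 2 * a - N₁ + b - N₂)
    / ((lam + 2 * a - N₁) * (lam + 2 * a - N₁ + 1))

/-- The part of the generator that belongs to two neighbouring sites. -/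
noncomputable def bond (N₁ N₂ : ℕ) (lam : ℝ) (f : ℕ → ℕ → ℝ) (a b : ℕ) : ℝ :=
  bondRateRight N₁ N₂ lam a b * (f (a - 1) (b + 1) - f a b)
    + bondRateLeft N₁ N₂ lam a b * (f (a + 1) (b - 1) - f a b)

lemma bond_congr {N₁ N₂ a b : ℕ} {f g : ℕ → ℕ → ℝ} (lam : ℝ) (ha : a ≤ N₁) (hb : b ≤ N₂)
    (h : ∀ p q, p ≤ N₁ → q ≤ N₂ → p + q = a + b → f p q = g p q) :
    bond N₁ N₂ lam f a b = bond N₁ N₂ lam g a b := by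
  rw [bond, bond, h a b ha hb rfl]
  congr 1
  · rcases Nat.eq_zero_or_pos a with rfl | ha₀
    · simp [bondRateRight]
    rcases hb.eq_or_lt with rfl | hb'
    · simp [bondRateRight]
    rw [h (a - 1) (b + 1) (by omega) (by omega) (by omega)]
  · rcases Nat.eq_zero_or_pos b with rfl | hb₀
    · simp [bondRateLeft]
    rcases ha.eq_or_lt with rfl | ha'
    · simp [bondRateLeft]
    rw [h (a + 1) (b - 1) (by omega) (by omega) (by omega)]

lemma bond_const_mul (N₁ N₂ : ℕ) (lam k : ℝ) (g : ℕ → ℕ → ℝ) (a b : ℕ) :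
    bond N₁ N₂ lam (fun p q => k * g p q) a b = k * bond N₁ N₂ lam g a b := by
  simp only [bond]
  ring

lemma bond_sum {ι : Type*} (s : Finset ι) (N₁ N₂ : ℕ) (lam : ℝ) (g : ι → ℕ → ℕ → ℝ) (a b : ℕ) :
    bond N₁ N₂ lam (fun p q => ∑ e ∈ s, g e p q) a b = ∑ e ∈ s, bond N₁ N₂ lam (g e) a b := by
  simp only [bond, Finset.sum_add_distrib, ← Finset.mul_sum, Finset.sum_sub_distrib]

/-! ### Splitting a site into two -/

/-- Signed conditional probability that the last place of a site of the left process with `N + 1`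
places and `y` particles holds `e` particles. -/
noncomputable def splitL (N y e : ℕ) (lam : ℝ) : ℝ :=
  (if e = 0 then (N + 1 - y) * (lam - N - 1 + y) else y * (lam + y))
    / ((N + 1) * (lam - N - 1 + 2 * y))

/-- Signed conditional probability that the last place of a site of the right process with `N + 1`
places and `x` particles holds `e` particles. -/
noncomputable def splitR (N x e : ℕ) (rho : ℝ) : ℝ :=
  (if e = 0 then (rho + x) * (N + 1 - x) else x * (rho - N - 1 + x)) / (rho * (N + 1))

lemma splitL_eq_zero_or {N y e : ℕ} (lam : ℝ) (hy : y ≤ N + 1) (he : e < 2) :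
    splitL N y e lam = 0 ∨ e ≤ y ∧ y - e ≤ N := by
  interval_cases e
  · rcases hy.eq_or_lt with rfl | h
    · left; simp [splitL]
    · right; omega
  · rcases Nat.eq_zero_or_pos y with rfl | h
    · left; simp [splitL]
    · right; omega

lemma splitR_eq_zero_or {N x e : ℕ} (rho : ℝ) (hx : x ≤ N + 1) (he : e < 2) :
    splitR N x e rho = 0 ∨ e ≤ x ∧ x - e ≤ N := by
  interval_cases e
  · rcases hx.eq_or_lt with rfl | h
    · left; simp [splitR]
    · right; omega
  · rcases Nat.eq_zero_or_pos x with rfl | h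
    · left; simp [splitR]
    · right; omega

section Split
variable {lam rho v : ℝ}

lemma siteDuality_splitR (hg : Generic lam rho v) {y N e' : ℕ} (hy : y ≤ N) (he : e' < 2) (x : ℕ) :
    siteDuality (y + e') x lam rho v (N + 1) = ∑ e ∈ Finset.range 2, splitR N x e rho
      * (siteDuality y (x - e) lam (rho + 2 * e - 1) v N
        * siteDuality e' e (lam + 2 * y - N) rho v 1) := by
  have hden : rho * (N + 1) ≠ 0 := mul_ne_zero (by simpa using hg.rho_ne 0) (by positivity)
  simp only [Finset.sum_range_succ, Finset.sum_range_zero, splitR, if_true, one_ne_zero, if_false,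
    Nat.cast_zero, Nat.cast_one, mul_zero, mul_one, add_zero, zero_add, Nat.sub_zero]
  rw [show rho + 2 - 1 = rho + 1 by ring, div_mul_eq_mul_div, div_mul_eq_mul_div, ← add_div,
    eq_div_iff hden, mul_comm]
  interval_cases e'
  · exact siteDuality_splitR_zero hg hy x
  · exact siteDuality_splitR_one hg hy x

lemma siteDuality_splitL (hg : Generic lam rho v) {x y N e : ℕ} (hx : x ≤ N) (hy : y ≤ N + 1)
    (he : e < 2) :
    siteDuality y (x + e) lam rho v (N + 1) = ∑ e' ∈ Finset.range 2, splitL N y e' lam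
      * (siteDuality (y - e') x lam (rho + 2 * e - 1) v N
        * siteDuality e' e (lam + 2 * ((y - e' : ℕ) : ℝ) - N) rho v 1) := by
  have hden : ((N : ℝ) + 1) * (lam - N - 1 + 2 * y) ≠ 0 :=
    mul_ne_zero (by positivity) fun h0 => hg.lam_ne (N + 1 - 2 * y) (by push_cast; linarith)
  have cast_pred (z : ℝ → ℝ) : (y : ℝ) * z (lam + 2 * ((y - 1 : ℕ) : ℝ) - N)
      = y * z (lam + 2 * y - 2 - N) := by
    rcases y with _ | y
    · simp
    · rw [Nat.add_sub_cancel]; push_cast; ring_nf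
  have cast_pred := cast_pred fun μ => (lam + y) * (siteDuality (y - 1) x lam (rho + 2 * e - 1) v N
    * siteDuality 1 e μ rho v 1)
  simp only [Finset.sum_range_succ, Finset.sum_range_zero, splitL, if_true, one_ne_zero, if_false,
    zero_add, Nat.sub_zero]
  rw [div_mul_eq_mul_div, div_mul_eq_mul_div, ← add_div, eq_div_iff hden, mul_assoc (y : ℝ),
    cast_pred]
  interval_cases e
  · rw [show rho + 2 * ((0 : ℕ) : ℝ) - 1 = rho - 1 by push_cast; ring, add_zero]
    linear_combination siteDuality_splitL_zero hg hx y
  · rw [show rho + 2 * ((1 : ℕ) : ℝ) - 1 = rho + 1 by push_cast; ring]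
    linear_combination siteDuality_splitL_one hg hx hy

lemma bond_split_snd (h : ∀ m : ℤ, lam ≠ m) (N₁ N₂ a b : ℕ) (f : ℕ → ℕ → ℝ) :
    N₂ * bond N₁ (N₂ + 1) lam f a b = (N₂ + 1) * ∑ e ∈ Finset.range 2,
      splitL N₂ b e (lam + 2 * a - N₁) * bond N₁ N₂ lam (fun p q => f p (q + e)) a (b - e) := by
  obtain ⟨H, rfl⟩ : ∃ H, lam = H - 2 * a + N₁ := ⟨lam + 2 * a - N₁, by ring⟩
  have hH (k : ℤ) : H + k ≠ 0 := fun h0 => h (-2 * a + N₁ - k) (by push_cast; linarith)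
  have hcancel : H - 2 * a + N₁ + 2 * a - N₁ = H := by ring
  have full : splitL N₂ b 1 H
        * bond N₁ N₂ (H - 2 * a + N₁) (fun p q => f p (q + 1)) a (b - 1)
      = splitL N₂ b 1 H * (a * (N₂ - (b - 1)) * (H - 2 * a + N₁ + a)
            * (H + (b - 1)) / (H * (H - 1)) * (f (a - 1) (b + 1) - f a b)
          + (b - 1) * (N₁ - a) * (H - 2 * a + N₁ + a - N₁) * (H + (b - 1) - N₂)
            / (H * (H + 1)) * (f (a + 1) (b - 1) - f a b)) := by
    rw [bond, bondRateRight, bondRateLeft, hcancel]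
    rcases b with _ | _ | b <;> simp [splitL]
  rw [hcancel, Finset.sum_range_succ, Finset.sum_range_one,
    full]
  simp only [splitL, bond, bondRateRight, bondRateLeft, Nat.sub_zero, add_zero, if_true,
    one_ne_zero, if_false, hcancel]
  generalize f _ _ - f _ _ = z₁
  generalize f _ _ - f _ _ = z₂
  have h₀ := hH 0
  have h₁ := hH 1
  have h₂ := hH (-1)
  have h₃ := hH (2 * b - N₂ - 1)
  have hN : (N₂ : ℝ) + 1 ≠ 0 := by positivity
  push_cast at h₀ h₁ h₂ h₃ ⊢
  rw [add_zero] at h₀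
  rw [← sub_eq_add_neg] at h₂
  clear full hH h hcancel
  obtain ⟨K, hK⟩ : ∃ K, K = H - N₂ - 1 + 2 * b := ⟨_, rfl⟩
  rw [show H + (2 * b - N₂ - 1) = K by rw [hK]; ring] at h₃
  rw [← hK]
  generalize (b : ℝ) = β at *
  obtain rfl : β = (K - H + N₂ + 1) / 2 := by rw [hK]; ring
  clear hK
  field_simp
  ring

lemma splitR_one_mul_bond (rho : ℝ) (N₁ N₂ a b : ℕ) (f : ℕ → ℕ → ℝ) {g : ℝ}
    (hg : g = rho + 2 * a - (N₁ + 1)) :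
    splitR N₁ a 1 rho * bond N₁ N₂ (rho + 2 * (1 : ℕ) - 1) (fun p q => f (p + 1) q) (a - 1) b
      = splitR N₁ a 1 rho * ((a - 1) * (N₂ - b) * (rho + a) * (g + b) / (g * (g - 1))
            * (f (a - 1) (b + 1) - f a b)
          + b * (N₁ - (a - 1)) * (rho + a - N₁) * (g + b - N₂) / (g * (g + 1))
            * (f (a + 1) (b - 1) - f a b)) := by
  rcases a with _ | a
  · simp [splitR]
  rw [bond, bondRateRight, bondRateLeft, Nat.add_sub_cancel,
    show rho + 2 * ((1 : ℕ) : ℝ) - 1 + 2 * a - N₁ = g by rw [hg]; push_cast; ring]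
  congr 2
  · rcases a with _ | a
    · simp
    · simp only [Nat.add_sub_cancel]
      push_cast
      ring
  · push_cast
    ring

lemma bond_split_fst (h : ∀ m : ℤ, rho ≠ m) (N₁ N₂ a b : ℕ) (f : ℕ → ℕ → ℝ) :
    N₁ * bond (N₁ + 1) N₂ rho f a b = (N₁ + 1) * ∑ e ∈ Finset.range 2,
      splitR N₁ a e rho * bond N₁ N₂ (rho + 2 * e - 1) (fun p q => f (p + e) q) (a - e) b := by
  set g := rho + 2 * a - (N₁ + 1) with hg
  rw [Finset.sum_range_succ, Finset.sum_range_one,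
    splitR_one_mul_bond rho N₁ N₂ a b f hg]
  simp only [splitR, bond, bondRateRight, bondRateLeft, Nat.sub_zero, add_zero, if_true,
    one_ne_zero, if_false]
  generalize f _ _ - f _ _ = z₁
  generalize f _ _ - f _ _ = z₂
  have hrho (k : ℤ) : rho + k ≠ 0 := fun h0 => h (-k) (by push_cast; linarith)
  have h₀ := hrho 0
  have h₁ := hrho (2 * a - N₁ - 1)
  have h₂ := hrho (2 * a - N₁)
  have h₃ := hrho (2 * a - N₁ - 2)
  have hN : (N₁ : ℝ) + 1 ≠ 0 := by positivity
  push_cast at h₀ h₁ h₂ h₃ ⊢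
  rw [add_zero] at h₀
  rw [show rho + (2 * a - N₁ - 1) = g by rw [hg]; ring] at h₁
  rw [show rho + (2 * a - N₁ : ℝ) = g + 1 by rw [hg]; ring] at h₂
  rw [show rho + (2 * a - N₁ - 2 : ℝ) = g - 1 by rw [hg]; ring] at h₃
  rw [← hg, show rho + 2 * (0 : ℝ) - 1 + 2 * a - N₁ = g by rw [hg]; ring,
    show rho + 2 * (0 : ℝ) - 1 + a = rho + a - 1 by ring]
  clear_value g
  field_simp
  rw [hg]
  ring

/-! ### Duality for one bond -/

lemma siteDuality_unit (hg : Generic lam rho v) {y x : ℕ} (hy : y ≤ 1) (hx : x ≤ 1) :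
    siteDuality y x lam rho v 1
      = ((1 - 2 * y) * v + lam - (1 - 2 * x) * (1 - 2 * y) * rho) / 2 := by
  interval_cases y <;> interval_cases x
  · rw [siteDuality_unit_zero_zero]; push_cast; ring
  · rw [siteDuality_unit_zero_one hg]; push_cast; ring
  · rw [siteDuality_unit_one_zero hg]; push_cast; ring
  · rw [siteDuality_unit_one_one hg]; push_cast; ring

/-- The duality function of two neighbouring sites. -/
noncomputable def pairDuality (N₁ N₂ : ℕ) (lam rho v : ℝ) (a b c d : ℕ) : ℝ :=
  siteDuality a c lam (rho + 2 * d - N₂) v N₁ * siteDuality b d (lam + 2 * a - N₁) rho v N₂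

lemma pairDuality_unit (hg : Generic lam rho v) {a b c d : ℕ} (ha : a ≤ 1) (hb : b ≤ 1)
    (hc : c ≤ 1) (hd : d ≤ 1) :
    pairDuality 1 1 lam rho v a b c d
      = ((1 - 2 * a) * v + lam - (1 - 2 * c) * (1 - 2 * a) * (rho + 2 * d - 1)) / 2
        * (((1 - 2 * b) * v + (lam + 2 * a - 1) - (1 - 2 * d) * (1 - 2 * b) * rho) / 2) := by
  have gR : Generic lam (rho + 2 * d - 1) v :=
    hg.shift 0 (2 * d - 1) (by simp) (by push_cast; ring)
  have gL : Generic (lam + 2 * a - 1) rho v :=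
    hg.shift (2 * a - 1) 0 (by push_cast; ring) (by simp)
  rw [pairDuality, Nat.cast_one, siteDuality_unit gR ha hc, siteDuality_unit gL hb hd]

lemma pairDuality_swap (hg : Generic lam rho v) (N₁ N₂ a b c d : ℕ) :
    pairDuality N₁ N₂ lam rho v a b c d
      = (-1) ^ (N₁ + N₂ + (a + b) + (c + d)) * pairDuality N₂ N₁ rho lam (-v) d c b a := by
  have gR : Generic lam (rho + 2 * d - N₂) v :=
    hg.shift 0 (2 * d - N₂) (by simp) (by push_cast; ring)
  have gL : Generic (lam + 2 * a - N₁) rho v :=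
    hg.shift (2 * a - N₁) 0 (by push_cast; ring) (by simp)
  rw [pairDuality, pairDuality, siteDuality_swap gR, siteDuality_swap gL]
  ring

/-- Duality of the left and the right generator of one bond. The right configuration `(c, d)` is
read from right to left. -/
def BondDuality (N₁ N₂ : ℕ) : Prop :=
  ∀ lam rho v : ℝ, Generic lam rho v → ∀ a b c d : ℕ, a ≤ N₁ → b ≤ N₂ → c ≤ N₁ → d ≤ N₂ →
    bond N₁ N₂ lam (fun p q => pairDuality N₁ N₂ lam rho v p q c d) a b
      = bond N₂ N₁ rho (fun q p => pairDuality N₁ N₂ lam rho v a b p q) d c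

lemma bondDuality_unit : BondDuality 1 1 := by
  intro lam rho v hg a b c d ha hb hc hd
  rw [bond_congr lam ha hb fun p q hp hq _ => pairDuality_unit hg hp hq hc hd,
    bond_congr rho hd hc fun q p hq hp _ => pairDuality_unit hg ha hb hp hq]
  have l (k : ℤ) : lam + k ≠ 0 := fun h0 => hg.lam_ne (-k) (by push_cast; linarith)
  have r (k : ℤ) : rho + k ≠ 0 := fun h0 => hg.rho_ne (-k) (by push_cast; linarith)
  have l₀ := l 0
  have l₁ := l 1
  have l₂ := l (-1)
  have r₀ := r 0
  have r₁ := r 1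
  have r₂ := r (-1)
  push_cast at l₀ l₁ l₂ r₀ r₁ r₂
  rw [add_zero] at l₀ r₀
  rw [← sub_eq_add_neg] at l₂ r₂
  have sub_one (z : ℝ) : z + 2 - 1 = z + 1 := by ring
  simp only [bond, bondRateRight, bondRateLeft]
  interval_cases a <;> interval_cases b <;> interval_cases c <;> interval_cases d <;>
    norm_num [sub_one] <;> first | (right; ring1) | (field_simp; ring1)

lemma bond_pairDuality_splitR (hg : Generic lam rho v) {N₁ N₂ a b d e' : ℕ} (ha : a ≤ N₁)
    (hb : b ≤ N₂) (hd : d ≤ N₂ + 1) (he' : e' < 2) (c : ℕ) :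
    bond N₁ N₂ lam (fun p q => pairDuality N₁ (N₂ + 1) lam rho v p (q + e') c d) a b
      = ∑ e ∈ Finset.range 2, splitR N₂ d e rho
        * siteDuality e' e (lam + 2 * a - N₁ + 2 * b - N₂) rho v 1
        * bond N₁ N₂ lam (fun p q => pairDuality N₁ N₂ lam (rho + 2 * e - 1) v p q c (d - e))
          a b := by
  simp only [← bond_const_mul, ← bond_sum]
  refine bond_congr lam ha hb fun p q _ hq hpq => ?_
  have gL : Generic (lam + 2 * p - N₁) rho v :=
    hg.shift (2 * p - N₁) 0 (by push_cast; ring) (by simp)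
  rw [pairDuality, siteDuality_splitR gL hq he', Finset.mul_sum]
  refine Finset.sum_congr rfl fun e he => ?_
  rcases splitR_eq_zero_or rho hd (Finset.mem_range.1 he) with h0 | ⟨hed, -⟩
  · simp [h0]
  have hpq' : (p : ℝ) + q = a + b := by exact_mod_cast hpq
  rw [pairDuality, show lam + 2 * a - N₁ + 2 * b - N₂ = lam + 2 * p - N₁ + 2 * q - N₂ by
      linear_combination -2 * hpq',
    show rho + 2 * (e : ℝ) - 1 + 2 * ((d - e : ℕ) : ℝ) - N₂ = rho + 2 * d - ((N₂ + 1 : ℕ) : ℝ) by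
      push_cast [Nat.cast_sub hed]; ring]
  ring

lemma bond_pairDuality_splitL (hg : Generic lam rho v) {N₁ N₂ b c d e : ℕ} (hb : b ≤ N₂ + 1)
    (hc : c ≤ N₁) (hd : d ≤ N₂) (he : e < 2) (a : ℕ) :
    bond N₂ N₁ (rho + 2 * e - 1)
        (fun q p => pairDuality N₁ (N₂ + 1) lam rho v a b p (q + e)) d c
      = ∑ e' ∈ Finset.range 2, splitL N₂ b e' (lam + 2 * a - N₁)
        * siteDuality e' e (lam + 2 * a - N₁ + 2 * ((b - e' : ℕ) : ℝ) - N₂) rho v 1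
        * bond N₂ N₁ (rho + 2 * e - 1)
          (fun q p => pairDuality N₁ N₂ lam (rho + 2 * e - 1) v a (b - e') p q) d c := by
  simp only [← bond_const_mul, ← bond_sum]
  refine bond_congr _ hd hc fun q p hq _ _ => ?_
  have gL : Generic (lam + 2 * a - N₁) rho v :=
    hg.shift (2 * a - N₁) 0 (by push_cast; ring) (by simp)
  rw [pairDuality, siteDuality_splitL gL hq hb he, Finset.mul_sum]
  refine Finset.sum_congr rfl fun e' _ => ?_
  rw [pairDuality, show rho + 2 * (e : ℝ) - 1 + 2 * q - N₂
    = rho + 2 * ((q + e : ℕ) : ℝ) - ((N₂ + 1 : ℕ) : ℝ) by push_cast; ring]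
  ring

end Split

lemma BondDuality.succ_right {N₁ N₂ : ℕ} (h : BondDuality N₁ N₂) (hN : N₂ ≠ 0) :
    BondDuality N₁ (N₂ + 1) := by
  intro lam rho v hg a b c d ha hb hc hd
  apply mul_left_cancel₀ (Nat.cast_ne_zero.2 hN : (N₂ : ℝ) ≠ 0)
  rw [bond_split_snd hg.lam_ne, bond_split_fst hg.rho_ne]
  congr 1
  have gR (e : ℕ) : Generic lam (rho + 2 * e - 1) v :=
    hg.shift 0 (2 * e - 1) (by simp) (by push_cast; ring)
  calc ∑ e' ∈ Finset.range 2, splitL N₂ b e' (lam + 2 * a - N₁)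
        * bond N₁ N₂ lam (fun p q => pairDuality N₁ (N₂ + 1) lam rho v p (q + e') c d) a (b - e')
    _ = ∑ e' ∈ Finset.range 2, splitL N₂ b e' (lam + 2 * a - N₁)
        * ∑ e ∈ Finset.range 2, splitR N₂ d e rho
          * siteDuality e' e (lam + 2 * a - N₁ + 2 * ((b - e' : ℕ) : ℝ) - N₂) rho v 1
          * bond N₁ N₂ lam (fun p q => pairDuality N₁ N₂ lam (rho + 2 * e - 1) v p q c (d - e))
            a (b - e') := by
      refine Finset.sum_congr rfl fun e' he' => ?_
      have he' := Finset.mem_range.1 he'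
      rcases splitL_eq_zero_or (lam + 2 * a - N₁) hb he' with h0 | ⟨-, hbe⟩
      · rw [h0, zero_mul, zero_mul]
      · rw [bond_pairDuality_splitR hg ha hbe hd he' c]
    _ = ∑ e ∈ Finset.range 2, splitR N₂ d e rho
        * ∑ e' ∈ Finset.range 2, splitL N₂ b e' (lam + 2 * a - N₁)
          * siteDuality e' e (lam + 2 * a - N₁ + 2 * ((b - e' : ℕ) : ℝ) - N₂) rho v 1
          * bond N₂ N₁ (rho + 2 * e - 1)
            (fun q p => pairDuality N₁ N₂ lam (rho + 2 * e - 1) v a (b - e') p q) (d - e) c := by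
      simp only [Finset.mul_sum]
      rw [Finset.sum_comm]
      refine Finset.sum_congr rfl fun e he => Finset.sum_congr rfl fun e' he' => ?_
      rcases splitL_eq_zero_or (lam + 2 * a - N₁) hb (Finset.mem_range.1 he') with h0 | ⟨-, hbe⟩
      · simp only [h0, zero_mul, mul_zero]
      rcases splitR_eq_zero_or rho hd (Finset.mem_range.1 he) with h0 | ⟨-, hde⟩
      · simp only [h0, zero_mul, mul_zero]
      rw [h lam _ v (gR e) a (b - e') c (d - e) ha hbe hc hde]
      ring
    _ = ∑ e ∈ Finset.range 2, splitR N₂ d e rho * bond N₂ N₁ (rho + 2 * e - 1)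
        (fun q p => pairDuality N₁ (N₂ + 1) lam rho v a b p (q + e)) (d - e) c := by
      refine Finset.sum_congr rfl fun e he => ?_
      have he := Finset.mem_range.1 he
      rcases splitR_eq_zero_or rho hd he with h0 | ⟨-, hde⟩
      · rw [h0, zero_mul, zero_mul]
      · rw [bond_pairDuality_splitL hg hb hc hde he a]

lemma BondDuality.swap {N₁ N₂ : ℕ} (h : BondDuality N₁ N₂) : BondDuality N₂ N₁ := by
  intro lam rho v hg a b c d ha hb hc hd
  set sign : ℝ := (-1) ^ (N₂ + N₁ + (a + b) + (c + d))
  rw [bond_congr lam ha hb (g := fun p q => sign * pairDuality N₁ N₂ rho lam (-v) d c q p)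
      fun p q _ _ hpq => by rw [pairDuality_swap hg, hpq],
    bond_congr rho hd hc (g := fun q p => sign * pairDuality N₁ N₂ rho lam (-v) q p b a)
      fun q p _ _ hqp => by rw [pairDuality_swap hg, add_comm p, hqp, add_comm d],
    bond_const_mul, bond_const_mul, h rho lam (-v) hg.swap d c b a hd hc hb ha]

lemma bondDuality {N₁ N₂ : ℕ} (h₁ : 0 < N₁) (h₂ : 0 < N₂) : BondDuality N₁ N₂ := by
  have extend {n m : ℕ} (h : BondDuality n 1) (hm : 0 < m) : BondDuality n m := by
    induction m, hm using Nat.le_induction with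
    | base => exact h
    | succ m hm ih => exact ih.succ_right (by omega)
  exact extend (extend bondDuality_unit h₁).swap h₂

/-! ### Height functions and jumps -/

section Config
variable {M : ℕ} {N : Fin M → ℕ}

lemma Config.le (η : Config N) (k : Fin M) : (η k : ℕ) ≤ N k := Nat.lt_succ_iff.1 (η k).isLt

/-- The particles minus the holes of `η` on the sites in `S`. It is the difference of a height and
its boundary value, but lies in `ℤ`. -/
def excess (η : Config N) (S : Finset (Fin M)) : ℤ := ∑ j ∈ S, (2 * ((η j : ℕ) : ℤ) - N j)

lemma abs_excess_add_le (η : Config N) {S : Finset (Fin M)} {i : Fin M} (hi : i ∉ S) :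
    |excess η S| + N i ≤ capacity N := by
  have site_le (j : Fin M) : |2 * ((η j : ℕ) : ℤ) - N j| ≤ N j := by
    have := η.le j
    rw [abs_le]
    omega
  calc |excess η S| + N i ≤ ∑ j ∈ S, (N j : ℤ) + N i :=
        add_le_add_left ((Finset.abs_sum_le_sum_abs _ _).trans
          (Finset.sum_le_sum fun j _ => site_le j)) _
    _ = ∑ j ∈ insert i S, (N j : ℤ) := by rw [Finset.sum_insert hi, add_comm]
    _ ≤ ∑ j, (N j : ℤ) := Finset.sum_le_univ_sum_of_nonneg fun j => Int.natCast_nonneg (N j)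
    _ = capacity N := by rw [capacity, Nat.cast_sum]

section CommRing
variable {K : Type*} [CommRing K]

lemma heightL_eq_add_excess (lam : K) (ζ : Config N) (i : ℕ) :
    heightL lam ζ i = lam + (excess ζ {j | (j : ℕ) < i} : K) := by
  simp [heightL, excess, Finset.sum_filter, -Finset.sum_sub_distrib]

lemma heightR_eq_add_excess (rho : K) (ξ : Config N) (i : ℕ) :
    heightR rho ξ i = rho + (excess ξ {j | i ≤ (j : ℕ)} : K) := by
  simp [heightR, excess, Finset.sum_filter, -Finset.sum_sub_distrib]

lemma heightL_succ (lam : K) (ζ : Config N) (i : Fin M) :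
    heightL lam ζ ((i : ℕ) + 1) = heightL lam ζ i + 2 * ((ζ i : ℕ) : K) - N i := by
  have insert_eq : Finset.univ.filter (fun j : Fin M => (j : ℕ) < i + 1)
      = insert i (Finset.univ.filter fun j : Fin M => (j : ℕ) < i) := by
    ext j
    simp [Fin.ext_iff, Nat.le_iff_lt_or_eq, or_comm]
  rw [heightL_eq_add_excess, heightL_eq_add_excess, insert_eq, excess,
    Finset.sum_insert (by simp), excess]
  push_cast
  ring

lemma heightR_eq_succ (rho : K) (ξ : Config N) (i : Fin M) :
    heightR rho ξ i = heightR rho ξ ((i : ℕ) + 1) + 2 * ((ξ i : ℕ) : K) - N i := by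
  have insert_eq : Finset.univ.filter (fun j : Fin M => (i : ℕ) ≤ j)
      = insert i (Finset.univ.filter fun j : Fin M => (i : ℕ) + 1 ≤ j) := by
    ext j
    simp [Fin.ext_iff, Nat.le_iff_lt_or_eq, or_comm, eq_comm]
  rw [heightR_eq_add_excess, heightR_eq_add_excess, insert_eq, excess,
    Finset.sum_insert (by simp), excess]
  push_cast
  ring

end CommRing

lemma Generic.height {lam rho v : ℝ} (hg : Generic lam rho v) (ζ ξ : Config N) (i j : ℕ) :
    Generic (heightL lam ζ i) (heightR rho ξ j) v :=
  hg.shift _ _ (heightL_eq_add_excess lam ζ i) (heightR_eq_add_excess rho ξ j)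

/-- `η'` arises from `η` by moving particles between the sites `i` and `j`. -/
structure Exchanged (i j : Fin M) (η η' : Config N) : Prop where
  off : ∀ k, k ≠ i → k ≠ j → η' k = η k
  sum : (η' i : ℕ) + η' j = η i + η j

section Exchanged
variable {i j : Fin M} {η η' : Config N}

lemma Exchanged.refl (i j : Fin M) (η : Config N) : Exchanged i j η η := ⟨fun _ _ _ => rfl, rfl⟩

lemma Exchanged.swap (h : Exchanged i j η η') : Exchanged j i η η' :=
  ⟨fun k hj hi => h.off k hi hj, by rw [add_comm, h.sum, add_comm]⟩

lemma Exchanged.excess_eq (h : Exchanged i j η η') (hne : i ≠ j) {S : Finset (Fin M)}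
    (hS : i ∈ S ↔ j ∈ S) : excess η' S = excess η S := by
  by_cases hi : i ∈ S
  · rw [← sub_eq_zero, excess, excess, ← Finset.sum_sub_distrib,
      Finset.sum_eq_add_of_mem i j hi (hS.1 hi) hne fun k _ hk => by
        rw [h.off k hk.1 hk.2, sub_self]]
    have := h.sum
    omega
  · refine Finset.sum_congr rfl fun k hk => ?_
    rw [h.off k (ne_of_mem_of_not_mem hk hi) (ne_of_mem_of_not_mem hk (mt hS.2 hi))]

lemma Exchanged.heightL_eq (h : Exchanged i j η η') (hij : (i : ℕ) + 1 = j) (lam : ℝ) {l : ℕ}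
    (hl : l ≠ j) : heightL lam η' l = heightL lam η l := by
  rw [heightL_eq_add_excess, heightL_eq_add_excess,
    h.excess_eq (by rintro rfl; omega) (by simp only [Finset.mem_filter_univ]; omega)]

lemma Exchanged.heightR_eq (h : Exchanged i j η η') (hij : (i : ℕ) + 1 = j) (rho : ℝ) {l : ℕ}
    (hl : l ≠ j) : heightR rho η' l = heightR rho η l := by
  rw [heightR_eq_add_excess, heightR_eq_add_excess,
    h.excess_eq (by rintro rfl; omega) (by simp only [Finset.mem_filter_univ]; omega)]

lemma jump_source (hne : i ≠ j) (hi : 0 < (η i : ℕ)) (hj : (η j : ℕ) < N j) :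
    (jump η i j i : ℕ) = η i - 1 := by
  rw [jump, dif_pos ⟨hi, hj⟩, Function.update_of_ne hne, Function.update_self]

lemma jump_target (hi : 0 < (η i : ℕ)) (hj : (η j : ℕ) < N j) :
    (jump η i j j : ℕ) = η j + 1 := by
  rw [jump, dif_pos ⟨hi, hj⟩, Function.update_self]

lemma jump_other (η : Config N) {k : Fin M} (hi : k ≠ i) (hj : k ≠ j) :
    jump η i j k = η k := by
  rw [jump]
  split_ifs
  · rw [Function.update_of_ne hj, Function.update_of_ne hi]
  · rfl

lemma jump_eq_self (h : ¬ (0 < (η i : ℕ) ∧ (η j : ℕ) < N j)) : jump η i j = η := dif_neg h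

lemma exchanged_jump (hne : i ≠ j) (η : Config N) : Exchanged i j η (jump η i j) := by
  by_cases h : 0 < (η i : ℕ) ∧ (η j : ℕ) < N j
  · refine ⟨fun k hi hj => jump_other η hi hj, ?_⟩
    rw [jump_source hne h.1 h.2, jump_target h.1 h.2]
    omega
  · rw [jump_eq_self h]
    exact .refl i j η

lemma jump_jump (hne : i ≠ j) (hi : 0 < (η i : ℕ)) (hj : (η j : ℕ) < N j) :
    jump (jump η i j) j i = η := by
  have source := jump_source hne hi hj
  have target := jump_target hi hj
  have source_le := η.le i
  funext k
  by_cases hki : k = i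
  · subst hki
    apply Fin.ext
    rw [jump_target (by omega) (by omega), source]
    omega
  by_cases hkj : k = j
  · subst hkj
    apply Fin.ext
    rw [jump_source hne.symm (by omega) (by omega), target]
    omega
  rw [jump_other _ hkj hki, jump_other _ hki hkj]

end Exchanged

lemma prod_eq_prod_erase_mul_pair {i j : Fin M} (hne : i ≠ j) (f : Fin M → ℝ) :
    ∏ k, f k = (∏ k ∈ (Finset.univ.erase i).erase j, f k) * (f i * f j) := by
  rw [← Finset.mul_prod_erase _ f (Finset.mem_univ i), ← Finset.mul_prod_erase _ f
    (Finset.mem_erase.2 ⟨hne.symm, Finset.mem_univ j⟩)]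
  ring

/-! ### Duality of the generators -/

lemma rateLRight_eq (lam : ℝ) (ζ : Config N) (i j : Fin M) :
    rateLRight lam ζ i j = bondRateRight (N i) (N j) (heightL lam ζ i) (ζ i) (ζ j) := by
  rw [rateLRight, heightL_succ, bondRateRight]

lemma rateRLeft_eq (rho : ℝ) (ξ : Config N) (i j : Fin M) :
    rateRLeft rho ξ i j = bondRateRight (N j) (N i) (heightR rho ξ (j + 1)) (ξ j) (ξ i) := by
  rw [rateRLeft, heightR_eq_succ rho ξ j, bondRateRight]
  ring

section Neighbours
variable {i j : Fin M} (hij : (i : ℕ) + 1 = j)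
include hij

lemma rateLLeft_eq (lam : ℝ) (ζ : Config N) :
    rateLLeft lam ζ i j = bondRateLeft (N i) (N j) (heightL lam ζ i) (ζ i) (ζ j) := by
  rw [rateLLeft, heightL_succ lam ζ j, ← hij, heightL_succ lam ζ i, bondRateLeft]
  ring

lemma rateRRight_eq (rho : ℝ) (ξ : Config N) :
    rateRRight rho ξ i j = bondRateLeft (N j) (N i) (heightR rho ξ (j + 1)) (ξ j) (ξ i) := by
  rw [rateRRight, heightR_eq_succ rho ξ i, hij, heightR_eq_succ rho ξ j, bondRateLeft]
  ring

lemma duality_exchanged (lam rho v : ℝ) {ζ ζ' ξ ξ' : Config N} (hζ : Exchanged i j ζ ζ')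
    (hξ : Exchanged i j ξ ξ') :
    duality lam rho v ζ' ξ' = (∏ k ∈ (Finset.univ.erase i).erase j,
        siteDuality (ζ k) (ξ k) (heightL lam ζ k) (heightR rho ξ (k + 1)) v (N k))
      * pairDuality (N i) (N j) (heightL lam ζ i) (heightR rho ξ (j + 1)) v
          (ζ' i) (ζ' j) (ξ' i) (ξ' j) := by
  rw [duality, prod_eq_prod_erase_mul_pair (by rintro rfl; omega : i ≠ j), pairDuality]
  congr 1
  · refine Finset.prod_congr rfl fun k hk => ?_
    obtain ⟨hkj, hki, -⟩ : k ≠ j ∧ k ≠ i ∧ k ∈ Finset.univ := by simpa using hk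
    rw [hζ.off k hki hkj, hξ.off k hki hkj, hζ.heightL_eq hij lam (Fin.val_ne_of_ne hkj),
      hξ.heightR_eq hij rho (by have := Fin.val_ne_of_ne hki; omega)]
  · rw [hij, heightR_eq_succ, hξ.heightR_eq hij rho (by omega : (j : ℕ) + 1 ≠ j),
      hζ.heightL_eq hij lam (by omega : (i : ℕ) ≠ j), ← hij, heightL_succ,
      hζ.heightL_eq hij lam (by omega : (i : ℕ) ≠ j)]

end Neighbours

lemma bond_eq_of_exchanged {i j : Fin M} (hne : i ≠ j) (η : Config N) (s : ℝ) {F : Config N → ℝ}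
    {c : ℝ} {f : ℕ → ℕ → ℝ} (hF : ∀ η', Exchanged i j η η' → F η' = c * f (η' i) (η' j)) :
    bondRateRight (N i) (N j) s (η i) (η j) * (F (jump η i j) - F η)
        + bondRateLeft (N i) (N j) s (η i) (η j) * (F (jump η j i) - F η)
      = c * bond (N i) (N j) s f (η i) (η j) := by
  rw [bond, hF _ (exchanged_jump hne η), hF _ (exchanged_jump hne.symm η).swap, hF _ (.refl i j η),
    mul_add c]
  congr 1
  · by_cases h : 0 < (η i : ℕ) ∧ (η j : ℕ) < N j
    · rw [jump_source hne h.1 h.2, jump_target h.1 h.2]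
      ring
    · have : (η i : ℕ) = 0 ∨ (η j : ℕ) = N j := by have := η.le j; omega
      rcases this with h | h <;> simp [bondRateRight, h]
  · by_cases h : 0 < (η j : ℕ) ∧ (η i : ℕ) < N i
    · rw [jump_source hne.symm h.1 h.2, jump_target h.1 h.2]
      ring
    · have : (η j : ℕ) = 0 ∨ (η i : ℕ) = N i := by have := η.le i; omega
      rcases this with h | h <;> simp [bondRateLeft, h]

lemma isDuality_duality_of_generic (hN : ∀ k, 0 < N k) {lam rho v : ℝ} (hg : Generic lam rho v) :
    IsDuality (generatorL N lam) (generatorR N rho) (duality lam rho v) := by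
  intro ζ ξ
  simp only [generatorL, generatorR, generator]
  refine Finset.sum_congr rfl fun i _ => Finset.sum_congr rfl fun j _ => ?_
  split_ifs with hij
  swap
  · rfl
  have hne : i ≠ j := by rintro rfl; omega
  let D := pairDuality (N i) (N j) (heightL lam ζ i) (heightR rho ξ (j + 1)) v
  rw [rateLRight_eq, rateLLeft_eq hij, rateRRight_eq hij, rateRLeft_eq,
    bond_eq_of_exchanged hne ζ _ (F := fun ζ' => duality lam rho v ζ' ξ)
      (f := fun p q => D p q (ξ i) (ξ j)) fun ζ' h =>
        duality_exchanged hij lam rho v h (.refl i j ξ),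
    add_comm (bondRateLeft _ _ _ _ _ * _),
    bond_eq_of_exchanged hne.symm ξ _ (F := duality lam rho v ζ)
      (f := fun q p => D (ζ i) (ζ j) p q) fun ξ' h =>
        duality_exchanged hij lam rho v (.refl i j ζ) h.swap]
  congr 1
  exact bondDuality (hN i) (hN j) _ _ v (hg.height ζ ξ _ _) _ _ _ _ (ζ.le i) (ζ.le j) (ξ.le i)
    (ξ.le j)

/-! ### Detailed balance -/

lemma isReversible_generator {cR cL : Config N → Fin M → Fin M → ℝ} {μ : Config N → ℝ}
    (h : ∀ (η : Config N) (i j : Fin M), (i : ℕ) + 1 = j → 0 < (η i : ℕ) → (η j : ℕ) < N j →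
      μ η * cR η i j = μ (jump η i j) * cL (jump η i j) i j) :
    IsReversible (generator cR cL) μ := by
  have bond_balance (a b : Config N) (i j : Fin M) (hij : (i : ℕ) + 1 = j) (hab : a ≠ b) :
      μ a * (cR a i j * (Pi.single b 1 : Config N → ℝ) (jump a i j))
        = μ b * (cL b i j * (Pi.single a 1 : Config N → ℝ) (jump b j i)) := by
    have hne : i ≠ j := by rintro rfl; omega
    by_cases forth : jump a i j = b
    · have hp : 0 < (a i : ℕ) ∧ (a j : ℕ) < N j := by
        by_contra hp
        exact hab ((jump_eq_self hp).symm.trans forth)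
      subst forth
      rw [jump_jump hne hp.1 hp.2, Pi.single_eq_same, Pi.single_eq_same, mul_one, mul_one]
      exact h a i j hij hp.1 hp.2
    · have back : jump b j i ≠ a := by
        rintro rfl
        have hp : 0 < (b j : ℕ) ∧ (b i : ℕ) < N i := by
          by_contra hp
          exact hab (jump_eq_self hp)
        exact forth (jump_jump hne.symm hp.1 hp.2)
      rw [Pi.single_eq_of_ne forth, Pi.single_eq_of_ne back, mul_zero, mul_zero, mul_zero, mul_zero]
  intro a b
  by_cases hab : a = b
  · rw [hab]
  simp only [generator, Finset.mul_sum, Pi.single_eq_of_ne hab,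
    Pi.single_eq_of_ne (Ne.symm hab), sub_zero]
  refine Finset.sum_congr rfl fun i _ => Finset.sum_congr rfl fun j _ => ?_
  split_ifs with hij
  · rw [mul_add, mul_add, bond_balance a b i j hij hab, bond_balance b a i j hij (Ne.symm hab),
      add_comm]
  · rw [mul_zero, mul_zero]

end Config

lemma natCast_choose_succ_mul (N x : ℕ) :
    (N.choose (x + 1) : ℝ) * (x + 1) = N.choose x * (N - x) := by
  rcases le_or_gt x N with hx | hx
  · rw [← Nat.cast_sub hx]
    exact_mod_cast Nat.choose_succ_right_eq N x
  · rw [Nat.choose_eq_zero_of_lt hx, Nat.choose_eq_zero_of_lt (by omega)]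
    simp

section Balance
variable {l : ℝ} (h : ∀ m : ℤ, l ≠ m)
include h

lemma siteWeight_particle_succ (x N : ℕ) :
    (x + 1) * (l + x + 1) * (l + 2 * x - N) * siteWeight (x + 1) N l
      = -((N - x) * (l - N + x) * (l + 2 * x + 2 - N) * siteWeight x N l) := by
  have hden := poch_int_ne_zero h (-N + x) (b := l - N + x) (by push_cast; ring) (N + 1)
  have hden' := poch_int_ne_zero h (-N + x + 1) (b := l - N + x + 1) (by push_cast; ring) (N + 1)
  have shift := mul_poch_add_one (l - N + x) (N + 1)
  rw [siteWeight_eq h, siteWeight_eq h, add_right_comm x 1 N, pow_succ]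
  push_cast at shift ⊢
  rw [← add_assoc (l - N) (x : ℝ) 1, mul_div_assoc', mul_div_assoc', ← neg_div,
    div_eq_div_iff hden' hden]
  linear_combination (-1) ^ (x + N) * (l + 2 * x - N) * (l - N + 2 * (x + 1))
    * ((N.choose x : ℝ) * (N - x) * shift
      - (l + x + 1) * poch (l - N + x) (N + 1) * natCast_choose_succ_mul N x)

lemma siteWeight_particle_succ_shift (x N : ℕ) :
    (N - x) * (l + 2 + x) * siteWeight x N (l + 2)
      = -((x + 1) * (l - N + x + 1) * siteWeight (x + 1) N l) := by
  have h' (m : ℤ) : l + 2 ≠ m := fun hm => h (m - 2) (by push_cast; linarith)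
  have hden := poch_int_ne_zero h (-N + x + 1) (b := l - N + x + 1) (by push_cast; ring) (N + 1)
  have hden' := poch_int_ne_zero h (-N + x + 2) (b := l - N + x + 1 + 1) (by push_cast; ring)
    (N + 1)
  have shift := mul_poch_add_one (l - N + x + 1) (N + 1)
  rw [siteWeight_eq h, siteWeight_eq h', add_right_comm x 1 N, pow_succ]
  push_cast at shift ⊢
  rw [← add_assoc (l - N) (x : ℝ) 1, show l + 2 - (N : ℝ) + x = l - N + x + 1 + 1 by ring,
    mul_div_assoc', mul_div_assoc', ← neg_div, div_eq_div_iff hden' hden]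
  linear_combination (-1) ^ (x + N) * (l - N + 2 * (x + 1))
    * (-(l + 2 + x) * poch (l - N + x + 1) (N + 1) * natCast_choose_succ_mul N x
      - (N.choose (x + 1)) * (x + 1) * shift)

lemma siteWeight_pair_balance (a b N₁ N₂ : ℕ) :
    siteWeight (a + 1) N₁ l * siteWeight b N₂ (l + 2 * (a + 1 : ℕ) - N₁)
        * bondRateRight N₁ N₂ l (a + 1) b
      = siteWeight a N₁ l * siteWeight (b + 1) N₂ (l + 2 * a - N₁)
        * bondRateLeft N₁ N₂ l a (b + 1) := by
  obtain ⟨H, hH⟩ : ∃ H, H = l + 2 * a - N₁ := ⟨_, rfl⟩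
  have hH' (m : ℤ) : H ≠ m := fun hm => h (m - 2 * a + N₁) (by push_cast; linarith)
  have hne₀ : H ≠ 0 := by simpa using hH' 0
  have hne₁ : H + 1 ≠ 0 := fun h0 => hH' (-1) (by push_cast; linarith)
  have hne₂ : H + 2 ≠ 0 := fun h0 => hH' (-2) (by push_cast; linarith)
  have first := siteWeight_particle_succ h a N₁
  have second := siteWeight_particle_succ_shift hH' b N₂
  rw [bondRateRight, bondRateLeft, show l + 2 * ((a + 1 : ℕ) : ℝ) - N₁ = H + 2 by
    rw [hH]; push_cast; ring, show H + 2 - 1 = H + 1 by ring, ← hH, mul_div_assoc', mul_div_assoc',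
    div_eq_div_iff (mul_ne_zero hne₂ hne₁) (mul_ne_zero hne₀ hne₁)]
  rw [show l + 2 * (a : ℝ) + 2 - N₁ = H + 2 by rw [hH]; ring, ← hH] at first
  push_cast
  linear_combination (H + 1) * (N₂ - b) * (H + 2 + b) * siteWeight b N₂ (H + 2) * first
    - (H + 1) * (H + 2) * (N₁ - a) * (l - N₁ + a) * siteWeight a N₁ l * second

end Balance

section Config
variable {M : ℕ} {N : Fin M → ℕ} {i j : Fin M} {η η' : Config N}

lemma weightL_exchanged (hij : (i : ℕ) + 1 = j) (lam : ℝ) (h : Exchanged i j η η') :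
    weightL lam η' = ((∏ k ∈ (Finset.univ.erase i).erase j,
        (-1) ^ N k * siteWeight (η k) (N k) (heightL lam η k)) * ((-1) ^ N i * (-1) ^ N j))
      * (siteWeight (η' i) (N i) (heightL lam η i)
        * siteWeight (η' j) (N j) (heightL lam η i + 2 * (η' i : ℕ) - N i)) := by
  rw [weightL, prod_eq_prod_erase_mul_pair (by rintro rfl; omega : i ≠ j), mul_assoc (∏ k ∈ _, _)]
  congr 1
  · refine Finset.prod_congr rfl fun k hk => ?_
    obtain ⟨hkj, hki, -⟩ : k ≠ j ∧ k ≠ i ∧ k ∈ Finset.univ := by simpa using hk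
    rw [h.off k hki hkj, h.heightL_eq hij lam (Fin.val_ne_of_ne hkj)]
  · rw [h.heightL_eq hij lam (by omega : (i : ℕ) ≠ j), ← hij, heightL_succ,
      h.heightL_eq hij lam (by omega : (i : ℕ) ≠ j)]
    ring

lemma weightR_exchanged (hij : (i : ℕ) + 1 = j) (rho : ℝ) (h : Exchanged i j η η') :
    weightR rho η' = (∏ k ∈ (Finset.univ.erase i).erase j,
        siteWeight (η k) (N k) (heightR rho η (k + 1)))
      * (siteWeight (η' j) (N j) (heightR rho η (j + 1))
        * siteWeight (η' i) (N i) (heightR rho η (j + 1) + 2 * (η' j : ℕ) - N j)) := by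
  rw [weightR, prod_eq_prod_erase_mul_pair (by rintro rfl; omega : i ≠ j)]
  congr 1
  · refine Finset.prod_congr rfl fun k hk => ?_
    obtain ⟨hkj, hki, -⟩ : k ≠ j ∧ k ≠ i ∧ k ∈ Finset.univ := by simpa using hk
    rw [h.off k hki hkj, h.heightR_eq hij rho (by have := Fin.val_ne_of_ne hki; omega)]
  · rw [hij, heightR_eq_succ, h.heightR_eq hij rho (by omega : (j : ℕ) + 1 ≠ j)]
    ring

lemma isReversible_weightL_of_generic {lam : ℝ} (hlam : ∀ m : ℤ, lam ≠ m) :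
    IsReversible (generatorL N lam) (weightL lam) := by
  refine isReversible_generator fun η i j hij hi hj => ?_
  have hne : i ≠ j := by rintro rfl; omega
  have hex := exchanged_jump hne η
  rw [rateLRight_eq, rateLLeft_eq hij, weightL_exchanged hij lam (.refl i j η),
    weightL_exchanged hij lam hex, hex.heightL_eq hij lam (by omega : (i : ℕ) ≠ j),
    jump_source hne hi hj, jump_target hi hj, mul_assoc _ _ (bondRateRight _ _ _ _ _),
    mul_assoc _ _ (bondRateLeft _ _ _ _ _)]
  congr 1
  obtain ⟨a, ha⟩ : ∃ a, (η i : ℕ) = a + 1 := ⟨(η i : ℕ) - 1, by omega⟩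
  rw [ha, Nat.add_sub_cancel]
  refine siteWeight_pair_balance (fun m hm => ?_) a (η j) (N i) (N j)
  rw [heightL_eq_add_excess] at hm
  exact hlam (m - excess η {j | (j : ℕ) < i}) (by push_cast; linarith)

lemma isReversible_weightR_of_generic {rho : ℝ} (hrho : ∀ m : ℤ, rho ≠ m) :
    IsReversible (generatorR N rho) (weightR rho) := by
  refine isReversible_generator fun η i j hij hi hj => ?_
  have hne : i ≠ j := by rintro rfl; omega
  have hex := exchanged_jump hne η
  rw [rateRRight_eq hij, rateRLeft_eq, weightR_exchanged hij rho (.refl i j η),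
    weightR_exchanged hij rho hex, hex.heightR_eq hij rho (by omega : (j : ℕ) + 1 ≠ j),
    jump_source hne hi hj, jump_target hi hj, mul_assoc _ _ (bondRateRight _ _ _ _ _),
    mul_assoc _ _ (bondRateLeft _ _ _ _ _)]
  congr 1
  obtain ⟨a, ha⟩ : ∃ a, (η i : ℕ) = a + 1 := ⟨(η i : ℕ) - 1, by omega⟩
  rw [ha, Nat.add_sub_cancel]
  refine (siteWeight_pair_balance (fun m hm => ?_) (η j) a (N j) (N i)).symm
  rw [heightR_eq_add_excess] at hm
  exact hrho (m - excess η {k | (j : ℕ) + 1 ≤ k}) (by push_cast; linarith)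

end Config

/-! ### Biorthogonality for generic parameters -/

section Cons
variable {M : ℕ} {N : Fin (M + 1) → ℕ}

lemma heightL_zero {M : ℕ} {N : Fin M → ℕ} (lam : ℝ) (ζ : Config N) : heightL lam ζ 0 = lam := by
  simp [heightL]

lemma heightL_cons (lam : ℝ) (z : Fin (N 0 + 1)) (ζ : Config fun k : Fin M => N k.succ) (k : ℕ) :
    heightL lam (Fin.cons z ζ : Config N) (k + 1)
      = heightL (lam + 2 * ((z : ℕ) : ℝ) - N 0) ζ k := by
  simp only [heightL, Fin.sum_univ_succ, Fin.cons_zero, Fin.cons_succ, Fin.val_zero, Fin.val_succ,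
    Nat.add_lt_add_iff_right, Nat.succ_pos, if_true]
  ring

lemma heightR_cons (rho : ℝ) (z : Fin (N 0 + 1)) (ξ : Config fun k : Fin M => N k.succ) (k : ℕ) :
    heightR rho (Fin.cons z ξ : Config N) (k + 1) = heightR rho ξ k := by
  simp [heightR, Fin.sum_univ_succ]

lemma duality_cons (lam rho v : ℝ) (z x : Fin (N 0 + 1)) (ζ ξ : Config fun k : Fin M => N k.succ) :
    duality lam rho v (Fin.cons z ζ : Config N) (Fin.cons x ξ)
      = siteDuality z x lam (heightR rho ξ 0) v (N 0)
        * duality (lam + 2 * ((z : ℕ) : ℝ) - N 0) rho v ζ ξ := by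
  simp only [duality, Fin.prod_univ_succ, Fin.cons_zero, Fin.cons_succ, Fin.val_zero, Fin.val_succ,
    heightL_cons, heightR_cons, heightL_zero]

lemma weightL_cons (lam : ℝ) (z : Fin (N 0 + 1)) (ζ : Config fun k : Fin M => N k.succ) :
    weightL lam (Fin.cons z ζ : Config N) = (-1) ^ N 0 * siteWeight z (N 0) lam
        * weightL (lam + 2 * ((z : ℕ) : ℝ) - N 0) ζ := by
  simp only [weightL, Fin.prod_univ_succ, Fin.cons_zero, Fin.cons_succ, Fin.val_zero, Fin.val_succ,
    heightL_cons, heightL_zero]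

lemma weightR_cons (rho : ℝ) (x : Fin (N 0 + 1)) (ξ : Config fun k : Fin M => N k.succ) :
    weightR rho (Fin.cons x ξ : Config N)
      = siteWeight x (N 0) (heightR rho ξ 0) * weightR rho ξ := by
  simp only [weightR, Fin.prod_univ_succ, Fin.cons_zero, Fin.cons_succ, Fin.val_zero, Fin.val_succ,
    heightR_cons]

lemma Config.exists_eq_cons (η : Config N) :
    ∃ (x : Fin (N 0 + 1)) (τ : Config fun k : Fin M => N k.succ), η = Fin.cons x τ :=
  ⟨η 0, Fin.tail η, (Fin.cons_self_tail η).symm⟩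

end Cons

theorem duality_orthogonal_of_generic {M : ℕ} {N : Fin M → ℕ} {lam rho v : ℝ}
    (hg : Generic lam rho v) (ξ ξ' : Config N) :
    ∑ ζ : Config N, duality lam rho v ζ ξ * duality lam rho (-v) ζ ξ' * weightL lam ζ
      = (if ξ = ξ' then 1 else 0) / weightR rho ξ := by
  induction M generalizing lam with
  | zero =>
    rw [if_pos (Subsingleton.elim _ _)]
    simp [duality, weightL, weightR]
  | succ M ih =>
    obtain ⟨x, ξ, rfl⟩ := ξ.exists_eq_cons
    obtain ⟨x', ξ', rfl⟩ := ξ'.exists_eq_cons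
    have sum_tail (z : Fin (N 0 + 1)) : ∑ ζ : Config fun k : Fin M => N k.succ,
          duality lam rho v (Fin.cons z ζ : Config N) (Fin.cons x ξ)
            * duality lam rho (-v) (Fin.cons z ζ : Config N) (Fin.cons x' ξ')
            * weightL lam (Fin.cons z ζ : Config N)
        = siteDuality z x lam (heightR rho ξ 0) v (N 0)
          * siteDuality z x' lam (heightR rho ξ' 0) (-v) (N 0)
          * ((-1) ^ N 0 * siteWeight z (N 0) lam)
          * ((if ξ = ξ' then 1 else 0) / weightR rho ξ) := by
      rw [← ih (lam := lam + 2 * ((z : ℕ) : ℝ) - N 0)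
        (hg.shift (2 * (z : ℕ) - N 0) 0 (by push_cast; ring) (by simp)), Finset.mul_sum]
      refine Finset.sum_congr rfl fun ζ _ => ?_
      rw [duality_cons, duality_cons, weightL_cons]
      ring
    rw [← (Fin.consEquiv fun k => Fin (N k + 1)).sum_comp, Fintype.sum_prod_type]
    refine (Finset.sum_congr rfl fun z _ => sum_tail z).trans ?_
    rw [← Finset.sum_mul, weightR_cons]
    by_cases tails : ξ = ξ'
    · subst tails
      have site := siteInner_eq
        (hg.shift (lam' := lam) 0 _ (by simp) (heightR_eq_add_excess rho ξ 0))
        (Nat.lt_succ_iff.1 x.isLt) (Nat.lt_succ_iff.1 x'.isLt)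
      rw [siteInner, ← Fin.sum_univ_eq_sum_range] at site
      simp only [site, Fin.cons_inj, Fin.ext_iff, and_true, if_true]
      rw [div_mul_div_comm, mul_one]
    · simp [tails, Fin.cons_inj]

/-! ### Non-vanishing of the weights and of the denominators of the rates -/

section Bounds
variable {M : ℕ} {N : Fin M → ℕ}

lemma WeightDefined.add_excess_add_ne_zero {s : ℝ} (h : WeightDefined N s) (η : Config N)
    {S : Finset (Fin M)} {i : Fin M} (hi : i ∉ S) {n : ℤ} (hn : |n| ≤ N i) :
    s + (excess η S : ℝ) + n ≠ 0 := by
  intro sum_eq_zero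
  refine h (-(excess η S + n)) ?_ (by push_cast; linarith)
  calc |-(excess η S + n)| = |excess η S + n| := abs_neg _
    _ ≤ |excess η S| + |n| := abs_add_le _ _
    _ ≤ |excess η S| + N i := by gcongr
    _ ≤ capacity N := abs_excess_add_le η hi

lemma WeightDefined.heightL_add_ne_zero {lam : ℝ} (h : WeightDefined N lam) (ζ : Config N)
    (i : Fin M) {n : ℤ} (hn : |n| ≤ N i) : heightL lam ζ i + n ≠ 0 := by
  rw [heightL_eq_add_excess]
  exact h.add_excess_add_ne_zero ζ (by simp) hn

lemma WeightDefined.heightR_add_ne_zero {rho : ℝ} (h : WeightDefined N rho) (ξ : Config N)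
    (i : Fin M) {n : ℤ} (hn : |n| ≤ N i) : heightR rho ξ (i + 1) + n ≠ 0 := by
  rw [heightR_eq_add_excess]
  exact h.add_excess_add_ne_zero ξ (by simp) hn

/-- No factor of the numerator or the denominator of `siteWeight x N r` vanishes. -/
structure SiteRegular (x N : ℕ) (r : ℝ) : Prop where
  mid : 2 * x + r - N ≠ 0
  low : r - N ≠ 0
  num : poch (r - N) x ≠ 0
  den : poch (r + 1) x ≠ 0
  norm : poch (-r) N ≠ 0

lemma siteRegular_of_ne {x N : ℕ} {r : ℝ} (hx : x ≤ N) (h : ∀ n : ℤ, |n| ≤ N → r + n ≠ 0) :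
    SiteRegular x N r where
  mid eq_zero := h (2 * x - N) (by rw [abs_le]; omega) (by push_cast; linarith)
  low eq_zero := h (-N) (by rw [abs_le]; omega) (by push_cast; linarith)
  num := poch_ne_zero_iff.2 fun i hi eq_zero =>
    h (-N + i) (by rw [abs_le]; omega) (by push_cast; linarith)
  den := poch_ne_zero_iff.2 fun i hi eq_zero =>
    h (1 + i) (by rw [abs_le]; omega) (by push_cast; linarith)
  norm := poch_ne_zero_iff.2 fun i hi eq_zero =>
    h (-i) (by rw [abs_le]; omega) (by push_cast; linarith)

lemma WeightDefined.siteRegularL {lam : ℝ} (h : WeightDefined N lam) (ζ : Config N) (k : Fin M) :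
    SiteRegular (ζ k) (N k) (heightL lam ζ k) :=
  siteRegular_of_ne (ζ.le k) fun _ hn => h.heightL_add_ne_zero ζ k hn

lemma WeightDefined.siteRegularR {rho : ℝ} (h : WeightDefined N rho) (ξ : Config N) (k : Fin M) :
    SiteRegular (ξ k) (N k) (heightR rho ξ (k + 1)) :=
  siteRegular_of_ne (ξ.le k) fun _ hn => h.heightR_add_ne_zero ξ k hn

lemma SiteRegular.siteWeight_ne_zero {x N : ℕ} {r : ℝ} (h : SiteRegular x N r) (hx : x ≤ N) :
    siteWeight x N r ≠ 0 := by
  have choose_ne : (N.choose x : ℝ) ≠ 0 := Nat.cast_ne_zero.2 (Nat.choose_pos hx).ne'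
  exact mul_ne_zero (mul_ne_zero (mul_ne_zero (by simp) (div_ne_zero h.mid h.low))
    (div_ne_zero h.num (mul_ne_zero h.den h.norm))) choose_ne

lemma WeightDefined.weightL_ne_zero {lam : ℝ} (h : WeightDefined N lam) (ζ : Config N) :
    weightL lam ζ ≠ 0 :=
  Finset.prod_ne_zero_iff.2 fun k _ =>
    mul_ne_zero (by simp) ((h.siteRegularL ζ k).siteWeight_ne_zero (ζ.le k))

lemma WeightDefined.weightR_ne_zero {rho : ℝ} (h : WeightDefined N rho) (ξ : Config N) :
    weightR rho ξ ≠ 0 :=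
  Finset.prod_ne_zero_iff.2 fun k _ => (h.siteRegularR ξ k).siteWeight_ne_zero (ξ.le k)

lemma WeightDefined.ratesDefinedL (hN : ∀ k, 0 < N k) {lam : ℝ} (h : WeightDefined N lam) :
    RatesDefinedL N lam := by
  intro ζ i j hij
  have one_le : (1 : ℤ) ≤ N j := by exact_mod_cast hN j
  have height_ne := h.heightL_add_ne_zero ζ j (n := 0) (by simp)
  have succ_ne := h.heightL_add_ne_zero ζ j (n := 1) (by simpa using one_le)
  have pred_ne := h.heightL_add_ne_zero ζ j (n := -1) (by simpa using one_le)
  push_cast [add_zero, ← sub_eq_add_neg] at height_ne succ_ne pred_ne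
  rw [hij]
  exact ⟨fun _ _ => mul_ne_zero height_ne pred_ne, fun _ _ => mul_ne_zero height_ne succ_ne⟩

lemma WeightDefined.ratesDefinedR (hN : ∀ k, 0 < N k) {rho : ℝ} (h : WeightDefined N rho) :
    RatesDefinedR N rho := by
  intro ξ i j hij
  have one_le : (1 : ℤ) ≤ N i := by exact_mod_cast hN i
  have height_ne := h.heightR_add_ne_zero ξ i (n := 0) (by simp)
  have succ_ne := h.heightR_add_ne_zero ξ i (n := 1) (by simpa using one_le)
  have pred_ne := h.heightR_add_ne_zero ξ i (n := -1) (by simpa using one_le)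
  push_cast [add_zero, ← sub_eq_add_neg] at height_ne succ_ne pred_ne
  rw [← hij]
  exact ⟨fun _ _ => mul_ne_zero height_ne succ_ne, fun _ _ => mul_ne_zero height_ne pred_ne⟩

end Bounds

/-! ### Density of generic parameters -/

lemma countable_setOf_eq_int (a : ℝ) {c : ℝ} (hc : c ≠ 0) :
    {t : ℝ | ∃ m : ℤ, a + c * t = m}.Countable := by
  have injective : Function.Injective fun t : ℝ => a + c * t :=
    fun s t hst => by simpa [hc] using hst
  refine ((Set.countable_range fun m : ℤ => (m : ℝ)).preimage injective).mono ?_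
  exact fun t ⟨m, hm⟩ => ⟨m, hm.symm⟩

lemma dense_generic : Dense {p : ℝ × ℝ × ℝ | Generic p.1 p.2.1 p.2.2} := by
  intro ⟨lam, rho, v⟩
  -- None of the six linear forms of `Generic` is constant in the direction `(1, 3, 10)`.
  let line (t : ℝ) : ℝ × ℝ × ℝ := (lam + t, rho + 3 * t, v + 10 * t)
  have countable_bad : {t | ∃ m : ℤ, lam + 1 * t = m} ∪ {t | ∃ m : ℤ, rho + 3 * t = m}
      ∪ {t | ∃ m : ℤ, rho + lam + v + 14 * t = m} ∪ {t | ∃ m : ℤ, rho + lam - v + -6 * t = m}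
      ∪ {t | ∃ m : ℤ, lam - rho + v + 8 * t = m} ∪ {t | ∃ m : ℤ, lam - rho - v + -12 * t = m}
      |>.Countable := by
    refine .union (.union (.union (.union (.union ?_ ?_) ?_) ?_) ?_) ?_ <;>
      exact countable_setOf_eq_int _ (by norm_num)
  have dense_good : Dense {t | Generic (line t).1 (line t).2.1 (line t).2.2} := by
    refine (countable_bad.dense_compl ℝ).mono fun t ht => ?_
    simp only [Set.compl_union, Set.mem_inter_iff, Set.mem_compl_iff, Set.mem_ofPred_eq,
      not_exists] at ht
    obtain ⟨⟨⟨⟨⟨lam_ne, rho_ne⟩, sum_add_ne⟩, sum_sub_ne⟩, diff_add_ne⟩, diff_sub_ne⟩ := ht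
    exact ⟨fun m hm => lam_ne m (by linarith), fun m hm => rho_ne m hm,
      fun m hm => sum_add_ne m (by linarith), fun m hm => sum_sub_ne m (by linarith),
      fun m hm => diff_add_ne m (by linarith), fun m hm => diff_sub_ne m (by linarith)⟩
  have line_zero : line 0 = (lam, rho, v) := by simp [line]
  rw [← line_zero]
  exact map_mem_closure (by fun_prop) (dense_good 0) fun _ ht => ht

lemma eq_of_eq_generic {f g : ℝ × ℝ × ℝ → ℝ} (h : ∀ p, Generic p.1 p.2.1 p.2.2 → f p = g p)
    {p₀ : ℝ × ℝ × ℝ} (hf : ContinuousAt f p₀) (hg : ContinuousAt g p₀) : f p₀ = g p₀ := by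
  let S := {p : ℝ × ℝ × ℝ | Generic p.1 p.2.1 p.2.2}
  have : (𝓝[S] p₀).NeBot := mem_closure_iff_nhdsWithin_neBot.1 (dense_generic p₀)
  have eqOn_generic : f =ᶠ[𝓝[S] p₀] g := eventually_nhdsWithin_of_forall h
  exact tendsto_nhds_unique_of_eventuallyEq (hf.mono_left nhdsWithin_le_nhds)
    (hg.mono_left nhdsWithin_le_nhds) eqOn_generic

/-! ### Continuity in the parameters -/

lemma poch_ne_zero_of_le {a : ℝ} {m n : ℕ} (hmn : m ≤ n) (h : poch a n ≠ 0) : poch a m ≠ 0 :=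
  poch_ne_zero_iff.2 fun i hi => poch_ne_zero_iff.1 h i (hi.trans_le hmn)

section Continuity
variable {T : Type*} [TopologicalSpace T] {l r w : T → ℝ} {t₀ : T}

lemma continuousAt_poch (hl : ContinuousAt l t₀) (n : ℕ) :
    ContinuousAt (fun t => poch (l t) n) t₀ :=
  tendsto_finsetProd _ fun _ _ => hl.add continuousAt_const

lemma continuousAt_prefactor (hl : ContinuousAt l t₀) (hr : ContinuousAt r t₀)
    (hw : ContinuousAt w t₀) {y x N : ℕ}
    (h : poch (-(x : ℝ) + (l t₀ - r t₀ + N + w t₀ + 1) / 2) (x + y) ≠ 0) :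
    ContinuousAt (fun t => prefactor y x (l t) (r t) (w t) N) t₀ := by
  refine .div (.mul (.mul ?_ ?_) ?_) ?_ h <;> exact continuousAt_poch (by fun_prop) _

lemma continuousAt_racahSeries (hl : ContinuousAt l t₀) (hr : ContinuousAt r t₀)
    (hw : ContinuousAt w t₀) {m y x N : ℕ} (hN : m ≤ N)
    (hsub : poch ((r t₀ + l t₀ - N - w t₀ + 1) / 2) m ≠ 0)
    (hadd : poch ((r t₀ + l t₀ - N + w t₀ + 1) / 2) m ≠ 0) :
    ContinuousAt (fun t => racahSeries (m + 1) y x (l t) (r t) (w t) N) t₀ := by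
  simp only [racahSeries, hyperSum, hyperTerm]
  refine tendsto_finsetSum _ fun n hn => ?_
  change ContinuousAt _ t₀
  replace hn : n ≤ m := Nat.lt_succ_iff.1 (Finset.mem_range.1 hn)
  refine .div_const (.div ?_ ?_ ?_) _
  · refine .mul (.mul (.mul ?_ ?_) ?_) ?_ <;> exact continuousAt_poch (by fun_prop) _
  · refine .mul (.mul ?_ ?_) ?_ <;> exact continuousAt_poch (by fun_prop) _
  · exact mul_ne_zero (mul_ne_zero (poch_ne_zero_of_le hn hsub) (poch_ne_zero_of_le hn hadd))
      (poch_neg_ne_zero (hn.trans hN))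

lemma continuousAt_siteWeight (hr : ContinuousAt r t₀) {x N : ℕ} (h : SiteRegular x N (r t₀)) :
    ContinuousAt (fun t => siteWeight x N (r t)) t₀ := by
  refine .mul (.mul (.mul continuousAt_const (.div (by fun_prop) (by fun_prop) h.low))
    (.div ?_ (.mul ?_ ?_) (mul_ne_zero h.den h.norm))) continuousAt_const <;>
    exact continuousAt_poch (by fun_prop) _

variable {M : ℕ} {N : Fin M → ℕ}

lemma continuousAt_heightL (hl : ContinuousAt l t₀) (ζ : Config N) (i : ℕ) :
    ContinuousAt (fun t => heightL (l t) ζ i) t₀ :=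
  hl.add continuousAt_const

lemma continuousAt_heightR (hr : ContinuousAt r t₀) (ξ : Config N) (i : ℕ) :
    ContinuousAt (fun t => heightR (r t) ξ i) t₀ :=
  hr.add continuousAt_const

lemma continuousAt_duality (hl : ContinuousAt l t₀) (hr : ContinuousAt r t₀)
    (hw : ContinuousAt w t₀) (h : DualityDefined N (l t₀) (r t₀) (w t₀)) (ζ ξ : Config N) :
    ContinuousAt (fun t => duality (l t) (r t) (w t) ζ ξ) t₀ := by
  refine tendsto_finsetProd _ fun k _ => ?_
  obtain ⟨hsub, hadd, hden⟩ := h ζ ξ k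
  have cl := continuousAt_heightL hl ζ k
  have cr := continuousAt_heightR hr ξ (k + 1)
  simp only [siteDuality_eq_prefactor_mul
    (show min (ξ k : ℕ) (ζ k) < min (ζ k : ℕ) (ξ k) + 1 by rw [min_comm]; exact Nat.lt_succ_self _)]
  exact (continuousAt_prefactor cl cr hw hden).mul
    (continuousAt_racahSeries cl cr hw ((min_le_left _ _).trans (ζ.le k)) hsub hadd)

lemma continuousAt_weightL (hl : ContinuousAt l t₀) (h : WeightDefined N (l t₀)) (ζ : Config N) :
    ContinuousAt (fun t => weightL (l t) ζ) t₀ :=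
  tendsto_finsetProd _ fun k _ => ContinuousAt.mul continuousAt_const
    (continuousAt_siteWeight (continuousAt_heightL hl ζ k) (h.siteRegularL ζ k))

lemma continuousAt_weightR (hr : ContinuousAt r t₀) (h : WeightDefined N (r t₀)) (ξ : Config N) :
    ContinuousAt (fun t => weightR (r t) ξ) t₀ :=
  tendsto_finsetProd _ fun k _ =>
    continuousAt_siteWeight (continuousAt_heightR hr ξ (k + 1)) (h.siteRegularR ξ k)

/-- The denominator of an exchange rate may vanish when the jump is impossible, since the rate is
then constantly zero. -/
lemma continuousAt_exchange_rate {a b n : ℕ} (hb : b ≤ n) {A B C : T → ℝ}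
    (hA : ContinuousAt A t₀) (hB : ContinuousAt B t₀) (hC : ContinuousAt C t₀)
    (h : 0 < a → b < n → C t₀ ≠ 0) :
    ContinuousAt (fun t => (a : ℝ) * ((n : ℝ) - b) * A t * B t / C t) t₀ := by
  by_cases possible : 0 < a ∧ b < n
  · exact .div (by fun_prop) hC (h possible.1 possible.2)
  · have impossible : a = 0 ∨ b = n := by omega
    have coeff_zero : (a : ℝ) * ((n : ℝ) - b) = 0 := by rcases impossible with rfl | rfl <;> simp
    simp only [coeff_zero, zero_mul, zero_div]
    exact continuousAt_const

lemma continuousAt_generator {cR cL : T → Config N → Fin M → Fin M → ℝ} {f : T → Config N → ℝ}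
    {η : Config N} (hR : ∀ i j : Fin M, (i : ℕ) + 1 = j → ContinuousAt (fun t => cR t η i j) t₀)
    (hL : ∀ i j : Fin M, (i : ℕ) + 1 = j → ContinuousAt (fun t => cL t η i j) t₀)
    (hf : ∀ η, ContinuousAt (fun t => f t η) t₀) :
    ContinuousAt (fun t => generator (cR t) (cL t) (f t) η) t₀ := by
  refine tendsto_finsetSum _ fun i _ => tendsto_finsetSum _ fun j _ => ?_
  split_ifs with hij
  · exact ((hR i j hij).mul ((hf _).sub (hf _))).add ((hL i j hij).mul ((hf _).sub (hf _)))
  · exact tendsto_const_nhds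

lemma continuousAt_generatorL (hl : ContinuousAt l t₀) (h : RatesDefinedL N (l t₀))
    {f : T → Config N → ℝ} (hf : ∀ ζ, ContinuousAt (fun t => f t ζ) t₀) (ζ : Config N) :
    ContinuousAt (fun t => generatorL N (l t) (f t) ζ) t₀ := by
  have height := continuousAt_heightL hl ζ
  refine continuousAt_generator (fun i j hij => ?_) (fun i j hij => ?_) hf
  · exact continuousAt_exchange_rate (ζ.le j) ((height _).add_const _) ((height _).add_const _)
      ((height _).mul ((height _).sub_const _)) (h ζ i j hij).1
  · exact continuousAt_exchange_rate (ζ.le i) ((height _).sub_const _) ((height _).sub_const _)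
      ((height _).mul ((height _).add_const _)) (h ζ i j hij).2

lemma continuousAt_generatorR (hr : ContinuousAt r t₀) (h : RatesDefinedR N (r t₀))
    {f : T → Config N → ℝ} (hf : ∀ ξ, ContinuousAt (fun t => f t ξ) t₀) (ξ : Config N) :
    ContinuousAt (fun t => generatorR N (r t) (f t) ξ) t₀ := by
  have height := continuousAt_heightR hr ξ
  refine continuousAt_generator (fun i j hij => ?_) (fun i j hij => ?_) hf
  · exact continuousAt_exchange_rate (ξ.le j) ((height _).sub_const _) ((height _).sub_const _)
      ((height _).mul ((height _).add_const _)) (h ξ i j hij).1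
  · exact continuousAt_exchange_rate (ξ.le i) ((height _).add_const _) ((height _).add_const _)
      ((height _).mul ((height _).sub_const _)) (h ξ i j hij).2

end Continuity

/-! ### Duality, reversibility and biorthogonality -/

section Main
variable {M : ℕ} {N : Fin M → ℕ} {lam rho v : ℝ}

theorem isDuality_duality (hN : ∀ k, 0 < N k) (hv : DualityDefined N lam rho v)
    (hL : RatesDefinedL N lam) (hR : RatesDefinedR N rho) :
    IsDuality (generatorL N lam) (generatorR N rho) (duality lam rho v) := by
  intro ζ ξ
  have lam_cts : ContinuousAt (fun p : ℝ × ℝ × ℝ => p.1) (lam, rho, v) := by fun_prop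
  have rho_cts : ContinuousAt (fun p : ℝ × ℝ × ℝ => p.2.1) (lam, rho, v) := by fun_prop
  have v_cts : ContinuousAt (fun p : ℝ × ℝ × ℝ => p.2.2) (lam, rho, v) := by fun_prop
  have duality_cts (ζ ξ : Config N) :
      ContinuousAt (fun p : ℝ × ℝ × ℝ => duality p.1 p.2.1 p.2.2 ζ ξ) (lam, rho, v) :=
    continuousAt_duality lam_cts rho_cts v_cts hv ζ ξ
  exact (eq_of_eq_generic (fun p hp => isDuality_duality_of_generic hN hp ζ ξ)
    (continuousAt_generatorL lam_cts hL (duality_cts · ξ) ζ)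
    (continuousAt_generatorR rho_cts hR (duality_cts ζ) ξ) :)

theorem isReversible_weightL (hN : ∀ k, 0 < N k) (h : WeightDefined N lam) :
    IsReversible (generatorL N lam) (weightL lam) := by
  intro η η'
  have flow_cts (η η' : Config N) : ContinuousAt (fun p : ℝ × ℝ × ℝ =>
      weightL p.1 η * generatorL N p.1 (Pi.single η' 1) η) (lam, 0, 0) := by
    refine .mul ?_ ?_
    · exact continuousAt_weightL continuousAt_fst h η
    · exact continuousAt_generatorL (f := fun _ => Pi.single η' 1) continuousAt_fst
        (h.ratesDefinedL hN) (fun _ => continuousAt_const) η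
  exact (eq_of_eq_generic (fun p hp => isReversible_weightL_of_generic hp.lam_ne η η')
    (flow_cts η η') (flow_cts η' η) :)

theorem isReversible_weightR (hN : ∀ k, 0 < N k) (h : WeightDefined N rho) :
    IsReversible (generatorR N rho) (weightR rho) := by
  intro η η'
  have snd_cts : ContinuousAt (fun p : ℝ × ℝ × ℝ => p.2.1) (0, rho, 0) := by fun_prop
  have flow_cts (η η' : Config N) : ContinuousAt (fun p : ℝ × ℝ × ℝ =>
      weightR p.2.1 η * generatorR N p.2.1 (Pi.single η' 1) η) (0, rho, 0) := by
    refine .mul ?_ ?_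
    · exact continuousAt_weightR snd_cts h η
    · exact continuousAt_generatorR (f := fun _ => Pi.single η' 1) snd_cts
        (h.ratesDefinedR hN) (fun _ => continuousAt_const) η
  exact (eq_of_eq_generic (fun p hp => isReversible_weightR_of_generic hp.rho_ne η η')
    (flow_cts η η') (flow_cts η' η) :)

theorem duality_orthogonal (hL : WeightDefined N lam) (hR : WeightDefined N rho)
    (hv : DualityDefined N lam rho v) (hv' : DualityDefined N lam rho (-v)) (ξ ξ' : Config N) :
    ∑ ζ : Config N, duality lam rho v ζ ξ * duality lam rho (-v) ζ ξ' * weightL lam ζ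
      = (if ξ = ξ' then 1 else 0) / weightR rho ξ := by
  have lam_cts : ContinuousAt (fun p : ℝ × ℝ × ℝ => p.1) (lam, rho, v) := by fun_prop
  have rho_cts : ContinuousAt (fun p : ℝ × ℝ × ℝ => p.2.1) (lam, rho, v) := by fun_prop
  have v_cts : ContinuousAt (fun p : ℝ × ℝ × ℝ => p.2.2) (lam, rho, v) := by fun_prop
  have lhs_cts : ContinuousAt (fun p : ℝ × ℝ × ℝ => ∑ ζ : Config N, duality p.1 p.2.1 p.2.2 ζ ξ
      * duality p.1 p.2.1 (-p.2.2) ζ ξ' * weightL p.1 ζ) (lam, rho, v) :=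
    tendsto_finsetSum _ fun ζ _ => ((continuousAt_duality lam_cts rho_cts v_cts hv ζ ξ).mul
      (continuousAt_duality lam_cts rho_cts v_cts.neg hv' ζ ξ')).mul
        (continuousAt_weightL lam_cts hL ζ)
  have rhs_cts : ContinuousAt (fun p : ℝ × ℝ × ℝ =>
      (if ξ = ξ' then (1 : ℝ) else 0) / weightR p.2.1 ξ) (lam, rho, v) :=
    continuousAt_const.div (continuousAt_weightR rho_cts hR ξ) (hR.weightR_ne_zero ξ)
  exact (eq_of_eq_generic (fun p hp => duality_orthogonal_of_generic hp ξ ξ') lhs_cts rhs_cts :)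

/-- A one-sided inverse of a square matrix is two-sided. -/
lemma dual_orthogonal {ι : Type*} [Fintype ι] [DecidableEq ι] {A B : ι → ι → ℝ} {wL wR : ι → ℝ}
    (hL : ∀ i, wL i ≠ 0) (hR : ∀ i, wR i ≠ 0)
    (h : ∀ x x', ∑ z, A z x * B z x' * wL z = (if x = x' then 1 else 0) / wR x) (z z' : ι) :
    ∑ x, A z x * B z' x * wR x = (if z = z' then 1 else 0) / wL z := by
  have right_inverse : (Matrix.of fun x z => A z x * wL z) * (Matrix.of fun z x => B z x * wR x)
      = (1 : Matrix ι ι ℝ) := by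
    ext x x'
    rw [Matrix.mul_apply, Matrix.one_apply]
    simp only [Matrix.of_apply]
    calc ∑ z, A z x * wL z * (B z x' * wR x') = (∑ z, A z x * B z x' * wL z) * wR x' := by
          rw [Finset.sum_mul]
          exact Finset.sum_congr rfl fun z _ => by ring
      _ = if x = x' then 1 else 0 := by
          rw [h]
          split_ifs with hx
          · rw [← hx, div_mul_cancel₀ _ (hR x)]
          · simp
  have left_inverse := congrArg (fun m : Matrix ι ι ℝ => m z' z) (mul_eq_one_comm.1 right_inverse)
  simp only [Matrix.mul_apply, Matrix.one_apply, Matrix.of_apply, eq_comm (a := z')]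
    at left_inverse
  rw [eq_div_iff (hL z), Finset.sum_mul, ← left_inverse]
  exact Finset.sum_congr rfl fun x _ => by ring

end Main

/-! ### Powers of `q` and their behaviour as `q → 1` -/

open Filter

lemma eventually_pos_ne_one : ∀ᶠ q : ℝ in 𝓝[≠] 1, 0 < q ∧ q ≠ 1 := by
  filter_upwards [nhdsWithin_le_nhds (lt_mem_nhds one_pos), self_mem_nhdsWithin] with q hpos hne
  exact ⟨hpos, hne⟩

lemma one_sub_sq_ne_zero {q : ℝ} (hq : 0 < q ∧ q ≠ 1) : 1 - (q : ℂ) ^ 2 ≠ 0 := by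
  have sq_ne_one : q ^ 2 ≠ 1 := sq_ne_one_iff.2 ⟨hq.2, by linarith [hq.1]⟩
  exact sub_ne_zero.2 (by exact_mod_cast sq_ne_one.symm)

lemma qpow_add {q : ℝ} (hq : 0 < q) (a b : ℂ) : qpow q (a + b) = qpow q a * qpow q b :=
  Complex.cpow_add _ _ (by exact_mod_cast hq.ne')

lemma qpow_neg (q : ℝ) (a : ℂ) : qpow q (-a) = (qpow q a)⁻¹ :=
  Complex.cpow_neg _ _

lemma qpow_two_mul_natCast (q : ℝ) (n : ℕ) : qpow q (2 * n) = ((q : ℂ) ^ 2) ^ n := by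
  rw [mul_comm, qpow, Complex.cpow_nat_mul, Complex.cpow_ofNat]

lemma tendsto_qpow_one (a : ℂ) : Tendsto (fun q : ℝ => qpow q a) (𝓝[≠] 1) (𝓝 1) := by
  have cts : ContinuousAt (fun q : ℝ => qpow q a) 1 :=
    Complex.continuous_ofReal.continuousAt.cpow continuousAt_const (by simp)
  simpa [qpow] using cts.tendsto.mono_left nhdsWithin_le_nhds

lemma tendsto_one_sub_qpow_div (a : ℂ) :
    Tendsto (fun q : ℝ => (1 - qpow q (2 * a)) / (1 - (q : ℂ) ^ 2)) (𝓝[≠] 1) (𝓝 a) := by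
  have slope_tendsto (b : ℂ) : Tendsto (slope (fun q : ℝ => qpow q b) 1) (𝓝[≠] 1) (𝓝 b) := by
    have deriv : HasDerivAt (fun z : ℂ => z ^ b) b ((1 : ℝ) : ℂ) := by
      simpa using
        (Complex.hasStrictDerivAt_cpow_const (c := b) Complex.one_mem_slitPlane).hasDerivAt
    exact hasDerivAt_iff_tendsto_slope.1 deriv.comp_ofReal
  have ratio := (slope_tendsto (2 * a)).div (slope_tendsto 2) two_ne_zero
  rw [mul_div_cancel_left₀ a two_ne_zero] at ratio
  refine ratio.congr' ?_
  filter_upwards [self_mem_nhdsWithin] with q hq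
  have sub_ne : (((q - 1)⁻¹ : ℝ) : ℂ) ≠ 0 := by exact_mod_cast inv_ne_zero (sub_ne_zero.2 hq)
  simp only [Pi.div_apply, slope, vsub_eq_sub, Complex.real_smul]
  rw [mul_div_mul_left _ _ sub_ne, ← neg_div_neg_eq]
  simp [qpow]

/-- The shifted factorial `(q^(2a); q²)_n`, the `q`-analogue of `(a)_n`. -/
noncomputable def qShiftedFactorial (q : ℝ) (a : ℂ) (n : ℕ) : ℂ :=
  qpoch (qpow q (2 * a)) ((q : ℂ) ^ 2) n

lemma qShiftedFactorial_eq_prod {q : ℝ} (hq : 0 < q) (a : ℂ) (n : ℕ) :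
    qShiftedFactorial q a n = ∏ i ∈ Finset.range n, (1 - qpow q (2 * (a + i))) := by
  rw [qShiftedFactorial, qpoch]
  refine Finset.prod_congr rfl fun i _ => ?_
  rw [mul_add, qpow_add hq, qpow_two_mul_natCast]

lemma qpoch_self_eq (q : ℝ) (n : ℕ) :
    qpoch ((q : ℂ) ^ 2) ((q : ℂ) ^ 2) n = qShiftedFactorial q 1 n := by
  simp [qShiftedFactorial, qpow]

lemma qShiftedFactorial_neg_eq_zero {q : ℝ} (hq : 0 < q) {x n : ℕ} (hn : x < n) :
    qShiftedFactorial q (-x) n = 0 := by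
  rw [qShiftedFactorial_eq_prod hq]
  exact Finset.prod_eq_zero (Finset.mem_range.2 hn) (by simp [qpow])

lemma tendsto_qShiftedFactorial_div (a : ℝ) (n : ℕ) :
    Tendsto (fun q : ℝ => qShiftedFactorial q a n / (1 - (q : ℂ) ^ 2) ^ n) (𝓝[≠] 1)
      (𝓝 ((poch a n : ℝ) : ℂ)) := by
  rw [poch, Complex.ofReal_prod]
  refine (tendsto_finsetProd _ fun (i : ℕ) _ =>
    tendsto_one_sub_qpow_div ((a + i : ℝ) : ℂ)).congr' ?_
  filter_upwards [eventually_pos_ne_one] with q hq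
  rw [qShiftedFactorial_eq_prod hq.1, Finset.prod_div_distrib, Finset.prod_const,
    Finset.card_range]
  push_cast
  rfl

lemma poch_one_eq_factorial (n : ℕ) : poch 1 n = n.factorial := by
  rw [poch, ← Finset.prod_range_add_one_eq_factorial]
  push_cast
  exact Finset.prod_congr rfl fun i _ => add_comm _ _

lemma tendsto_qpoch_self_div (n : ℕ) :
    Tendsto (fun q : ℝ => qpoch ((q : ℂ) ^ 2) ((q : ℂ) ^ 2) n / (1 - (q : ℂ) ^ 2) ^ n) (𝓝[≠] 1)
      (𝓝 (n.factorial : ℂ)) := by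
  simpa [qpoch_self_eq, poch_one_eq_factorial] using tendsto_qShiftedFactorial_div 1 n

lemma tendsto_qbinom {N x : ℕ} (hx : x ≤ N) :
    Tendsto (fun q : ℝ => qbinom ((q : ℂ) ^ 2) N x) (𝓝[≠] 1) (𝓝 (N.choose x : ℂ)) := by
  have factorials_ne : (x.factorial : ℂ) * ((N - x).factorial : ℂ) ≠ 0 := by
    exact_mod_cast mul_ne_zero x.factorial_ne_zero (N - x).factorial_ne_zero
  rw [Nat.cast_choose ℂ hx]
  refine ((tendsto_qpoch_self_div N).div ((tendsto_qpoch_self_div x).mul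
    (tendsto_qpoch_self_div (N - x))) factorials_ne).congr' ?_
  filter_upwards [eventually_pos_ne_one] with q hq
  have pow_ne := pow_ne_zero N (one_sub_sq_ne_zero hq)
  rw [Pi.div_apply, div_mul_div_comm, ← pow_add, Nat.add_sub_cancel' hx,
    div_div_div_cancel_right₀ pow_ne, qbinom]

/-- A quarter of the period `2πi / log q` of `z ↦ q^z`. -/
noncomputable def quarterPeriod (q : ℝ) : ℂ := Complex.I * Real.pi / (2 * (Real.log q : ℂ))

lemma quarterPeriod_inv (q : ℝ) : quarterPeriod q⁻¹ = -quarterPeriod q := by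
  simp [quarterPeriod, Real.log_inv, div_neg]

lemma qpow_two_mul_quarterPeriod {q : ℝ} (hq : 0 < q ∧ q ≠ 1) :
    qpow q (2 * quarterPeriod q) = -1 := by
  have q_ne : (q : ℂ) ≠ 0 := by exact_mod_cast hq.1.ne'
  have log_ne : (Real.log q : ℂ) ≠ 0 := by
    exact_mod_cast Real.log_ne_zero_of_pos_of_ne_one hq.1 hq.2
  rw [qpow, Complex.cpow_def_of_ne_zero q_ne, ← Complex.ofReal_log hq.1.le,
    ← Complex.exp_pi_mul_I, quarterPeriod]
  congr 1
  field_simp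

lemma qpow_add_int_mul {q : ℝ} (hq : 0 < q) {τ : ℂ} (hτ : qpow q (2 * τ) = -1) (s : ℂ) (n : ℤ)
    {z : ℂ} (hz : z = s + n * (2 * τ)) : qpow q z = (-1) ^ n * qpow q s := by
  rw [hz, qpow_add hq, ← hτ, mul_comm]
  congr 1
  exact Complex.cpow_int_mul _ _ _

section Heights
variable {M : ℕ} {N : Fin M → ℕ}

lemma heightL_shift (q lam : ℝ) (ζ : Config N) (i : ℕ) :
    heightL (shift q lam) ζ i = heightL lam ζ i + quarterPeriod q := by
  simp only [heightL, shift, quarterPeriod]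
  push_cast [apply_ite]
  ring

lemma heightR_shift (q rho : ℝ) (ξ : Config N) (i : ℕ) :
    heightR (shift q rho) ξ i = heightR rho ξ i + quarterPeriod q := by
  simp only [heightR, shift, quarterPeriod]
  push_cast [apply_ite]
  ring

end Heights

/-! ### Limit of the weights -/

lemma qSiteWeight_shifted {q : ℝ} (hq : 0 < q) {τ : ℂ} (hτ : qpow q (2 * τ) = -1) (x N : ℕ)
    (r : ℂ) :
    qSiteWeight x N (r + τ) q = (1 - qpow q (2 * (2 * x + r - N))) / (1 - qpow q (2 * (r - N)))
      * (qShiftedFactorial q (r - N) x / qShiftedFactorial q (r + 1) x)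
      * ((-1) ^ x * qpow q (-x * (2 * r + 1 + x - 2 * N)) / qShiftedFactorial q (-r) N)
      * qbinom ((q : ℂ) ^ 2) N x := by
  have shifted := fun s n z => qpow_add_int_mul hq hτ s n (z := z)
  have sign : (-1 : ℂ) ^ (-(x : ℤ)) = (-1) ^ x := by
    rw [zpow_neg, zpow_natCast, ← inv_pow, inv_neg_one]
  simp only [qSiteWeight, qShiftedFactorial]
  rw [shifted (2 * (2 * x + r - N)) 1 (4 * x + 2 * (r + τ) - 2 * N) (by push_cast; ring),
    shifted (2 * (r - N)) 1 (2 * (r + τ) - 2 * N) (by push_cast; ring),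
    shifted (2 * (r + 1)) 1 (2 * (r + τ) + 2) (by push_cast; ring),
    shifted (-x * (2 * r + 1 + x - 2 * N)) (-x) (-x * (2 * (r + τ) + 1 + x - 2 * N))
      (by push_cast; ring),
    shifted (2 * -r) (-1) (-2 * (r + τ)) (by push_cast; ring), sign]
  norm_num [← sub_eq_add_neg]

lemma tendsto_qSiteWeight {x N : ℕ} {r : ℝ} (hx : x ≤ N) (h : SiteRegular x N r) {τ : ℝ → ℂ}
    (hτ : ∀ᶠ q : ℝ in 𝓝[≠] 1, qpow q (2 * τ q) = -1) :
    Tendsto (fun q : ℝ => (1 - (q : ℂ) ^ 2) ^ N * qSiteWeight x N (r + τ q) q) (𝓝[≠] 1)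
      (𝓝 ((siteWeight x N r : ℝ) : ℂ)) := by
  have top := tendsto_one_sub_qpow_div (2 * x + r - N : ℝ)
  have low := tendsto_one_sub_qpow_div (r - N : ℝ)
  have num := tendsto_qShiftedFactorial_div (r - N) x
  have den := tendsto_qShiftedFactorial_div (r + 1) x
  have norm := tendsto_qShiftedFactorial_div (-r) N
  have power := (tendsto_qpow_one (-x * (2 * r + 1 + x - 2 * N))).const_mul ((-1) ^ x)
  have limit := (((top.div low (Complex.ofReal_ne_zero.2 h.low)).mul
    (num.div den (Complex.ofReal_ne_zero.2 h.den))).mul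
    (power.div norm (Complex.ofReal_ne_zero.2 h.norm))).mul (tendsto_qbinom hx)
  convert limit.congr' ?_ using 2
  · rw [siteWeight]
    push_cast
    simp only [div_eq_mul_inv, mul_inv]
    ring
  · filter_upwards [eventually_pos_ne_one, hτ] with q hq hτq
    have hu := one_sub_sq_ne_zero hq
    rw [qSiteWeight_shifted hq.1 hτq]
    push_cast
    simp only [Pi.div_apply]
    rw [div_div_div_cancel_right₀ hu, div_div_div_cancel_right₀ (pow_ne_zero _ hu),
      div_div_eq_mul_div]
    ring

/-! ### Limit of the `q`-Racah polynomials -/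

/-- The `q`-analogue of `hyperTerm`: the `n`-th term of the `₄φ₃` to the base `q²` and with
argument `q²` whose parameters are `q^(2X)`, …, `q^(2D)`. -/
noncomputable def qHyperTerm (q : ℝ) (X σ s t A B D : ℂ) (n : ℕ) : ℂ :=
  qShiftedFactorial q X n * qShiftedFactorial q σ n * qShiftedFactorial q s n
      * qShiftedFactorial q t n
    / (qShiftedFactorial q A n * qShiftedFactorial q B n * qShiftedFactorial q D n)
    * (((q : ℂ) ^ 2) ^ n / qpoch ((q : ℂ) ^ 2) ((q : ℂ) ^ 2) n)

lemma qRacah_qpow {q : ℝ} (hq : 0 < q) {n x m : ℕ} (h : min n x < m) (α β γ δ : ℂ) :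
    qRacah n x (qpow q (2 * α)) (qpow q (2 * β)) (qpow q (2 * γ)) (qpow q (2 * δ)) ((q : ℂ) ^ 2)
      = ∑ k ∈ Finset.range m, qHyperTerm q (-n) (n + α + β + 1) (-x) (x + γ + δ + 1)
        (α + 1) (β + δ + 1) (γ + 1) k := by
  have neg (j : ℕ) : (((q : ℂ) ^ 2) ^ j)⁻¹ = qpow q (2 * -j) := by
    rw [mul_neg, qpow_neg, qpow_two_mul_natCast]
  have add_natCast (a : ℂ) (j : ℕ) :
      qpow q (2 * a) * ((q : ℂ) ^ 2) ^ j = qpow q (2 * (a + j)) := by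
    rw [mul_add, qpow_add hq, qpow_two_mul_natCast]
  have add_one (a : ℂ) : qpow q (2 * a) * (q : ℂ) ^ 2 = qpow q (2 * (a + 1)) := by
    simpa using add_natCast a 1
  have add (a b : ℂ) : qpow q (2 * a) * qpow q (2 * b) = qpow q (2 * (a + b)) := by
    rw [mul_add, qpow_add hq]
  rw [qRacah, qhyper, tsum_eq_sum (s := Finset.range m)]
  · refine Finset.sum_congr rfl fun k _ => ?_
    simp only [List.map_cons, List.map_nil, List.prod_cons, List.prod_nil, mul_one, neg,
      add, add_natCast, add_one, qHyperTerm, qShiftedFactorial]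
    push_cast
    ring_nf
  · intro k hk
    rw [Finset.mem_range, not_lt] at hk
    have upper_vanishes : qShiftedFactorial q (-n) k = 0 ∨ qShiftedFactorial q (-x) k = 0 :=
      (lt_or_ge n k).imp (qShiftedFactorial_neg_eq_zero hq)
        fun hnk => qShiftedFactorial_neg_eq_zero hq (by omega)
    rcases upper_vanishes with h | h <;> rw [qShiftedFactorial] at h <;>
      simp only [List.map_cons, List.prod_cons, neg, h, zero_mul, mul_zero, zero_div]

lemma tendsto_qHyperTerm {X σ s t A B D : ℝ} {n : ℕ} (hA : poch A n ≠ 0) (hB : poch B n ≠ 0)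
    (hD : poch D n ≠ 0) :
    Tendsto (fun q : ℝ => qHyperTerm q X σ s t A B D n) (𝓝[≠] 1)
      (𝓝 ((hyperTerm X σ s t A B D n : ℝ) : ℂ)) := by
  have factor (a : ℝ) := tendsto_qShiftedFactorial_div a n
  have base_tendsto : Tendsto (fun q : ℝ => ((q : ℂ) ^ 2) ^ n) (𝓝[≠] 1) (𝓝 1) := by
    simpa only [qpow_two_mul_natCast] using tendsto_qpow_one (2 * n)
  have denominator_ne : ((poch A n : ℝ) : ℂ) * (poch B n : ℝ) * (poch D n : ℝ) ≠ 0 := by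
    exact_mod_cast mul_ne_zero (mul_ne_zero hA hB) hD
  have limit := ((((factor X).mul (factor σ)).mul (factor s)).mul (factor t)).div
    (((factor A).mul (factor B)).mul (factor D)) denominator_ne |>.mul
    (base_tendsto.div (tendsto_qpoch_self_div n) (by exact_mod_cast n.factorial_ne_zero))
  convert limit.congr' ?_ using 2
  · rw [hyperTerm]
    push_cast
    ring
  · filter_upwards [eventually_pos_ne_one] with q hq
    have pow_ne := pow_ne_zero n (one_sub_sq_ne_zero hq)
    simp only [Pi.div_apply, qHyperTerm]
    generalize (1 - (q : ℂ) ^ 2) ^ n = u at pow_ne ⊢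
    field_simp

lemma tendsto_qRacah {n x : ℕ} {α β γ δ : ℝ} (hα : poch (α + 1) (min n x) ≠ 0)
    (hβδ : poch (β + δ + 1) (min n x) ≠ 0) (hγ : poch (γ + 1) (min n x) ≠ 0) :
    Tendsto (fun q : ℝ => qRacah n x (qpow q (2 * α)) (qpow q (2 * β)) (qpow q (2 * γ))
        (qpow q (2 * δ)) ((q : ℂ) ^ 2)) (𝓝[≠] 1)
      (𝓝 ((racah n x α β γ δ : ℝ) : ℂ)) := by
  have range_bound := Nat.lt_succ_self (min n x)
  rw [racah_eq_hyperSum range_bound, hyperSum, Complex.ofReal_sum]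
  refine (tendsto_finsetSum _ fun k hk => ?_).congr' (eventually_pos_ne_one.mono fun q hq =>
    (qRacah_qpow hq.1 range_bound α β γ δ).symm)
  have hk : k ≤ min n x := Nat.lt_succ_iff.1 (Finset.mem_range.1 hk)
  convert tendsto_qHyperTerm (poch_ne_zero_of_le hk hα) (poch_ne_zero_of_le hk hβδ)
    (poch_ne_zero_of_le hk hγ) using 3 <;> push_cast <;> rfl

lemma qSiteDuality_shifted {q : ℝ} (hq : 0 < q) {τ : ℂ} (hτ : qpow q (2 * τ) = -1) (y x N : ℕ)
    (l r w : ℂ) :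
    qSiteDuality y x (l + τ) (r + τ) (qpow q w) N q
      = (-1) ^ y * qpow q (w * y - y * (y + r + l - N))
        * (qShiftedFactorial q ((r + l - N + w + 1) / 2) x
            * qShiftedFactorial q ((r + l - N - w + 1) / 2) y
            * qShiftedFactorial q (y + (l - r - N + w + 1) / 2) N
          / qShiftedFactorial q (-x + (l - r + N + w + 1) / 2) (x + y))
        * qRacah x y (qpow q (2 * ((r + l - N - w - 1) / 2)))
          (qpow q (2 * ((r - l - N + w - 1) / 2))) (qpow q (2 * (-N - 1))) (qpow q (2 * l))
          ((q : ℂ) ^ 2) := by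
  have shifted := fun s n z => qpow_add_int_mul hq hτ s n (z := z)
  have add (a b c : ℂ) (h : c = a + b) : qpow q a * qpow q b = qpow q c := by
    rw [h, qpow_add hq]
  have sign : ((-1 : ℂ) ^ y)⁻¹ = (-1) ^ y := by rw [← inv_pow, inv_neg_one]
  have pow_y : qpow q w ^ y = qpow q (w * y) := by
    rw [mul_comm w]
    exact (Complex.cpow_nat_mul _ _ _).symm
  simp only [qSiteDuality, qShiftedFactorial]
  rw [shifted (r + l - N + 1) 1 (r + τ + (l + τ) - N + 1) (by push_cast; ring),
    shifted (2 * y - r + l - N + 1) 0 (2 * y - (r + τ) + (l + τ) - N + 1) (by push_cast; ring),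
    shifted (y * (y + r + l - N)) y (y * (y + (r + τ) + (l + τ) - N)) (by push_cast; ring),
    shifted (-2 * x - r + l + N + 1) 0 (-2 * x - (r + τ) + (l + τ) + N + 1)
      (by push_cast; ring),
    shifted (r + l - N - 1) 1 (r + τ + (l + τ) - N - 1) (by push_cast; ring),
    shifted (r - l - N - 1) 0 (r + τ - (l + τ) - N - 1) (by push_cast; ring),
    shifted (2 * l) 1 (2 * (l + τ)) (by push_cast; ring), ← qpow_neg, pow_y]
  simp only [zpow_one, zpow_zero, zpow_natCast, one_mul, neg_mul, neg_neg, mul_neg]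
  rw [add w (r + l - N + 1) (2 * ((r + l - N + w + 1) / 2)) (by ring),
    add (-w) (r + l - N + 1) (2 * ((r + l - N - w + 1) / 2)) (by ring),
    add w (2 * y - r + l - N + 1) (2 * (y + (l - r - N + w + 1) / 2)) (by ring),
    add w (-(2 * x) - r + l + N + 1) (2 * (-x + (l - r + N + w + 1) / 2)) (by ring),
    add (-w) (r + l - N - 1) (2 * ((r + l - N - w - 1) / 2)) (by ring),
    add w (r - l - N - 1) (2 * ((r - l - N + w - 1) / 2)) (by ring),
    sub_eq_add_neg (w * y), qpow_add hq, qpow_neg, show -(2 * (N : ℂ)) - 2 = 2 * (-N - 1) by ring]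
  simp only [div_eq_mul_inv, mul_inv, sign]
  ring

lemma tendsto_qSiteDuality {x y N : ℕ} {l r w : ℝ} (hN : min x y ≤ N)
    (hsub : poch ((r + l - N - w + 1) / 2) (min x y) ≠ 0)
    (hadd : poch ((r + l - N + w + 1) / 2) (min x y) ≠ 0)
    (hden : poch (-(x : ℝ) + (l - r + N + w + 1) / 2) (x + y) ≠ 0) {τ : ℝ → ℂ}
    (hτ : ∀ᶠ q : ℝ in 𝓝[≠] 1, qpow q (2 * τ q) = -1) :
    Tendsto (fun q : ℝ => ((1 - (q : ℂ) ^ 2) ^ N)⁻¹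
        * qSiteDuality y x (l + τ q) (r + τ q) (qpow q w) N q) (𝓝[≠] 1)
      (𝓝 (((-1) ^ y * siteDuality y x l r w N : ℝ) : ℂ)) := by
  have sign_power := (tendsto_qpow_one (w * y - y * (y + r + l - N))).const_mul ((-1) ^ y)
  have factors := (((tendsto_qShiftedFactorial_div ((r + l - N + w + 1) / 2) x).mul
    (tendsto_qShiftedFactorial_div ((r + l - N - w + 1) / 2) y)).mul
    (tendsto_qShiftedFactorial_div (y + (l - r - N + w + 1) / 2) N)).div
    (tendsto_qShiftedFactorial_div (-x + (l - r + N + w + 1) / 2) (x + y))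
    (Complex.ofReal_ne_zero.2 hden)
  have polynomial := tendsto_qRacah (n := x) (x := y) (α := (r + l - N - w - 1) / 2)
    (β := (r - l - N + w - 1) / 2) (γ := -N - 1) (δ := l) (by convert hsub using 2; ring)
    (by convert hadd using 2; ring) (by simpa using poch_neg_ne_zero hN)
  convert ((sign_power.mul factors).mul polynomial).congr' ?_ using 2
  · rw [siteDuality]
    push_cast
    ring
  · filter_upwards [eventually_pos_ne_one, hτ] with q hq hτq
    have hx := pow_ne_zero x (one_sub_sq_ne_zero hq)
    have hy := pow_ne_zero y (one_sub_sq_ne_zero hq)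
    rw [qSiteDuality_shifted hq.1 hτq]
    push_cast
    simp only [Pi.div_apply, pow_add]
    generalize (1 - (q : ℂ) ^ 2) ^ x = ux at hx ⊢
    generalize (1 - (q : ℂ) ^ 2) ^ y = uy at hy ⊢
    field_simp

section Products
variable {M : ℕ} {N : Fin M → ℕ}

lemma eventually_qpow_two_mul_quarterPeriod :
    ∀ᶠ q : ℝ in 𝓝[≠] 1, qpow q (2 * quarterPeriod q) = -1 :=
  eventually_pos_ne_one.mono fun _ => qpow_two_mul_quarterPeriod

theorem tendsto_qDuality {lam rho v : ℝ} (hv : DualityDefined N lam rho v) (ζ ξ : Config N) :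
    Tendsto (fun q : ℝ => ((1 - (q : ℂ) ^ 2) ^ capacity N)⁻¹
        * qDuality (shift q lam) (shift q rho) ((q ^ v : ℝ) : ℂ) q ζ ξ)
      (𝓝[≠] (1 : ℝ)) (𝓝 (((-1) ^ particles ζ * duality lam rho v ζ ξ : ℝ) : ℂ)) := by
  have limit_eq_prod : ((-1) ^ particles ζ * duality lam rho v ζ ξ : ℝ)
      = ∏ k : Fin M, ((-1) ^ (ζ k : ℕ)
        * siteDuality (ζ k) (ξ k) (heightL lam ζ k) (heightR rho ξ (k + 1)) v (N k)) := by
    rw [Finset.prod_mul_distrib, Finset.prod_pow_eq_pow_sum, particles, duality]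
  rw [limit_eq_prod, Complex.ofReal_prod]
  refine (tendsto_finsetProd _ fun k _ => ?_).congr' (f₁ := fun q : ℝ => ∏ k,
    ((1 - (q : ℂ) ^ 2) ^ N k)⁻¹ * qSiteDuality (ζ k) (ξ k) (heightL lam ζ k + quarterPeriod q)
      (heightR rho ξ (k + 1) + quarterPeriod q) (qpow q v) (N k) q) ?_
  · obtain ⟨hsub, hadd, hden⟩ := hv ζ ξ k
    rw [min_comm] at hsub hadd
    exact tendsto_qSiteDuality ((min_le_right _ _).trans (ζ.le k)) hsub hadd hden
      eventually_qpow_two_mul_quarterPeriod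
  · filter_upwards [eventually_pos_ne_one] with q hq
    simp only [Finset.prod_mul_distrib, Finset.prod_inv_distrib, Finset.prod_pow_eq_pow_sum,
      qDuality, heightL_shift, heightR_shift, capacity, qpow, Complex.ofReal_cpow hq.1.le]

theorem tendsto_qWeightR {rho : ℝ} (h : WeightDefined N rho) (ξ : Config N) :
    Tendsto (fun q : ℝ => (1 - (q : ℂ) ^ 2) ^ capacity N * qWeightR (shift q rho) q ξ)
      (𝓝[≠] (1 : ℝ)) (𝓝 ((weightR rho ξ : ℝ) : ℂ)) := by
  rw [weightR, Complex.ofReal_prod]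
  refine (tendsto_finsetProd _ fun k _ => tendsto_qSiteWeight (ξ.le k) (h.siteRegularR ξ k)
    eventually_qpow_two_mul_quarterPeriod).congr fun q => ?_
  simp only [Finset.prod_mul_distrib, Finset.prod_pow_eq_pow_sum, qWeightR, heightR_shift,
    capacity]

lemma tendsto_inv_punctured_one : Tendsto (fun q : ℝ => q⁻¹) (𝓝[≠] 1) (𝓝[≠] 1) := by
  refine tendsto_nhdsWithin_iff.2 ⟨?_, ?_⟩
  · simpa using (continuousAt_inv₀ (one_ne_zero (α := ℝ))).tendsto.mono_left nhdsWithin_le_nhds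
  · filter_upwards [self_mem_nhdsWithin] with q hq
    exact inv_ne_one.2 hq

lemma tendsto_qSiteWeight_inv {x N : ℕ} {r : ℝ} (hx : x ≤ N) (h : SiteRegular x N r) :
    Tendsto (fun q : ℝ => (1 - (q : ℂ) ^ 2) ^ N * qSiteWeight x N (r + quarterPeriod q) q⁻¹)
      (𝓝[≠] 1) (𝓝 (((-1) ^ N * siteWeight x N r : ℝ) : ℂ)) := by
  have quarter : ∀ᶠ q : ℝ in 𝓝[≠] 1, qpow q (2 * quarterPeriod q⁻¹) = -1 := by
    filter_upwards [eventually_qpow_two_mul_quarterPeriod] with q hq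
    rw [quarterPeriod_inv, mul_neg, qpow_neg, hq, inv_neg_one]
  have inverted := (tendsto_qSiteWeight hx h quarter).comp tendsto_inv_punctured_one
  have ratio := ((tendsto_qpow_one 2).neg).pow N
  convert (ratio.mul inverted).congr' ?_ using 2
  · push_cast
    rfl
  · filter_upwards [eventually_pos_ne_one] with q hq
    have q_ne : (q : ℂ) ≠ 0 := by exact_mod_cast hq.1.ne'
    have factor : -qpow q 2 * (1 - ((q⁻¹ : ℝ) : ℂ) ^ 2) = 1 - (q : ℂ) ^ 2 := by
      rw [qpow, Complex.cpow_ofNat]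
      push_cast
      field_simp
      ring
    simp only [Function.comp_apply, inv_inv]
    rw [← mul_assoc, ← mul_pow, factor]

theorem tendsto_qWeightL {lam : ℝ} (h : WeightDefined N lam) (ζ : Config N) :
    Tendsto (fun q : ℝ => (1 - (q : ℂ) ^ 2) ^ capacity N * qWeightL (shift q lam) q ζ)
      (𝓝[≠] (1 : ℝ)) (𝓝 ((weightL lam ζ : ℝ) : ℂ)) := by
  rw [weightL, Complex.ofReal_prod]
  refine (tendsto_finsetProd _ fun k _ =>
    tendsto_qSiteWeight_inv (ζ.le k) (h.siteRegularL ζ k)).congr fun q => ?_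
  simp only [Finset.prod_mul_distrib, Finset.prod_pow_eq_pow_sum, qWeightL, heightL_shift,
    capacity]

end Products

end DynSSEP

theorem proposition5p3 {M : ℕ} (N : Fin M → ℕ) (hN : ∀ k, 0 < N k) (lam rho v : ℝ)
    (hv : DualityDefined N lam rho v) :
    -- the duality function is, up to the sign `(-1)^|ζ|`, the limit of the q-Racah duality function
    (∀ ζ ξ : Config N,
      Filter.Tendsto
        (fun q : ℝ => ((1 - (q : ℂ) ^ 2) ^ capacity N)⁻¹
          * qDuality (shift q lam) (shift q rho) ((q ^ v : ℝ) : ℂ) q ζ ξ)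
        (𝓝[≠] (1 : ℝ)) (𝓝 (((-1) ^ particles ζ * duality lam rho v ζ ξ : ℝ) : ℂ))) ∧
    -- duality
    (RatesDefinedL N lam → RatesDefinedR N rho →
      IsDuality (generatorL N lam) (generatorR N rho) (duality lam rho v)) ∧
    -- the weights of the two processes: limits of the q-weights, nonzero, reversible
    (WeightDefined N lam →
      (∀ ζ : Config N,
        Filter.Tendsto (fun q : ℝ => (1 - (q : ℂ) ^ 2) ^ capacity N * qWeightL (shift q lam) q ζ)
          (𝓝[≠] (1 : ℝ)) (𝓝 ((weightL lam ζ : ℝ) : ℂ)) ∧ weightL lam ζ ≠ 0) ∧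
      IsReversible (generatorL N lam) (weightL lam)) ∧
    (WeightDefined N rho →
      (∀ ξ : Config N,
        Filter.Tendsto (fun q : ℝ => (1 - (q : ℂ) ^ 2) ^ capacity N * qWeightR (shift q rho) q ξ)
          (𝓝[≠] (1 : ℝ)) (𝓝 ((weightR rho ξ : ℝ) : ℂ)) ∧ weightR rho ξ ≠ 0) ∧
      IsReversible (generatorR N rho) (weightR rho)) ∧
    -- biorthogonality
    (WeightDefined N lam → WeightDefined N rho → DualityDefined N lam rho (-v) →
      (∀ ξ ξ' : Config N,
        ∑ ζ : Config N, duality lam rho v ζ ξ * duality lam rho (-v) ζ ξ' * weightL lam ζ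
          = (if ξ = ξ' then 1 else 0) / weightR rho ξ) ∧
      (∀ ζ ζ' : Config N,
        ∑ ξ : Config N, duality lam rho v ζ ξ * duality lam rho (-v) ζ' ξ * weightR rho ξ
          = (if ζ = ζ' then 1 else 0) / weightL lam ζ)) := by
  refine ⟨tendsto_qDuality hv, isDuality_duality hN hv,
    fun hL => ⟨fun ζ => ⟨tendsto_qWeightL hL ζ, hL.weightL_ne_zero ζ⟩, isReversible_weightL hN hL⟩,
    fun hR => ⟨fun ξ => ⟨tendsto_qWeightR hR ξ, hR.weightR_ne_zero ξ⟩, isReversible_weightR hN hR⟩,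
    fun hL hR hv' => ⟨duality_orthogonal hL hR hv hv', ?_⟩⟩
  exact dual_orthogonal hL.weightL_ne_zero hR.weightR_ne_zero (duality_orthogonal hL hR hv hv')
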